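/- Let $d\in\mathbb N$, $1\le\alpha<2$. Let $M:\mathbb R^d\to(0,\infty)$ be twice differentiable with $M(-v)=M(v)$, $\int_{\mathbb R^d} M\,dv=1$, $|v|^{d+\alpha}M(v)\to\gamma$ as $|v|\to\infty$ for some $\gamma>0$, and, for some constant $C$ and all $v$, $$|D_vM(v)|\le C\frac{M(v)}{1+|v|},\qquad |D_v^2M(v)|\le C\,M(v).$$ Let $\sigma:\mathbb R^d\times\mathbb R^d\to\mathbb R$ be such that $\sigma(v,v')=\sigma(v',v)$ and $\nu_1\le\sigma(v,v')\le\nu_2$ for some constants $0<\nu_1\le\nu_2$, such that $v\mapsto\sigma(v',v)$ is $C^1$ for every $v'$ with $|\nabla_v\sigma(v',v)|\le \frac{C}{1+|v|}$ for all $v,v'$, such that $\nu(v):=\int\sigma(v',v)M(v')\,dv'$ is even, and such that, for some $\nu_0$, $|\sigma(v,v')-\nu_0|\le\frac{C}{1+|v|}$ for all $v,v'$. Set $$Q(f)(v)=\int_{\mathbb R^d}\big(\sigma(v,v')M(v)f(v')-\sigma(v',v)M(v')f(v)\big)\,dv'.$$ Then there is a function $F:\mathbb R^d\times\mathbb R^d\to\mathbb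 R$, $(v,E)\mapsto F(v,E)$, with the following properties. (i) For every $E\in\mathbb R^d$, the function $F(\cdot,E)$ is of class $C^1$, belongs to $L^2(\mathbb R^d, M^{-1}dv)\cap L^1(\mathbb R^d)$, and solves $$E\cdot\nabla_vF-Q(F)=0,\qquad \int_{\mathbb R^d}F(v,E)\,dv=1,$$ pointwise and in the sense of distributions. It is the unique such solution: every $f\in L^1(\mathbb R^d)$ (in particular every $f\in L^2(\mathbb R^d,M^{-1}dv)$) with $\int f\,dv=1$ and $E\cdot\nabla_vf-Q(f)=0$ in the sense of distributions is equal to $F(\cdot,E)$ almost everywhere. (ii) For every $R>0$ there are constants $c(R),C(R)>0$ such that $c(R)M(v)\le F(v,E)\le C(R)M(v)$ for all $v\in\mathbb R^d$ and all $|E|\le R$. (iii) For every $v\in\mathbb R^d$ the function $E\mapsto F(v,E)$ is $C^1$ on $\mathbb R^d$, and for every $R>0$ there is $C(R)>0$ such that $$|\partial_EF(v,E)|\le C(R)\frac{F(v,E)}{1+|v|}\qquad\text{for all } v\in\mathbb R^d,\ |E|\le R.$$ -/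

import Mathlib

open MeasureTheory Filter Topology
open scoped ContDiff

namespace LinearBoltzmann

/-- The velocity space `ℝ^d` with its Euclidean norm and Lebesgue measure. -/
abbrev Vel (d : ℕ) : Type := EuclideanSpace ℝ (Fin d)

/-- The linear Boltzmann operator
`Q(f)(v) = ∫ (σ(v,v') M(v) f(v') - σ(v',v) M(v') f(v)) dv'`. -/
noncomputable def collision {d : ℕ} (M : Vel d → ℝ) (σ : Vel d → Vel d → ℝ)
    (f : Vel d → ℝ) (v : Vel d) : ℝ :=
  ∫ v', (σ v v' * M v * f v' - σ v' v * M v' * f v)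

/-- The collision frequency `ν(v) = ∫ σ(v',v) M(v') dv'`. -/
noncomputable def collisionFrequency {d : ℕ} (M : Vel d → ℝ) (σ : Vel d → Vel d → ℝ)
    (v : Vel d) : ℝ :=
  ∫ v', σ v' v * M v'

/-- The assumptions on the heavy-tailed equilibrium `M`: a positive even probability density,
with `|v|^(d+α) M(v) → γ > 0` at infinity, twice differentiable, with
`|DM| ≤ C M / (1+|v|)` and `|D²M| ≤ C M`. -/
structure IsHeavyTailEquilibrium {d : ℕ} (α : ℝ) (M : Vel d → ℝ) : Prop where
  pos : ∀ v, 0 < M v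
  even : ∀ v, M (-v) = M v
  integral_eq_one : (∫ v, M v) = 1
  tail : ∃ γ : ℝ, 0 < γ ∧
    Tendsto (fun v : Vel d => ‖v‖ ^ ((d : ℝ) + α) * M v) (cocompact (Vel d)) (𝓝 γ)
  differentiable : Differentiable ℝ M
  differentiable_fderiv : Differentiable ℝ (fderiv ℝ M)
  fderiv_bound : ∃ C : ℝ, ∀ v, ‖fderiv ℝ M v‖ ≤ C * (M v / (1 + ‖v‖))
  fderiv_fderiv_bound : ∃ C : ℝ, ∀ v, ‖fderiv ℝ (fderiv ℝ M) v‖ ≤ C * M v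

/-- The assumptions on the cross section `σ` (relative to `M`): symmetric, bounded between two
positive constants, of class `C¹` with respect to the velocity and with
`|∇_v σ(v',v)| ≤ C / (1+|v|)`, with even collision frequency, and with
`|σ(v,v') - ν₀| ≤ C / (1+|v|)` for some constant `ν₀`. -/
structure IsCrossSection {d : ℕ} (M : Vel d → ℝ) (σ : Vel d → Vel d → ℝ) : Prop where
  symm : ∀ v v', σ v v' = σ v' v
  bounds : ∃ ν₁ ν₂ : ℝ, 0 < ν₁ ∧ ∀ v v', ν₁ ≤ σ v v' ∧ σ v v' ≤ ν₂
  contDiff : ∀ v', ContDiff ℝ 1 (fun v => σ v' v)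
  fderiv_bound : ∃ C : ℝ, ∀ v' v, ‖fderiv ℝ (fun w => σ v' w) v‖ ≤ C / (1 + ‖v‖)
  frequency_even : ∀ v, collisionFrequency M σ (-v) = collisionFrequency M σ v
  limit : ∃ ν₀ C : ℝ, ∀ v v', |σ v v' - ν₀| ≤ C / (1 + ‖v‖)

/-- `f` is an integrable solution, in the sense of distributions, of
`E · ∇_v f - Q(f) = 0`, with `∫ f = 1`. Here `fderiv ℝ φ v E` is `E · ∇_v φ(v)`.
Every function of the weighted space `L²(M⁻¹ dv)` is integrable, so this class contains all the
normalized solutions in that space. -/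
structure IsNormalizedSolution {d : ℕ} (M : Vel d → ℝ) (σ : Vel d → Vel d → ℝ) (E : Vel d)
    (f : Vel d → ℝ) : Prop where
  integrable : Integrable f
  integral_eq_one : (∫ v, f v) = 1
  equation : ∀ φ : Vel d → ℝ, ContDiff ℝ ∞ φ → HasCompactSupport φ →
    -(∫ v, f v * fderiv ℝ φ v E) - (∫ v, collision M σ f v * φ v) = 0

end LinearBoltzmann

/-! Write K f = ∫ σ(·,v') f(v') dv' (`gain`). Then Q(f) = M K f - ν f, so the equation reads E·∇f +
ν f = M K f. Integrating along the field lines inverts the left side and gives f = T_E (K f), where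
T_E g (v) = ∫₀^∞ exp(-∫₀ᵗ ν(v - sE) ds) (M g)(v - tE) dt (`resolvent`). Solutions thus correspond to
bounded fixed points g = K f of K T_E. Since ν ≥ ν₁ > 0 the kernel decays exponentially in t, while
translating M by tE costs only a power of 1 + t; hence |T_E g| ≤ C(R) M sup |g| for |E| ≤ R.

The operator K T_E preserves ∫ g M, and for g ≥ 0 it satisfies the Doeblin bound K T_E g ≥ (ν₁/ν₂) ∫
g M. So B g = K T_E g - κ ∫ g M (`reducedGain`) is positive for small κ, contracts L¹(M) by the
factor 1 - κ (`integral_abs_reducedGain_le`) and maps L¹(M) into bounded functions. The series G = ∑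
Bⁿ 1 converges and G = 1 + B G; integrating against M gives κ ∫ G M = 1, whence K T_E G = G. The
solution is F = T_E G after normalization. The lower bound in (ii) comes from G = K F ≥ ν₁ and the
times t ≤ 1 in T_E.

For uniqueness, a weak solution f equals T_E (K f) almost everywhere, because the homogeneous
transport equation has no nonzero integrable weak solution: this is tested by duality against the
resolvent of the reversed field. The contraction then forces K f to be a multiple of G.

The field derivative does not commute with T_E, but the commutator involves only the kernel and ∂_v,
and gains a factor 1/(1+|v|) (`abs_fderiv_fieldResolvent_sub_le`). The v-derivative of Bⁿ 1 falls on
σ and is geometrically small, so ∂_E Bⁿ 1 = O((n+1)(1-κ)ⁿ) and G is C¹ in (E, v). For (iii), ∂_E F =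
T_E(∂_E G) + O(M/(1+|v|)) and ∂_E G = K(∂_E F). Since ∂_E F has zero mass, σ may be replaced by σ -
ν₀ in K, and this supplies the missing decay. -/

namespace LinearBoltzmann

/-! ### Differentiation under the integral sign -/

/-- Differentiation under the integral sign, `C¹` version: a family of `C¹` functions which is
locally dominated together with its derivative has a `C¹` integral. -/
theorem contDiff_one_integral {X P : Type*} [MeasurableSpace X]
    [NormedAddCommGroup P] [NormedSpace ℝ P]
    {μ : Measure X} {f : X → P → ℝ} (hm : ∀ p, AEStronglyMeasurable (fun x => f x p) μ)
    (hm' : ∀ p, AEStronglyMeasurable (fun x => fderiv ℝ (f x) p) μ)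
    (hd : ∀ x, ContDiff ℝ 1 (f x))
    (hb : ∀ p₀, ∃ s ∈ 𝓝 p₀, ∃ b : X → ℝ, Integrable b μ ∧
      ∀ᵐ x ∂μ, ∀ p ∈ s, |f x p| ≤ b x ∧ ‖fderiv ℝ (f x) p‖ ≤ b x) :
    ContDiff ℝ 1 (fun p => ∫ x, f x p ∂μ) ∧
      ∀ p, Integrable (fun x => fderiv ℝ (f x) p) μ ∧
        fderiv ℝ (fun p => ∫ x, f x p ∂μ) p = ∫ x, fderiv ℝ (f x) p ∂μ := by
  have hint : ∀ p, Integrable (fun x => fderiv ℝ (f x) p) μ := by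
    intro p
    obtain ⟨s, hs, b, hbi, hbd⟩ := hb p
    exact hbi.mono' (hm' p) (hbd.mono fun x hx => (hx p (mem_of_mem_nhds hs)).2)
  have hder : ∀ p, HasFDerivAt (fun p => ∫ x, f x p ∂μ) (∫ x, fderiv ℝ (f x) p ∂μ) p := by
    intro p
    obtain ⟨s, hs, b, hbi, hbd⟩ := hb p
    exact hasFDerivAt_integral_of_dominated_of_fderiv_le (F := fun p x => f x p)
      (F' := fun p x => fderiv ℝ (f x) p) hs
      (Eventually.of_forall hm)
      (hbi.mono' (hm p) (hbd.mono fun x hx => (hx p (mem_of_mem_nhds hs)).1)) (hm' p)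
      (hbd.mono fun x hx p hp => (hx p hp).2) hbi
      (Eventually.of_forall fun x p _ => ((hd x).differentiable one_ne_zero p).hasFDerivAt)
  refine ⟨contDiff_one_iff_fderiv.2 ⟨fun p => (hder p).differentiableAt, ?_⟩,
    fun p => ⟨hint p, (hder p).fderiv⟩⟩
  have : fderiv ℝ (fun p => ∫ x, f x p ∂μ) = fun p => ∫ x, fderiv ℝ (f x) p ∂μ :=
    funext fun p => (hder p).fderiv
  rw [this]
  refine continuous_iff_continuousAt.2 fun p => ?_
  obtain ⟨s, hs, b, hbi, hbd⟩ := hb p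
  refine continuousAt_of_dominated (Eventually.of_forall hm') ?_ hbi
    (Eventually.of_forall fun x => ((hd x).continuous_fderiv one_ne_zero).continuousAt)
  filter_upwards [hs] with q hq
  exact hbd.mono fun x hx => (hx q hq).2

theorem aestronglyMeasurable_fderiv_of_continuous {X P : Type*} [TopologicalSpace X]
    [SecondCountableTopology X] [MeasurableSpace X] [OpensMeasurableSpace X]
    [NormedAddCommGroup P] [NormedSpace ℝ P] [FiniteDimensional ℝ P]
    {μ : Measure X} {f : X → P → ℝ} (hc : Continuous f.uncurry) (p : P) :
    AEStronglyMeasurable (fun x => fderiv ℝ (f x) p) μ := by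
  borelize P
  have hFD : ProperSpace P := FiniteDimensional.proper_real P
  exact ((measurable_fderiv_with_param ℝ hc).comp
    (measurable_id.prodMk measurable_const)).aestronglyMeasurable

/-- `contDiff_one_integral` for a jointly continuous family. -/
theorem contDiff_one_integral_of_continuous {X P : Type*} [TopologicalSpace X]
    [SecondCountableTopology X] [MeasurableSpace X] [OpensMeasurableSpace X]
    [NormedAddCommGroup P] [NormedSpace ℝ P] [FiniteDimensional ℝ P]
    {μ : Measure X} {f : X → P → ℝ} (hc : Continuous f.uncurry) (hd : ∀ x, ContDiff ℝ 1 (f x))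
    (hb : ∀ p₀, ∃ s ∈ 𝓝 p₀, ∃ b : X → ℝ, Integrable b μ ∧
      ∀ᵐ x ∂μ, ∀ p ∈ s, |f x p| ≤ b x ∧ ‖fderiv ℝ (f x) p‖ ≤ b x) :
    ContDiff ℝ 1 (fun p => ∫ x, f x p ∂μ) ∧
      ∀ p, Integrable (fun x => fderiv ℝ (f x) p) μ ∧
        fderiv ℝ (fun p => ∫ x, f x p ∂μ) p = ∫ x, fderiv ℝ (f x) p ∂μ :=
  contDiff_one_integral
    (fun p => (hc.comp (Continuous.prodMk_left p)).aestronglyMeasurable)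
    (fun p => aestronglyMeasurable_fderiv_of_continuous hc p) hd hb

/-! ### Polynomial weights and exponential moments -/

theorem one_add_norm_le_mul {G : Type*} [SeminormedAddCommGroup G] (v w : G) :
    1 + ‖v‖ ≤ (1 + ‖v - w‖) * (1 + ‖w‖) := by
  have := norm_sub_norm_le v w
  nlinarith [norm_nonneg (v - w), norm_nonneg w, norm_nonneg v]

/-- Peetre's inequality. It trades decay at the shifted velocity v - tE for decay at v, at the price
of a factor linear in t that the exponential absorbs. -/
theorem inv_one_add_norm_sub_le {G : Type*} [SeminormedAddCommGroup G] (v w : G) :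
    (1 + ‖v - w‖)⁻¹ ≤ (1 + ‖w‖) / (1 + ‖v‖) := by
  have h1 : 0 < 1 + ‖v - w‖ := by positivity
  have h2 : 0 < 1 + ‖v‖ := by positivity
  rw [inv_eq_one_div, div_le_div_iff₀ h1 h2]
  linarith [one_add_norm_le_mul v w]

/-- Polynomially weighted exponential decay is integrable on the half line. -/
theorem integrableOn_exp_neg_mul_one_add_pow {a : ℝ} (ha : 0 < a) (m : ℕ) :
    IntegrableOn (fun t : ℝ => Real.exp (-(a * t)) * (1 + t) ^ m) (Set.Ioi 0) := by
  have h0 : IntegrableOn (fun t : ℝ => (m.factorial * (2 / a) ^ m * Real.exp (a / 2)) *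
      Real.exp (-(a / 2) * t)) (Set.Ioi 0) :=
    (exp_neg_integrableOn_Ioi 0 (half_pos ha)).const_mul _
  refine Integrable.mono' h0 (by fun_prop) ?_
  filter_upwards [ae_restrict_mem measurableSet_Ioi] with t ht
  have ht0 : (0 : ℝ) < t := ht
  rw [Real.norm_of_nonneg (by positivity)]
  -- Half of the exponential rate absorbs the polynomial, through x^m / m! ≤ e^x at x = (a/2)(1+t).
  have h1 := Real.pow_div_factorial_le_exp (a / 2 * (1 + t)) (by positivity) m
  rw [div_le_iff₀ (by positivity), mul_pow] at h1
  have h2 : (1 + t) ^ m = (2 / a) ^ m * ((a / 2) ^ m * (1 + t) ^ m) := by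
    rw [← mul_assoc, ← mul_pow]
    field_simp
    simp
  have h3 : Real.exp (-(a * t)) * Real.exp (a / 2 * (1 + t)) =
      Real.exp (a / 2) * Real.exp (-(a / 2) * t) := by
    rw [← Real.exp_add, ← Real.exp_add]; ring_nf
  calc Real.exp (-(a * t)) * (1 + t) ^ m
      ≤ Real.exp (-(a * t)) * ((2 / a) ^ m * (Real.exp (a / 2 * (1 + t)) * m.factorial)) := by
        rw [h2]; gcongr
    _ = (m.factorial * (2 / a) ^ m) *
        (Real.exp (-(a * t)) * Real.exp (a / 2 * (1 + t))) := by ring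
    _ = _ := by rw [h3]; ring

/-! ### Quantitative bounds on the equilibrium and the cross section -/

/-- Quantitative form of the assumptions on `M` and `σ`. -/
structure KineticBounds {d : ℕ} (M : Vel d → ℝ) (σ : Vel d → Vel d → ℝ)
    (ν₁ ν₂ ν₀ A : ℝ) (k : ℕ) : Prop where
  one_le : 1 ≤ A
  pos : ∀ v, 0 < M v
  integrable : Integrable M
  integral_eq_one : (∫ v, M v) = 1
  contDiff : ContDiff ℝ 1 M
  fderiv_le : ∀ v, ‖fderiv ℝ M v‖ ≤ A * M v / (1 + ‖v‖)
  le_bound : ∀ v, M v ≤ A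
  shift_le : ∀ v w, M (v - w) ≤ A * (1 + ‖w‖) ^ k * M v
  lower_pos : 0 < ν₁
  sigma_symm : ∀ v v', σ v v' = σ v' v
  sigma_ge : ∀ v v', ν₁ ≤ σ v v'
  sigma_le : ∀ v v', σ v v' ≤ ν₂
  sigma_contDiff : ∀ v', ContDiff ℝ 1 (σ v')
  sigma_fderiv_le : ∀ v' v, ‖fderiv ℝ (σ v') v‖ ≤ A / (1 + ‖v‖)
  sigma_limit : ∀ v v', |σ v v' - ν₀| ≤ A / (1 + ‖v‖)

/-- Off a compact set the tail limit gives the comparison; on it, continuity and positivity do. -/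
theorem IsHeavyTailEquilibrium.exists_two_sided {d : ℕ} {α : ℝ} (hα : 1 ≤ α) {M : Vel d → ℝ}
    (hM : IsHeavyTailEquilibrium α M) :
    ∃ c C : ℝ, 0 < c ∧ 0 < C ∧
      ∀ v, c ≤ (1 + ‖v‖) ^ ((d : ℝ) + α) * M v ∧ (1 + ‖v‖) ^ ((d : ℝ) + α) * M v ≤ C := by
  obtain ⟨γ, hγ, ht⟩ := hM.tail
  have hp : 0 ≤ (d : ℝ) + α := by positivity
  have hev : ∀ᶠ v in cocompact (Vel d), ‖v‖ ^ ((d : ℝ) + α) * M v ∈ Set.Ioo (γ / 2) (2 * γ) :=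
    ht (Ioo_mem_nhds (by linarith) (by linarith))
  obtain ⟨K, hK, hKs⟩ := mem_cocompact.1 hev
  have hcont : Continuous fun v : Vel d => (1 + ‖v‖) ^ ((d : ℝ) + α) * M v := by
    refine Continuous.mul ?_ hM.differentiable.continuous
    exact Continuous.rpow_const (by fun_prop) fun v => Or.inr hp
  have hpos : ∀ v, 0 < (1 + ‖v‖) ^ ((d : ℝ) + α) * M v := fun v =>
    mul_pos (Real.rpow_pos_of_pos (by positivity) _) (hM.pos v)
  -- Adding the unit ball makes the compact set nonempty and ensures 1 + ‖v‖ ≤ 2‖v‖ off it.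
  have hK' : IsCompact (K ∪ Metric.closedBall (0 : Vel d) 1) :=
    hK.union (isCompact_closedBall _ _)
  have hne : (K ∪ Metric.closedBall (0 : Vel d) 1).Nonempty :=
    ⟨0, Or.inr (Metric.mem_closedBall_self zero_le_one)⟩
  obtain ⟨x, -, hx⟩ := hK'.exists_isMinOn hne hcont.continuousOn
  obtain ⟨y, -, hy⟩ := hK'.exists_isMaxOn hne hcont.continuousOn
  refine ⟨min ((1 + ‖x‖) ^ ((d : ℝ) + α) * M x) (γ / 2),
    max ((1 + ‖y‖) ^ ((d : ℝ) + α) * M y) (2 ^ ((d : ℝ) + α) * (2 * γ)),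
    lt_min (hpos x) (by positivity), lt_max_of_lt_left (hpos y), fun v => ?_⟩
  by_cases hv : v ∈ K ∪ Metric.closedBall (0 : Vel d) 1
  · exact ⟨(min_le_left _ _).trans (hx hv), (hy hv).trans (le_max_left _ _)⟩
  · rw [Set.mem_union, not_or] at hv
    have h1 : 1 < ‖v‖ := by simpa using hv.2
    have h2 := hKs hv.1
    have hMv := (hM.pos v).le
    constructor
    · refine (min_le_right _ _).trans (h2.1.le.trans ?_)
      gcongr
      linarith
    · refine le_trans ?_ (le_max_right _ _)
      calc (1 + ‖v‖) ^ ((d : ℝ) + α) * M v ≤ (2 * ‖v‖) ^ ((d : ℝ) + α) * M v := by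
            gcongr; linarith
        _ = 2 ^ ((d : ℝ) + α) * (‖v‖ ^ ((d : ℝ) + α) * M v) := by
            rw [Real.mul_rpow (by norm_num) (by positivity)]; ring
        _ ≤ _ := mul_le_mul_of_nonneg_left h2.2.le (by positivity)

/-- M is comparable to a power of 1 + |v|, to which Peetre's inequality applies. The exponent d + α
is rounded up to an integer k so that only natural powers of 1 + t occur later. -/
theorem IsHeavyTailEquilibrium.exists_shift_le {d : ℕ} {α : ℝ} (hα : 1 ≤ α) {M : Vel d → ℝ}
    (hM : IsHeavyTailEquilibrium α M) :
    ∃ (C : ℝ) (k : ℕ), 0 < C ∧ ∀ v w, M (v - w) ≤ C * (1 + ‖w‖) ^ k * M v := by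
  obtain ⟨c, C, hc, hC, h⟩ := hM.exists_two_sided hα
  have hp : 0 ≤ (d : ℝ) + α := by positivity
  obtain ⟨k, hk⟩ := exists_nat_ge ((d : ℝ) + α)
  refine ⟨C / c, k, by positivity, fun v w => ?_⟩
  set p := (d : ℝ) + α
  have h1 : (1 + ‖v‖) ^ p ≤ (1 + ‖v - w‖) ^ p * (1 + ‖w‖) ^ k := by
    calc (1 + ‖v‖) ^ p ≤ ((1 + ‖v - w‖) * (1 + ‖w‖)) ^ p := by
          gcongr; exact one_add_norm_le_mul v w
      _ = (1 + ‖v - w‖) ^ p * (1 + ‖w‖) ^ p := Real.mul_rpow (by positivity) (by positivity)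
      _ ≤ (1 + ‖v - w‖) ^ p * (1 + ‖w‖) ^ (k : ℝ) := by
          gcongr; linarith [norm_nonneg w]
      _ = _ := by rw [Real.rpow_natCast]
  have h2 : 0 < (1 + ‖v‖) ^ p := Real.rpow_pos_of_pos (by positivity) _
  have h3 := (hM.pos (v - w)).le
  have h4 := (h v).1
  have h5 := (h (v - w)).2
  have h6 : (1 + ‖v‖) ^ p * (c * M (v - w)) ≤ (1 + ‖v‖) ^ p * (C * (1 + ‖w‖) ^ k * M v) := by
    calc (1 + ‖v‖) ^ p * (c * M (v - w))
        ≤ (1 + ‖v - w‖) ^ p * (1 + ‖w‖) ^ k * (c * M (v - w)) := by gcongr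
      _ = ((1 + ‖v - w‖) ^ p * M (v - w)) * (1 + ‖w‖) ^ k * c := by ring
      _ ≤ C * (1 + ‖w‖) ^ k * ((1 + ‖v‖) ^ p * M v) := by gcongr
      _ = _ := by ring
  have h7 := le_of_mul_le_mul_left h6 h2
  rw [show C / c * (1 + ‖w‖) ^ k * M v = (C * (1 + ‖w‖) ^ k * M v) / c by ring,
    le_div_iff₀ hc]
  linarith

theorem exists_kineticBounds {d : ℕ} {α : ℝ} (hα : 1 ≤ α) {M : Vel d → ℝ}
    {σ : Vel d → Vel d → ℝ} (hM : IsHeavyTailEquilibrium α M) (hσ : IsCrossSection M σ) :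
    ∃ (ν₁ ν₂ ν₀ A : ℝ) (k : ℕ), KineticBounds M σ ν₁ ν₂ ν₀ A k := by
  obtain ⟨C₁, k, -, h1⟩ := hM.exists_shift_le hα
  obtain ⟨C₂, h2⟩ := hM.fderiv_bound
  obtain ⟨ν₁, ν₂, h3, h4⟩ := hσ.bounds
  obtain ⟨C₃, h5⟩ := hσ.fderiv_bound
  obtain ⟨ν₀, C₄, h6⟩ := hσ.limit
  obtain ⟨_, C₅, -, -, h7⟩ := hM.exists_two_sided hα
  -- A single constant serves all bounds; A ≥ 1 allows powers of A to be raised freely.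
  set A := max (max 1 C₅) (max (max C₁ C₂) (max C₃ C₄))
  have hA5 : C₅ ≤ A := by simp [A]
  have hA1 : C₁ ≤ A := by simp [A]
  have hA2 : C₂ ≤ A := by simp [A]
  have hA3 : C₃ ≤ A := by simp [A]
  have hA4 : C₄ ≤ A := by simp [A]
  exact ⟨ν₁, ν₂, ν₀, A, k,
    { one_le := by simp [A]
      pos := hM.pos
      integrable := by
        -- The integral of a non-integrable function is 0 by convention, so unit mass forces
        -- integrability.
        by_contra h
        have := hM.integral_eq_one
        rw [integral_undef h] at this
        exact zero_ne_one this
      integral_eq_one := hM.integral_eq_one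
      contDiff := contDiff_one_iff_fderiv.2
        ⟨hM.differentiable, hM.differentiable_fderiv.continuous⟩
      fderiv_le := fun v => by
        have := (hM.pos v).le
        refine (h2 v).trans ?_
        rw [mul_div_assoc]
        gcongr
      le_bound := fun v => by
        refine le_trans ?_ ((h7 v).2.trans hA5)
        exact le_mul_of_one_le_left (hM.pos v).le
          (Real.one_le_rpow (by linarith [norm_nonneg v]) (by positivity))
      shift_le := fun v w => by
        have := (hM.pos v).le
        refine (h1 v w).trans ?_
        gcongr
      lower_pos := h3
      sigma_symm := hσ.symm
      sigma_ge := fun v v' => (h4 v v').1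
      sigma_le := fun v v' => (h4 v v').2
      sigma_contDiff := hσ.contDiff
      sigma_fderiv_le := fun v' v => (h5 v' v).trans (by gcongr)
      sigma_limit := fun v v' => (h6 v v').trans (by gcongr) }⟩

namespace KineticBounds

variable {d : ℕ} {M : Vel d → ℝ} {σ : Vel d → Vel d → ℝ} {ν₁ ν₂ ν₀ A : ℝ} {k : ℕ}
  (h : KineticBounds M σ ν₁ ν₂ ν₀ A k)
include h

theorem A_pos : 0 < A := zero_lt_one.trans_le h.one_le

theorem upper_pos : 0 < ν₂ :=
  h.lower_pos.trans_le ((h.sigma_ge 0 0).trans (h.sigma_le 0 0))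

theorem le_upper : ν₁ ≤ ν₂ := (h.sigma_ge 0 0).trans (h.sigma_le 0 0)

theorem sigma_abs_le (v v' : Vel d) : |σ v v'| ≤ ν₂ := by
  rw [abs_of_pos (h.lower_pos.trans_le (h.sigma_ge v v'))]
  exact h.sigma_le v v'

theorem continuous_M : Continuous M := h.contDiff.continuous

theorem sigma_lipschitz (v' v w : Vel d) : |σ v' v - σ v' w| ≤ A * ‖v - w‖ := by
  refine Convex.norm_image_sub_le_of_norm_fderiv_le (𝕜 := ℝ) (s := Set.univ)
    (fun x _ => (h.sigma_contDiff v').differentiable one_ne_zero x) (fun x _ => ?_) convex_univ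
    (Set.mem_univ w) (Set.mem_univ v)
  refine (h.sigma_fderiv_le v' x).trans (div_le_self h.A_pos.le ?_)
  linarith [norm_nonneg x]

/-- The gradient bound makes σ Lipschitz in its second argument, uniformly in the first; symmetry
exchanges the roles, and two one-variable moves give joint continuity. -/
theorem continuous_sigma : Continuous fun p : Vel d × Vel d => σ p.1 p.2 := by
  rw [Metric.continuous_iff]
  intro p ε hε
  have hA := h.A_pos
  refine ⟨ε / (4 * A), by positivity, fun q hq => ?_⟩
  rw [dist_eq_norm, lt_div_iff₀ (by positivity)] at hq
  rw [Real.dist_eq]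
  have h1 := h.sigma_lipschitz q.1 q.2 p.2
  have h2 := h.sigma_lipschitz p.2 q.1 p.1
  rw [h.sigma_symm p.2 q.1, h.sigma_symm p.2 p.1] at h2
  have h3 : ‖q.1 - p.1‖ ≤ ‖q - p‖ := norm_fst_le (q - p)
  have h4 : ‖q.2 - p.2‖ ≤ ‖q - p‖ := norm_snd_le (q - p)
  have h5 := abs_sub_le (σ q.1 q.2) (σ q.1 p.2) (σ p.1 p.2)
  nlinarith

theorem integrable_sigma_mul {f : Vel d → ℝ} (hf : Integrable f) (v : Vel d) :
    Integrable fun v' => σ v v' * f v' := by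
  refine hf.bdd_mul (c := ν₂) ?_ (Eventually.of_forall fun v' => h.sigma_abs_le v v')
  exact (h.continuous_sigma.comp (Continuous.prodMk_right v)).aestronglyMeasurable

end KineticBounds

/-! ### Gain operator, collision frequency and attenuated equilibrium -/

/-- The gain operator `f ↦ ∫ σ(·,v') f(v') dv'`. -/
noncomputable def gain {d : ℕ} (σ : Vel d → Vel d → ℝ) (f : Vel d → ℝ) (v : Vel d) : ℝ :=
  ∫ v', σ v v' * f v'

/-- The average of the collision frequency on the segment from `p.1 - p.2` to `p.1`. -/
noncomputable def avgFrequency {d : ℕ} (M : Vel d → ℝ) (σ : Vel d → Vel d → ℝ)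
    (p : Vel d × Vel d) : ℝ :=
  ∫ s in Set.Ioc (0 : ℝ) 1, collisionFrequency M σ (p.1 - s • p.2)

/-- The attenuated equilibrium `exp (-∫₀ᵗ ν(v - sE) ds) M(v - tE)`, at `p = (E, v)`. -/
noncomputable def propagator {d : ℕ} (M : Vel d → ℝ) (σ : Vel d → Vel d → ℝ) (t : ℝ)
    (p : Vel d × Vel d) : ℝ :=
  Real.exp (-(t * avgFrequency M σ (p.2, t • p.1))) * M (p.2 - t • p.1)

namespace KineticBounds

variable {d : ℕ} {M : Vel d → ℝ} {σ : Vel d → Vel d → ℝ} {ν₁ ν₂ ν₀ A : ℝ} {k : ℕ}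
  (h : KineticBounds M σ ν₁ ν₂ ν₀ A k)
include h

/-- The derivative falls on σ alone, so integrability of f suffices, and the decay 1/(1+|v|) is that
of ∇σ. -/
theorem gain_contDiff {f : Vel d → ℝ} (hf : Integrable f) : ContDiff ℝ 1 (gain σ f) ∧
    ∀ v, ‖fderiv ℝ (gain σ f) v‖ ≤ A * (∫ v', |f v'|) / (1 + ‖v‖) := by
  have hA := h.A_pos
  have hsw : ∀ v', (fun v => σ v v') = σ v' := fun v' => funext fun v => h.sigma_symm v v'
  have hc1 : ∀ v', ContDiff ℝ 1 (fun v => σ v v') := fun v' => by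
    rw [hsw]; exact h.sigma_contDiff v'
  have hfd : ∀ v v', fderiv ℝ (fun v => σ v v' * f v') v = f v' • fderiv ℝ (σ v') v := by
    intro v v'
    rw [fderiv_mul_const ((hc1 v').differentiable one_ne_zero v), hsw]
  have hnf : ∀ v v', ‖fderiv ℝ (fun v => σ v v' * f v') v‖ ≤ A / (1 + ‖v‖) * |f v'| := by
    intro v v'
    rw [hfd, norm_smul, mul_comm, Real.norm_eq_abs]
    gcongr
    exact h.sigma_fderiv_le v' v
  have key := contDiff_one_integral (μ := (volume : Measure (Vel d)))
    (f := fun v' v => σ v v' * f v')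
    (fun v => (h.integrable_sigma_mul hf v).aestronglyMeasurable)
    (fun v => by
      simp only [hfd]
      exact hf.aestronglyMeasurable.smul
        (aestronglyMeasurable_fderiv_of_continuous (f := σ) h.continuous_sigma v))
    (fun v' => (hc1 v').mul contDiff_const)
    (fun v => ⟨Set.univ, univ_mem, fun v' => (ν₂ + A) * |f v'|, hf.abs.const_mul _,
      Eventually.of_forall fun v' p _ => ⟨?_, ?_⟩⟩)
  · refine ⟨key.1, fun v => ?_⟩
    change ‖fderiv ℝ (fun v => ∫ v', σ v v' * f v') v‖ ≤ _
    rw [(key.2 v).2]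
    refine (norm_integral_le_integral_norm _).trans ?_
    rw [mul_div_right_comm, ← integral_const_mul]
    exact integral_mono (key.2 v).1.norm (hf.abs.const_mul _) (hnf v)
  · rw [abs_mul]
    exact mul_le_mul_of_nonneg_right (by linarith [h.sigma_abs_le p v']) (abs_nonneg _)
  · refine (hnf p v').trans (mul_le_mul_of_nonneg_right ?_ (abs_nonneg _))
    have := div_le_self hA.le (show 1 ≤ 1 + ‖p‖ by linarith [norm_nonneg p])
    linarith [h.upper_pos]

theorem abs_gain_le {f : Vel d → ℝ} (hf : Integrable f) (v : Vel d) :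
    |gain σ f v| ≤ ν₂ * ∫ v', |f v'| := by
  rw [← integral_const_mul]
  refine (norm_integral_le_integral_norm (fun v' => σ v v' * f v')).trans ?_
  refine integral_mono (h.integrable_sigma_mul hf v).norm (hf.abs.const_mul _) fun v' => ?_
  simp only [norm_mul, Real.norm_eq_abs]
  gcongr
  exact h.sigma_abs_le v v'

theorem frequency_eq_gain : collisionFrequency M σ = gain σ M := by
  funext v
  simp only [collisionFrequency, gain, h.sigma_symm v]

theorem frequency_contDiff : ContDiff ℝ 1 (collisionFrequency M σ) := by
  rw [h.frequency_eq_gain]; exact (h.gain_contDiff h.integrable).1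

theorem frequency_fderiv_le (v : Vel d) :
    ‖fderiv ℝ (collisionFrequency M σ) v‖ ≤ A / (1 + ‖v‖) := by
  rw [h.frequency_eq_gain]
  have := (h.gain_contDiff h.integrable).2 v
  simpa [abs_of_pos (h.pos _), h.integral_eq_one] using this

theorem le_frequency (v : Vel d) : ν₁ ≤ collisionFrequency M σ v := by
  rw [h.frequency_eq_gain]
  calc ν₁ = ∫ v', ν₁ * M v' := by rw [integral_const_mul, h.integral_eq_one, mul_one]
    _ ≤ _ := integral_mono (h.integrable.const_mul _) (h.integrable_sigma_mul h.integrable v)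
      fun v' => mul_le_mul_of_nonneg_right (h.sigma_ge v v') (h.pos v').le

theorem frequency_le (v : Vel d) : collisionFrequency M σ v ≤ ν₂ := by
  rw [h.frequency_eq_gain]
  calc
    gain σ M v ≤ ∫ v', ν₂ * M v' :=
      integral_mono (h.integrable_sigma_mul h.integrable v) (h.integrable.const_mul _)
      fun v' => mul_le_mul_of_nonneg_right (h.sigma_le v v') (h.pos v').le
    _ = ν₂ := by rw [integral_const_mul, h.integral_eq_one, mul_one]

theorem continuous_frequency : Continuous (collisionFrequency M σ) := h.frequency_contDiff.continuous

theorem frequency_abs_le (v : Vel d) : |collisionFrequency M σ v| ≤ ν₂ := by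
  rw [abs_of_pos (h.lower_pos.trans_le (h.le_frequency v))]
  exact h.frequency_le v

/-- Writing ∫₀ᵗ ν(v - sE) ds as t times an average over the fixed interval (0,1] allows
differentiation in (E, v) under the integral. The weight comes from Peetre's inequality on the
segment, and 2 bounds the norm of (v, w) ↦ v - s w. -/
theorem avgFrequency_contDiff : ContDiff ℝ 1 (avgFrequency M σ) ∧
    ∀ p, ‖fderiv ℝ (avgFrequency M σ) p‖ ≤ 2 * A * (1 + ‖p.2‖) / (1 + ‖p.1‖) := by
  have hA := h.A_pos
  set ν := collisionFrequency M σ with hν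
  have hνd : Differentiable ℝ ν := h.frequency_contDiff.differentiable one_ne_zero
  have hfd : ∀ (s : ℝ) (p : Vel d × Vel d), HasFDerivAt (fun p : Vel d × Vel d => ν (p.1 - s • p.2))
      ((fderiv ℝ ν (p.1 - s • p.2)).comp (ContinuousLinearMap.fst ℝ (Vel d) (Vel d) -
        s • ContinuousLinearMap.snd ℝ (Vel d) (Vel d))) p := fun s p =>
    (hνd _).hasFDerivAt.comp p
      (hasFDerivAt_fst.sub (hasFDerivAt_snd.const_smul s))
  have hnf : ∀ s ∈ Set.Ioc (0 : ℝ) 1, ∀ p : Vel d × Vel d,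
      ‖fderiv ℝ (fun p : Vel d × Vel d => ν (p.1 - s • p.2)) p‖ ≤
        2 * A * (1 + ‖p.2‖) / (1 + ‖p.1‖) := by
    intro s hs p
    rw [(hfd s p).fderiv]
    have h1 : ‖ContinuousLinearMap.fst ℝ (Vel d) (Vel d) -
        s • ContinuousLinearMap.snd ℝ (Vel d) (Vel d)‖ ≤ 2 := by
      refine (norm_sub_le _ _).trans ?_
      rw [norm_smul, Real.norm_of_nonneg hs.1.le]
      have h2 := ContinuousLinearMap.norm_fst_le ℝ (Vel d) (Vel d)
      have h3 := ContinuousLinearMap.norm_snd_le ℝ (Vel d) (Vel d)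
      nlinarith [hs.2, hs.1, norm_nonneg (ContinuousLinearMap.snd ℝ (Vel d) (Vel d))]
    have h2 : ‖s • p.2‖ ≤ ‖p.2‖ := by
      rw [norm_smul, Real.norm_of_nonneg hs.1.le]
      exact mul_le_of_le_one_left (norm_nonneg _) hs.2
    calc _ ≤ ‖fderiv ℝ ν (p.1 - s • p.2)‖ * _ := ContinuousLinearMap.opNorm_comp_le _ _
      _ ≤ (A * (1 + ‖p.1 - s • p.2‖)⁻¹) * 2 := by
        gcongr
        exact (h.frequency_fderiv_le _).trans_eq (div_eq_mul_inv _ _)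
      _ ≤ (A * ((1 + ‖s • p.2‖) / (1 + ‖p.1‖))) * 2 := by
        gcongr; exact inv_one_add_norm_sub_le _ _
      _ ≤ (A * ((1 + ‖p.2‖) / (1 + ‖p.1‖))) * 2 := by gcongr
      _ = _ := by ring
  have key := contDiff_one_integral_of_continuous (μ := volume.restrict (Set.Ioc (0 : ℝ) 1))
    (f := fun (s : ℝ) (p : Vel d × Vel d) => ν (p.1 - s • p.2))
    (h.continuous_frequency.comp (by fun_prop : Continuous
      fun q : ℝ × (Vel d × Vel d) => q.2.1 - q.1 • q.2.2))
    (fun s => h.frequency_contDiff.comp (by fun_prop))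
    (fun p => ⟨Metric.ball 0 (‖p‖ + 1), Metric.isOpen_ball.mem_nhds (by simp),
      fun _ => max ν₂ (2 * A * (1 + (‖p‖ + 1))), integrable_const _, ?_⟩)
  · refine ⟨key.1, fun p => ?_⟩
    change ‖fderiv ℝ (fun p => ∫ s in Set.Ioc (0 : ℝ) 1, ν (p.1 - s • p.2)) p‖ ≤ _
    rw [(key.2 p).2]
    have := norm_setIntegral_le_of_norm_le_const (μ := volume) (s := Set.Ioc (0 : ℝ) 1)
      (by simp) (fun s hs => hnf s hs p)
    simpa using this
  · filter_upwards [ae_restrict_mem measurableSet_Ioc] with s hs q hq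
    refine ⟨(h.frequency_abs_le _).trans (le_max_left _ _),
      (hnf s hs q).trans (le_trans ?_ (le_max_right _ _))⟩
    have h1 : ‖q.2‖ ≤ ‖p‖ + 1 := (norm_snd_le q).trans (mem_ball_zero_iff.1 hq).le
    refine (div_le_self (by positivity) (by linarith [norm_nonneg q.1])).trans ?_
    gcongr

theorem integrableOn_frequency (v w : Vel d) :
    IntegrableOn (fun s : ℝ => collisionFrequency M σ (v - s • w)) (Set.Ioc 0 1) :=
  Measure.integrableOn_of_bounded (M := ν₂) (by simp)
    ((h.continuous_frequency.comp (by fun_prop)).aestronglyMeasurable)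
    (Eventually.of_forall fun s => h.frequency_abs_le _)

theorem le_avgFrequency (p : Vel d × Vel d) : ν₁ ≤ avgFrequency M σ p := by
  have := setIntegral_mono (μ := volume) (s := Set.Ioc (0 : ℝ) 1) (f := fun _ => ν₁)
    (integrable_const _) (h.integrableOn_frequency p.1 p.2) (fun s => h.le_frequency _)
  simpa [avgFrequency] using this

theorem avgFrequency_le (p : Vel d × Vel d) : avgFrequency M σ p ≤ ν₂ := by
  have := setIntegral_mono (μ := volume) (s := Set.Ioc (0 : ℝ) 1) (g := fun _ => ν₂)
    (h.integrableOn_frequency p.1 p.2) (integrable_const _) (fun s => h.frequency_le _)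
  simpa [avgFrequency] using this

omit h in
theorem mul_avgFrequency (t : ℝ) (v E : Vel d) :
    t * avgFrequency M σ (v, t • E) = ∫ s in (0 : ℝ)..t, collisionFrequency M σ (v - s • E) := by
  have := intervalIntegral.mul_integral_comp_mul_right (a := 0) (b := 1)
    (f := fun s => collisionFrequency M σ (v - s • E)) (c := t)
  simp only [zero_mul, one_mul] at this
  rw [← this, intervalIntegral.integral_of_le zero_le_one]
  simp [avgFrequency, smul_smul]

theorem continuous_propagator :
    Continuous fun q : ℝ × (Vel d × Vel d) => propagator M σ q.1 q.2 := by
  have h1 := h.avgFrequency_contDiff.1.continuous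
  have h2 := h.continuous_M
  unfold propagator
  fun_prop

theorem propagator_pos (t : ℝ) (p : Vel d × Vel d) : 0 < propagator M σ t p :=
  mul_pos (Real.exp_pos _) (h.pos _)

theorem propagator_contDiff (t : ℝ) : ContDiff ℝ 1 (propagator M σ t) := by
  have h1 := h.avgFrequency_contDiff.1
  have h2 := h.contDiff
  unfold propagator
  fun_prop

theorem propagator_le_exp_mul {t : ℝ} (ht : 0 ≤ t) (E v : Vel d) :
    propagator M σ t (E, v) ≤ Real.exp (-(ν₁ * t)) * M (v - t • E) := by
  have := (h.pos (v - t • E)).le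
  unfold propagator
  rw [mul_comm ν₁]
  gcongr
  exact h.le_avgFrequency _

theorem le_propagator {t : ℝ} (ht : 0 ≤ t) (E v : Vel d) :
    Real.exp (-(ν₂ * t)) * M (v - t • E) ≤ propagator M σ t (E, v) := by
  have := (h.pos (v - t • E)).le
  unfold propagator
  rw [mul_comm ν₂]
  gcongr
  exact h.avgFrequency_le _

omit h in
theorem one_add_norm_smul_le {R t : ℝ} (hR : 0 ≤ R) (ht : 0 ≤ t) {E : Vel d} (hE : ‖E‖ ≤ R) :
    1 + ‖t • E‖ ≤ (1 + R) * (1 + t) := by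
  rw [norm_smul, Real.norm_of_nonneg ht]
  nlinarith [mul_le_mul_of_nonneg_left hE ht]

theorem M_shift_le {R t : ℝ} (hR : 0 ≤ R) (ht : 0 ≤ t) {E : Vel d} (hE : ‖E‖ ≤ R) (v : Vel d) :
    M (v - t • E) ≤ A * (1 + R) ^ k * (1 + t) ^ k * M v := by
  have := h.A_pos
  have := (h.pos v).le
  refine (h.shift_le v (t • E)).trans ?_
  rw [mul_assoc A ((1 + R) ^ k), ← mul_pow]
  gcongr
  exact one_add_norm_smul_le hR ht hE

theorem propagator_le {R t : ℝ} (hR : 0 ≤ R) (ht : 0 ≤ t) {E : Vel d} (hE : ‖E‖ ≤ R) (v : Vel d) :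
    propagator M σ t (E, v) ≤
      A * (1 + R) ^ k * (Real.exp (-(ν₁ * t)) * (1 + t) ^ k) * M v := by
  refine (h.propagator_le_exp_mul ht E v).trans ?_
  calc _ ≤ Real.exp (-(ν₁ * t)) * (A * (1 + R) ^ k * (1 + t) ^ k * M v) := by
        gcongr; exact h.M_shift_le hR ht hE v
    _ = _ := by ring

/-- The derivative hits either M or the exponent. Both ∇M / M and ∇ν decay like 1/(1+|v|), so either
way one factor 1/(1+|v|) is gained after moving the weight from the trajectory back to v. -/
theorem norm_fderiv_propagator_le {R t : ℝ} (hR : 0 ≤ R) (ht : 0 ≤ t) {E : Vel d} (hE : ‖E‖ ≤ R)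
    (v : Vel d) : ‖fderiv ℝ (propagator M σ t) (E, v)‖ ≤
      3 * A ^ 2 * (1 + R) ^ (k + 1) * (Real.exp (-(ν₁ * t)) * (1 + t) ^ (k + 3)) *
        M v / (1 + ‖v‖) := by
  have hA := h.A_pos
  set L := avgFrequency M σ
  set fst := ContinuousLinearMap.fst ℝ (Vel d) (Vel d)
  set snd := ContinuousLinearMap.snd ℝ (Vel d) (Vel d)
  have hfst : ‖fst‖ ≤ 1 := ContinuousLinearMap.norm_fst_le ℝ (Vel d) (Vel d)
  have hsnd : ‖snd‖ ≤ 1 := ContinuousLinearMap.norm_snd_le ℝ (Vel d) (Vel d)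
  have htf : ‖t • fst‖ ≤ t := by
    rw [norm_smul, Real.norm_of_nonneg ht]; exact mul_le_of_le_one_right ht hfst
  have h1 : HasFDerivAt (fun p : Vel d × Vel d => L (p.2, t • p.1))
      ((fderiv ℝ L (v, t • E)).comp (snd.prod (t • fst))) (E, v) :=
    HasFDerivAt.comp (g := L) (E, v)
      (h.avgFrequency_contDiff.1.differentiable one_ne_zero (v, t • E)).hasFDerivAt
      (snd.prod (t • fst)).hasFDerivAt
  have h2 : HasFDerivAt (fun p : Vel d × Vel d => M (p.2 - t • p.1))
      ((fderiv ℝ M (v - t • E)).comp (snd - t • fst)) (E, v) :=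
    (h.contDiff.differentiable one_ne_zero (v - t • E)).hasFDerivAt.comp (E, v)
      (hasFDerivAt_snd.sub (hasFDerivAt_fst.const_smul t))
  have h3 := ((h1.const_mul t).neg.exp).mul h2
  have h4 : fderiv ℝ (propagator M σ t) (E, v) = _ := h3.fderiv
  rw [h4]
  have hw := one_add_norm_smul_le hR ht hE
  have hMp := h.pos (v - t • E)
  set e := Real.exp (-(t * L (v, t • E)))
  have he : 0 < e := Real.exp_pos _
  have h5 : ‖(fderiv ℝ M (v - t • E)).comp (snd - t • fst)‖ ≤
      A * M (v - t • E) * ((1 + R) * (1 + t) / (1 + ‖v‖)) * (1 + t) := by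
    refine (ContinuousLinearMap.opNorm_comp_le _ _).trans ?_
    gcongr
    · refine (h.fderiv_le _).trans ?_
      rw [div_eq_mul_inv]
      gcongr
      exact (inv_one_add_norm_sub_le _ _).trans (by gcongr)
    · exact (norm_sub_le _ _).trans (add_le_add hsnd htf)
  have h6 : ‖(fderiv ℝ L (v, t • E)).comp (snd.prod (t • fst))‖ ≤
      2 * A * ((1 + R) * (1 + t) / (1 + ‖v‖)) * (1 + t) := by
    refine (ContinuousLinearMap.opNorm_comp_le _ _).trans ?_
    gcongr
    · refine (h.avgFrequency_contDiff.2 _).trans ?_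
      rw [← mul_div_assoc]
      gcongr
    · rw [ContinuousLinearMap.opNorm_prod]
      exact max_le (hsnd.trans (by linarith)) (htf.trans (by linarith))
  have h7 : ‖e • (fderiv ℝ M (v - t • E)).comp (snd - t • fst)‖ ≤
      e * (A * M (v - t • E) * ((1 + R) * (1 + t) / (1 + ‖v‖)) * (1 + t)) := by
    rw [norm_smul, Real.norm_of_nonneg he.le]
    gcongr
  have h8 : ‖M (v - t • E) • e • -(t • (fderiv ℝ L (v, t • E)).comp (snd.prod (t • fst)))‖ ≤
      M (v - t • E) * (e * (t * (2 * A * ((1 + R) * (1 + t) / (1 + ‖v‖)) * (1 + t)))) := by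
    rw [norm_smul, norm_smul, norm_neg, norm_smul, Real.norm_of_nonneg he.le,
      Real.norm_of_nonneg ht, Real.norm_of_nonneg hMp.le]
    gcongr
  refine (norm_add_le _ _).trans ((add_le_add h7 h8).trans ?_)
  have h9 : e * M (v - t • E) ≤ _ := h.propagator_le hR ht hE v
  -- The first term comes from differentiating M, the second from the exponent; one power of 1 + t
  -- is Peetre's, another is the norm of the inner linear map.
  have h10 : (1 + t) ^ 2 + 2 * (t * (1 + t) ^ 2) ≤ 3 * (1 + t) ^ 3 := by nlinarith [pow_nonneg ht 3]
  calc _ = (e * M (v - t • E)) * (A * (1 + R) / (1 + ‖v‖)) * ((1 + t) ^ 2 + 2 * (t * (1 + t) ^ 2)) := by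
        ring
    _ ≤ (A * (1 + R) ^ k * (Real.exp (-(ν₁ * t)) * (1 + t) ^ k) * M v) *
        (A * (1 + R) / (1 + ‖v‖)) * (3 * (1 + t) ^ 3) := by
        have := (h.pos v).le
        gcongr
    _ = _ := by ring

end KineticBounds

/-! ### The transport resolvent -/

/-- The inverse of `E · ∇ + ν` applied to `M g`:
`v ↦ ∫₀^∞ exp (-∫₀ᵗ ν(v - sE) ds) (M g)(v - tE) dt`. -/
noncomputable def resolvent {d : ℕ} (M : Vel d → ℝ) (σ : Vel d → Vel d → ℝ) (E : Vel d)
    (g : Vel d → ℝ) (v : Vel d) : ℝ :=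
  ∫ t in Set.Ioi (0 : ℝ), propagator M σ t (E, v) * g (v - t • E)

/-- The moment `∫₀^∞ exp (-a t) (1 + t)^m dt`. -/
noncomputable def decayMoment (a : ℝ) (m : ℕ) : ℝ :=
  ∫ t in Set.Ioi (0 : ℝ), Real.exp (-(a * t)) * (1 + t) ^ m

theorem decayMoment_nonneg (a : ℝ) (m : ℕ) : 0 ≤ decayMoment a m :=
  setIntegral_nonneg measurableSet_Ioi fun t ht => by
    have : (0 : ℝ) < t := ht
    positivity

namespace KineticBounds

variable {d : ℕ} {M : Vel d → ℝ} {σ : Vel d → Vel d → ℝ} {ν₁ ν₂ ν₀ A : ℝ} {k : ℕ}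
  (h : KineticBounds M σ ν₁ ν₂ ν₀ A k)
include h

theorem continuous_propagator_mul {g : Vel d → ℝ} (hg : Continuous g) (E : Vel d) :
    Continuous fun q : Vel d × ℝ => propagator M σ q.2 (E, q.1) * g (q.1 - q.2 • E) :=
  (h.continuous_propagator.comp (by fun_prop : Continuous
    fun q : Vel d × ℝ => (q.2, (E, q.1)))).mul (hg.comp (by fun_prop))

theorem abs_propagator_mul_le {g : Vel d → ℝ} {a R t : ℝ} (hb : ∀ v, |g v| ≤ a) (hR : 0 ≤ R)
    {E : Vel d} (hE : ‖E‖ ≤ R) (ht : 0 ≤ t) (v : Vel d) :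
    |propagator M σ t (E, v) * g (v - t • E)| ≤
      A * (1 + R) ^ k * M v * a * (Real.exp (-(ν₁ * t)) * (1 + t) ^ k) := by
  have ha : 0 ≤ a := (abs_nonneg _).trans (hb 0)
  rw [abs_mul, abs_of_pos (h.propagator_pos _ _)]
  calc _ ≤ (A * (1 + R) ^ k * (Real.exp (-(ν₁ * t)) * (1 + t) ^ k) * M v) * a :=
        mul_le_mul (h.propagator_le hR ht hE v) (hb _) (abs_nonneg _)
          ((h.propagator_pos _ _).le.trans (h.propagator_le hR ht hE v))
    _ = _ := by ring

theorem integrableOn_propagator_mul {g : Vel d → ℝ} (hg : Continuous g) (hb : ∃ a, ∀ v, |g v| ≤ a)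
    (E v : Vel d) :
    IntegrableOn (fun t => propagator M σ t (E, v) * g (v - t • E)) (Set.Ioi 0) := by
  obtain ⟨a, hb⟩ := hb
  refine Integrable.mono' ((integrableOn_exp_neg_mul_one_add_pow h.lower_pos k).const_mul
    (A * (1 + ‖E‖) ^ k * M v * a)) ?_ ?_
  · exact ((h.continuous_propagator_mul hg E).comp
      (Continuous.prodMk_right v)).aestronglyMeasurable
  · filter_upwards [ae_restrict_mem measurableSet_Ioi] with t ht
    exact h.abs_propagator_mul_le hb (norm_nonneg E) le_rfl (le_of_lt ht) v

theorem abs_resolvent_le {g : Vel d → ℝ} {a R : ℝ}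
    (hb : ∀ v, |g v| ≤ a) (hR : 0 ≤ R) {E : Vel d} (hE : ‖E‖ ≤ R) (v : Vel d) :
    |resolvent M σ E g v| ≤ A * (1 + R) ^ k * decayMoment ν₁ k * a * M v := by
  have := norm_integral_le_of_norm_le (f := fun t => propagator M σ t (E, v) * g (v - t • E))
    ((integrableOn_exp_neg_mul_one_add_pow h.lower_pos k).const_mul (A * (1 + R) ^ k * M v * a))
    (by
      filter_upwards [ae_restrict_mem measurableSet_Ioi] with t ht
      exact h.abs_propagator_mul_le hb hR hE (le_of_lt ht) v)
  rw [integral_const_mul] at this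
  refine this.trans_eq ?_
  rw [decayMoment]
  ring

/-- The decay of g at v - tE becomes decay at v for one more factor (1+R)(1+t), hence the moment of
order k + 1. -/
theorem abs_resolvent_le_div {g : Vel d → ℝ} {a R : ℝ}
    (hb : ∀ v, |g v| ≤ a / (1 + ‖v‖)) (hR : 0 ≤ R) {E : Vel d} (hE : ‖E‖ ≤ R) (v : Vel d) :
    |resolvent M σ E g v| ≤
      A * (1 + R) ^ (k + 1) * decayMoment ν₁ (k + 1) * a * (M v / (1 + ‖v‖)) := by
  have hA := h.A_pos
  have hM := h.pos v
  have ha : 0 ≤ a := by simpa using (abs_nonneg _).trans (hb 0)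
  have := norm_integral_le_of_norm_le (f := fun t => propagator M σ t (E, v) * g (v - t • E))
    ((integrableOn_exp_neg_mul_one_add_pow h.lower_pos (k + 1)).const_mul
      (A * (1 + R) ^ (k + 1) * a * (M v / (1 + ‖v‖))))
    (by
      filter_upwards [ae_restrict_mem measurableSet_Ioi] with t ht
      have ht : 0 ≤ t := le_of_lt ht
      rw [Real.norm_eq_abs, abs_mul, abs_of_pos (h.propagator_pos _ _)]
      have h1 : |g (v - t • E)| ≤ a * ((1 + R) * (1 + t) / (1 + ‖v‖)) := by
        refine (hb _).trans ?_
        rw [div_eq_mul_inv]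
        gcongr
        refine (inv_one_add_norm_sub_le _ _).trans ?_
        gcongr
        exact one_add_norm_smul_le hR ht hE
      calc _ ≤ (A * (1 + R) ^ k * (Real.exp (-(ν₁ * t)) * (1 + t) ^ k) * M v) *
            (a * ((1 + R) * (1 + t) / (1 + ‖v‖))) :=
            mul_le_mul (h.propagator_le hR ht hE v) h1 (abs_nonneg _) (by positivity)
        _ = _ := by ring)
  rw [integral_const_mul] at this
  refine this.trans_eq ?_
  rw [decayMoment]
  ring

theorem continuous_resolvent {g : Vel d → ℝ} (hg : Continuous g) (hb : ∃ a, ∀ v, |g v| ≤ a)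
    (E : Vel d) : Continuous (resolvent M σ E g) := by
  obtain ⟨a, hb⟩ := hb
  refine continuous_iff_continuousAt.2 fun v₀ => ?_
  have hM : ∀ᶠ v in 𝓝 v₀, M v ≤ M v₀ + 1 :=
    (h.continuous_M.continuousAt.eventually_lt continuousAt_const (by linarith)).mono
      fun v hv => le_of_lt hv
  have ha : 0 ≤ a := (abs_nonneg _).trans (hb 0)
  have hA := h.A_pos
  refine continuousAt_of_dominated
    (bound := fun t => A * (1 + ‖E‖) ^ k * (M v₀ + 1) * a * (Real.exp (-(ν₁ * t)) * (1 + t) ^ k))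
    (Eventually.of_forall fun v => ((h.continuous_propagator_mul hg E).comp
      (Continuous.prodMk_right v)).aestronglyMeasurable) ?_
    ((integrableOn_exp_neg_mul_one_add_pow h.lower_pos k).const_mul _)
    (Eventually.of_forall fun _ => ((h.continuous_propagator_mul hg E).comp
      (Continuous.prodMk_left _)).continuousAt)
  filter_upwards [hM] with v hv
  filter_upwards [ae_restrict_mem measurableSet_Ioi] with t ht
  have ht : 0 < t := ht
  refine (h.abs_propagator_mul_le hb (norm_nonneg E) le_rfl ht.le v).trans ?_
  gcongr

theorem integrable_resolvent {g : Vel d → ℝ} (hg : Continuous g) (hb : ∃ a, ∀ v, |g v| ≤ a)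
    (E : Vel d) : Integrable (resolvent M σ E g) := by
  obtain ⟨a, ha⟩ := hb
  exact Integrable.mono' (h.integrable.const_mul _)
    (h.continuous_resolvent hg ⟨a, ha⟩ E).aestronglyMeasurable
    (Eventually.of_forall fun v => h.abs_resolvent_le ha (norm_nonneg E) le_rfl v)

theorem resolvent_sub {f g : Vel d → ℝ} (hf : Continuous f) (hfb : ∃ a, ∀ v, |f v| ≤ a)
    (hg : Continuous g) (hgb : ∃ a, ∀ v, |g v| ≤ a) (E v : Vel d) :
    resolvent M σ E (fun w => f w - g w) v = resolvent M σ E f v - resolvent M σ E g v := by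
  unfold resolvent
  rw [← integral_sub (h.integrableOn_propagator_mul hf hfb E v)
    (h.integrableOn_propagator_mul hg hgb E v)]
  simp only [mul_sub]

omit h in
theorem resolvent_const_mul (c : ℝ) (g : Vel d → ℝ) (E v : Vel d) :
    resolvent M σ E (fun w => c * g w) v = c * resolvent M σ E g v := by
  unfold resolvent
  rw [← integral_const_mul]
  simp only [mul_left_comm]

theorem resolvent_nonneg {g : Vel d → ℝ} (hg : ∀ v, 0 ≤ g v) (E v : Vel d) :
    0 ≤ resolvent M σ E g v :=
  integral_nonneg fun _ => mul_nonneg (h.propagator_pos _ _).le (hg _)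

theorem abs_resolvent_le_resolvent_abs (g : Vel d → ℝ) (E v : Vel d) :
    |resolvent M σ E g v| ≤ resolvent M σ E (fun w => |g w|) v := by
  refine (norm_integral_le_integral_norm
    (fun t => propagator M σ t (E, v) * g (v - t • E))).trans_eq ?_
  unfold resolvent
  simp only [Real.norm_eq_abs, abs_mul, abs_of_pos (h.propagator_pos _ _)]

theorem exp_neg_mul_avgFrequency_deriv (E w : Vel d) (t : ℝ) :
    HasDerivAt (fun t : ℝ => -Real.exp (-∫ s in (0 : ℝ)..t, collisionFrequency M σ (w + s • E)))
      (collisionFrequency M σ (w + t • E) *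
        Real.exp (-∫ s in (0 : ℝ)..t, collisionFrequency M σ (w + s • E))) t := by
  have hc : Continuous fun s : ℝ => collisionFrequency M σ (w + s • E) :=
    h.continuous_frequency.comp (by fun_prop)
  have := ((intervalIntegral.integral_hasDerivAt_right (hc.intervalIntegrable 0 t)
    (hc.stronglyMeasurableAtFilter _ _) hc.continuousAt).fun_neg.exp).fun_neg
  exact this.congr_deriv (by ring)

/-- The integrand is the derivative of -exp(-∫₀ᵗ ν), and ν ≥ ν₁ > 0 sends the exponential to 0: a
particle starting at w collides almost surely. -/
theorem integral_frequency_mul_exp (E w : Vel d) :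
    ∫ t in Set.Ioi (0 : ℝ), collisionFrequency M σ (w + t • E) *
        Real.exp (-∫ s in (0 : ℝ)..t, collisionFrequency M σ (w + s • E)) = 1 := by
  have hlim : Tendsto (fun t : ℝ => -Real.exp
      (-∫ s in (0 : ℝ)..t, collisionFrequency M σ (w + s • E))) atTop (𝓝 0) := by
    suffices hs : Tendsto (fun t : ℝ => ∫ s in (0 : ℝ)..t, collisionFrequency M σ (w + s • E))
        atTop atTop by simpa using (Real.tendsto_exp_neg_atTop_nhds_zero.comp hs).neg
    refine tendsto_atTop_mono' _ ?_ (tendsto_id.const_mul_atTop h.lower_pos)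
    filter_upwards [eventually_ge_atTop 0] with t ht
    have := mul_avgFrequency (M := M) (σ := σ) t w (-E)
    simp only [smul_neg, sub_neg_eq_add] at this
    simp only [id]
    rw [← this, mul_comm]
    exact mul_le_mul_of_nonneg_left (h.le_avgFrequency _) ht
  have hd := fun t (_ : t ∈ Set.Ici (0 : ℝ)) => h.exp_neg_mul_avgFrequency_deriv E w t
  rw [integral_Ioi_of_hasDerivAt_of_tendsto' hd
    (integrableOn_Ioi_deriv_of_nonneg' hd (fun t _ => ?_) hlim) hlim]
  · simp
  · exact mul_nonneg (h.lower_pos.le.trans (h.le_frequency _)) (Real.exp_pos _).le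

omit h in
-- The trajectory is reparametrized from its starting point w by s ↦ t - s. In these coordinates M
-- no longer depends on t.
theorem propagator_add_smul (t : ℝ) (E w : Vel d) :
    propagator M σ t (E, w + t • E) =
      Real.exp (-∫ s in (0 : ℝ)..t, collisionFrequency M σ (w + s • E)) * M w := by
  have h1 := intervalIntegral.integral_comp_sub_left (a := 0) (b := t)
    (fun s => collisionFrequency M σ (w + s • E)) t
  simp only [sub_self, sub_zero] at h1
  rw [propagator]
  simp only [mul_avgFrequency, add_sub_cancel_right]
  rw [← h1]
  simp only [sub_smul, add_sub_assoc]

/-- Conservation of mass for the resolvent. -/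
theorem integral_frequency_mul_resolvent {g : Vel d → ℝ} (hg : Continuous g)
    (hb : ∃ a, ∀ v, |g v| ≤ a) (E : Vel d) :
    ∫ v, collisionFrequency M σ v * resolvent M σ E g v = ∫ v, g v * M v := by
  obtain ⟨a, hb⟩ := hb
  have ha : 0 ≤ a := (abs_nonneg _).trans (hb 0)
  have hν := h.upper_pos
  set ν := collisionFrequency M σ with hνdef
  have hdec := integrableOn_exp_neg_mul_one_add_pow h.lower_pos k
  have hI1 : Integrable (Function.uncurry fun (v : Vel d) (t : ℝ) =>
      ν v * (propagator M σ t (E, v) * g (v - t • E)))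
      (volume.prod (volume.restrict (Set.Ioi 0))) := by
    refine Integrable.mono' (h.integrable.mul_prod
      (hdec.const_mul (ν₂ * (A * (1 + ‖E‖) ^ k * a)))) ?_ ?_
    · exact ((h.continuous_frequency.comp continuous_fst).mul
        (h.continuous_propagator_mul hg E)).aestronglyMeasurable
    · have : ∀ᵐ q : Vel d × ℝ ∂(volume.prod (volume.restrict (Set.Ioi 0))), q.2 ∈ Set.Ioi (0 : ℝ) :=
        Measure.quasiMeasurePreserving_snd.ae (ae_restrict_mem measurableSet_Ioi)
      filter_upwards [this] with q hq
      simp only [Function.uncurry]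
      rw [norm_mul]
      calc _ ≤ ν₂ * (A * (1 + ‖E‖) ^ k * M q.1 * a *
            (Real.exp (-(ν₁ * q.2)) * (1 + q.2) ^ k)) :=
            mul_le_mul (h.frequency_abs_le _)
              (h.abs_propagator_mul_le hb (norm_nonneg E) le_rfl (le_of_lt hq) _)
              (abs_nonneg _) hν.le
        _ = _ := by ring
  have hI2 : Integrable (Function.uncurry fun (t : ℝ) (w : Vel d) =>
      (ν (w + t • E) * Real.exp (-∫ s in (0 : ℝ)..t, ν (w + s • E))) * (g w * M w))
      ((volume.restrict (Set.Ioi 0)).prod volume) := by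
    have hc : Continuous fun q : ℝ × Vel d =>
        ν (q.2 + q.1 • E) * (propagator M σ q.1 (E, q.2 + q.1 • E) * g q.2) := by
      have h1 := h.continuous_propagator.comp (by fun_prop : Continuous
        fun q : ℝ × Vel d => (q.1, (E, q.2 + q.1 • E)))
      exact (h.continuous_frequency.comp (by fun_prop)).mul (h1.mul (hg.comp continuous_snd))
    -- In starting-point coordinates M is evaluated at w itself, so no power of 1 + t is lost and
    -- the moment of order 0 is enough.
    have hdec0 := integrableOn_exp_neg_mul_one_add_pow h.lower_pos 0
    refine Integrable.mono' ((hdec0.const_mul ν₂).mul_prod (h.integrable.const_mul a)) ?_ ?_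
    · convert hc.aestronglyMeasurable using 2 with q
      simp only [Function.uncurry]
      rw [propagator_add_smul]
      ring
    · have : ∀ᵐ q : ℝ × Vel d ∂((volume.restrict (Set.Ioi 0)).prod volume), q.1 ∈ Set.Ioi (0 : ℝ) :=
        Measure.quasiMeasurePreserving_fst.ae (ae_restrict_mem measurableSet_Ioi)
      filter_upwards [this] with q hq
      have hq : 0 < q.1 := hq
      simp only [Function.uncurry]
      rw [norm_mul, norm_mul, norm_mul, Real.norm_of_nonneg (Real.exp_pos _).le,
        Real.norm_of_nonneg (h.pos _).le]
      have h1 := mul_avgFrequency (M := M) (σ := σ) q.1 q.2 (-E)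
      simp only [smul_neg, sub_neg_eq_add] at h1
      rw [← hνdef] at h1
      rw [← h1]
      have hM := h.pos q.2
      have h2 : Real.exp (-(q.1 * avgFrequency M σ (q.2, -(q.1 • E)))) ≤
          Real.exp (-(ν₁ * q.1)) * (1 + q.1) ^ 0 := by
        rw [pow_zero, mul_one, mul_comm ν₁]
        gcongr
        exact h.le_avgFrequency _
      gcongr
      · exact h.frequency_abs_le _
      · exact hb _
  -- Fubini, the translation v = w + tE at fixed t, and Fubini back; the remaining time integral is
  -- 1 for every w.
  calc _ = ∫ v, ∫ t in Set.Ioi (0 : ℝ), ν v * (propagator M σ t (E, v) * g (v - t • E)) := by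
        simp only [resolvent, integral_const_mul]
    _ = ∫ t in Set.Ioi (0 : ℝ), ∫ v, ν v * (propagator M σ t (E, v) * g (v - t • E)) :=
        integral_integral_swap hI1
    _ = ∫ t in Set.Ioi (0 : ℝ), ∫ w,
        (ν (w + t • E) * Real.exp (-∫ s in (0 : ℝ)..t, ν (w + s • E))) * (g w * M w) := by
        congr 1; ext t
        rw [← integral_sub_right_eq_self (fun w =>
          (ν (w + t • E) * Real.exp (-∫ s in (0 : ℝ)..t, ν (w + s • E))) * (g w * M w)) (t • E)]
        congr 1; ext v
        have := propagator_add_smul (M := M) (σ := σ) t E (v - t • E)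
        rw [sub_add_cancel] at this
        rw [this, sub_add_cancel]
        ring
    _ = ∫ w, ∫ t in Set.Ioi (0 : ℝ),
        (ν (w + t • E) * Real.exp (-∫ s in (0 : ℝ)..t, ν (w + s • E))) * (g w * M w) :=
        integral_integral_swap hI2
    _ = _ := by
        congr 1; ext w
        rw [integral_mul_const, h.integral_frequency_mul_exp, one_mul]

/-- The resolvent solves the transport equation along the field lines. -/
theorem hasDerivAt_resolvent {g : Vel d → ℝ} (hg : Continuous g)
    (hb : ∃ a, ∀ v, |g v| ≤ a) (E v : Vel d) :
    HasDerivAt (fun r : ℝ => resolvent M σ E g (v + r • E))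
      (M v * g v - collisionFrequency M σ v * resolvent M σ E g v) 0 := by
  set ν := collisionFrequency M σ with hν
  have hνc : Continuous fun s : ℝ => ν (v + s • E) := h.continuous_frequency.comp (by fun_prop)
  set q : ℝ → ℝ := fun t => propagator M σ t (E, v) * g (v - t • E) with hq
  have hqc : Continuous q := (h.continuous_propagator_mul hg E).comp (Continuous.prodMk_right v)
  have hqi : ∀ r, IntegrableOn q (Set.Ioi r) := by
    intro r
    have h0 : IntegrableOn q (Set.Ioi 0) := h.integrableOn_propagator_mul hg hb E v
    have h1 : IntegrableOn q (Set.Icc r 0) := hqc.integrableOn_Icc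
    refine (h1.union h0).mono_set fun x hx => ?_
    rcases le_or_gt x 0 with hx0 | hx0
    · exact Or.inl ⟨le_of_lt hx, hx0⟩
    · exact Or.inr hx0
  -- Moving the base point by rE amounts to shifting time by r and multiplying by an explicit
  -- exponential. The dependence on r then sits in that exponential and in an endpoint of
  -- integration, so the derivative along E exists although g is only continuous.
  have hprop : ∀ t r : ℝ, propagator M σ t (E, v + r • E) * g (v + r • E - t • E) =
      Real.exp (-∫ s in (0 : ℝ)..r, ν (v + s • E)) * q (t - r) := by
    intro t r
    have h1 : v + r • E - t • E = v - (t - r) • E := by rw [sub_smul]; abel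
    simp only [hq, propagator, h1]
    rw [mul_avgFrequency, mul_avgFrequency, ← hν]
    have h2 : ∫ s in (0 : ℝ)..t, ν (v + r • E - s • E) = ∫ s in (r - t)..r, ν (v + s • E) := by
      have := intervalIntegral.integral_comp_sub_left (a := 0) (b := t)
        (fun s => ν (v + s • E)) r
      rw [sub_zero] at this
      rw [← this]
      congr 1; ext s
      rw [sub_smul, add_sub_assoc]
    have h3 : ∫ s in (0 : ℝ)..(t - r), ν (v - s • E) = ∫ s in (r - t)..0, ν (v + s • E) := by
      have := intervalIntegral.integral_comp_sub_left (a := 0) (b := t - r)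
        (fun s => ν (v + s • E)) 0
      rw [sub_zero, show (0 : ℝ) - (t - r) = r - t by ring] at this
      rw [← this]
      congr 1; ext s
      rw [zero_sub, neg_smul, sub_eq_add_neg]
    rw [h2, h3, ← intervalIntegral.integral_add_adjacent_intervals
      (hνc.intervalIntegrable (r - t) 0) (hνc.intervalIntegrable 0 r), neg_add, Real.exp_add]
    ring
  have hres : ∀ r : ℝ, resolvent M σ E g (v + r • E) =
      Real.exp (-∫ s in (0 : ℝ)..r, ν (v + s • E)) *
        (resolvent M σ E g v - ∫ s in (0 : ℝ)..(-r), q s) := by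
    intro r
    have h1 : resolvent M σ E g v = ∫ s in Set.Ioi 0, q s := rfl
    rw [h1, ← intervalIntegral.integral_interval_add_Ioi (hqi 0) (hqi (-r)), add_sub_cancel_left]
    simp only [resolvent, hprop]
    rw [integral_const_mul]
    congr 1
    have := (measurePreserving_sub_right (volume : Measure ℝ) r).setIntegral_preimage_emb
      (measurableEmbedding_subRight r) q (Set.Ioi (-r))
    rw [← this]
    congr 2
    ext x; simp
  simp only [hres]
  have hd1 : HasDerivAt (fun r : ℝ => Real.exp (-∫ s in (0 : ℝ)..r, ν (v + s • E)))
      (-ν v) 0 := by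
    have := (h.exp_neg_mul_avgFrequency_deriv E v 0).fun_neg
    simpa using this
  have hd2 : HasDerivAt (fun r : ℝ => ∫ s in (0 : ℝ)..(-r), q s) (-(q 0)) 0 := by
    have h1 : HasDerivAt (fun r : ℝ => ∫ s in (0 : ℝ)..r, q s) (q 0) (-0) := by
      rw [neg_zero]
      exact intervalIntegral.integral_hasDerivAt_right (hqc.intervalIntegrable 0 0)
        (hqc.stronglyMeasurableAtFilter _ _) hqc.continuousAt
    have := HasDerivAt.comp (h₂ := fun r : ℝ => ∫ s in (0 : ℝ)..r, q s) (h := fun r : ℝ => -r)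
      (0 : ℝ) h1 (hasDerivAt_neg (0 : ℝ))
    simpa [Function.comp_def] using this
  refine (hd1.fun_mul (hd2.const_sub (resolvent M σ E g v))).congr_deriv ?_
  simp only [hq, propagator, zero_smul, sub_zero, intervalIntegral.integral_same, neg_zero,
    Real.exp_zero, zero_mul, one_mul]
  ring

end KineticBounds

/-! ### The reduced gain operator: positivity and contraction -/

/-- The operator `g ↦ gain (resolvent g) - κ ∫ g M`, which is positive for small `κ`. -/
noncomputable def reducedGain {d : ℕ} (M : Vel d → ℝ) (σ : Vel d → Vel d → ℝ) (κ : ℝ) (E : Vel d)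
    (g : Vel d → ℝ) (v : Vel d) : ℝ :=
  gain σ (resolvent M σ E g) v - κ * ∫ w, g w * M w

namespace KineticBounds

variable {d : ℕ} {M : Vel d → ℝ} {σ : Vel d → Vel d → ℝ} {ν₁ ν₂ ν₀ A : ℝ} {k : ℕ}
  (h : KineticBounds M σ ν₁ ν₂ ν₀ A k)
include h

theorem integrable_mul_M {g : Vel d → ℝ} (hg : Continuous g) (hb : ∃ a, ∀ v, |g v| ≤ a) :
    Integrable fun v => g v * M v :=
  h.integrable.bdd_mul hg.aestronglyMeasurable (Eventually.of_forall hb.choose_spec)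

theorem integrable_frequency_mul {f : Vel d → ℝ} (hf : Integrable f) :
    Integrable fun v => collisionFrequency M σ v * f v :=
  hf.bdd_mul h.continuous_frequency.aestronglyMeasurable (Eventually.of_forall h.frequency_abs_le)

theorem lower_mul_integral_resolvent_le {g : Vel d → ℝ} (hg : Continuous g)
    (hb : ∃ a, ∀ v, |g v| ≤ a) (h0 : ∀ v, 0 ≤ g v) (E : Vel d) :
    ν₁ * ∫ v, resolvent M σ E g v ≤ ∫ v, g v * M v := by
  rw [← h.integral_frequency_mul_resolvent hg hb E, ← integral_const_mul]
  have hi := h.integrable_resolvent hg hb E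
  exact integral_mono (hi.const_mul _) (h.integrable_frequency_mul hi) fun v =>
    mul_le_mul_of_nonneg_right (h.le_frequency v) (h.resolvent_nonneg h0 E v)

theorem le_upper_mul_integral_resolvent {g : Vel d → ℝ} (hg : Continuous g)
    (hb : ∃ a, ∀ v, |g v| ≤ a) (h0 : ∀ v, 0 ≤ g v) (E : Vel d) :
    ∫ v, g v * M v ≤ ν₂ * ∫ v, resolvent M σ E g v := by
  rw [← h.integral_frequency_mul_resolvent hg hb E, ← integral_const_mul]
  have hi := h.integrable_resolvent hg hb E
  exact integral_mono (h.integrable_frequency_mul hi) (hi.const_mul _) fun v =>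
    mul_le_mul_of_nonneg_right (h.frequency_le v) (h.resolvent_nonneg h0 E v)

omit h in
theorem bounded_abs {g : Vel d → ℝ} (hb : ∃ a, ∀ v, |g v| ≤ a) :
    ∃ a, ∀ v, |(|g v|)| ≤ a := by simpa using hb

theorem integral_abs_resolvent_le {g : Vel d → ℝ} (hg : Continuous g)
    (hb : ∃ a, ∀ v, |g v| ≤ a) (E : Vel d) :
    ∫ v, |resolvent M σ E g v| ≤ (∫ v, |g v| * M v) / ν₁ := by
  rw [le_div_iff₀ h.lower_pos, mul_comm]
  refine le_trans ?_ (h.lower_mul_integral_resolvent_le hg.abs (bounded_abs hb)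
    (fun v => abs_nonneg _) E)
  refine mul_le_mul_of_nonneg_left ?_ h.lower_pos.le
  exact integral_mono (h.integrable_resolvent hg hb E).abs
    (h.integrable_resolvent hg.abs (bounded_abs hb) E)
    (h.abs_resolvent_le_resolvent_abs g E)

theorem lower_mul_integral_le_gain {f : Vel d → ℝ} (hf : Integrable f) (h0 : ∀ v, 0 ≤ f v)
    (v : Vel d) : ν₁ * ∫ w, f w ≤ gain σ f v := by
  rw [← integral_const_mul]
  exact integral_mono (hf.const_mul _) (h.integrable_sigma_mul hf v) fun w =>
    mul_le_mul_of_nonneg_right (h.sigma_ge v w) (h0 w)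

theorem gain_sub {f g : Vel d → ℝ} (hf : Integrable f) (hg : Integrable g) (v : Vel d) :
    gain σ (fun w => f w - g w) v = gain σ f v - gain σ g v := by
  unfold gain
  rw [← integral_sub (h.integrable_sigma_mul hf v) (h.integrable_sigma_mul hg v)]
  simp only [mul_sub]

/-- This is Fubini. Combined with conservation of mass for the resolvent, it shows that `gain` after
`resolvent` preserves the integral against M. -/
theorem integral_gain_mul {f : Vel d → ℝ} (hf : Integrable f) :
    ∫ v, gain σ f v * M v = ∫ v, collisionFrequency M σ v * f v := by
  have hI : Integrable (Function.uncurry fun v v' : Vel d => σ v v' * f v' * M v)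
      (volume.prod volume) := by
    have h1 : Integrable (fun q : Vel d × Vel d => M q.1 * f q.2) (volume.prod volume) :=
      h.integrable.mul_prod hf
    refine (h1.bdd_mul (c := ν₂) h.continuous_sigma.aestronglyMeasurable
      (Eventually.of_forall fun q => h.sigma_abs_le q.1 q.2)).congr
      (Eventually.of_forall fun q => ?_)
    simp only [Function.uncurry]
    ring
  calc _ = ∫ v, ∫ v', σ v v' * f v' * M v := by simp only [gain, integral_mul_const]
    _ = ∫ v', ∫ v, σ v v' * f v' * M v := integral_integral_swap hI
    _ = _ := by
      congr 1; ext v'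
      rw [collisionFrequency, ← integral_mul_const]
      congr 1; ext v
      ring

theorem continuous_reducedGain {g : Vel d → ℝ} (hg : Continuous g) (hb : ∃ a, ∀ v, |g v| ≤ a)
    (κ : ℝ) (E : Vel d) : Continuous (reducedGain M σ κ E g) :=
  (h.gain_contDiff (h.integrable_resolvent hg hb E)).1.continuous.sub continuous_const

/-- Boundedness of σ turns an L¹ bound on the resolvent into a sup bound. This smoothing lets the
L¹(M) contraction control uniform norms. -/
theorem abs_gain_resolvent_le {g : Vel d → ℝ} (hg : Continuous g) (hb : ∃ a, ∀ v, |g v| ≤ a)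
    (E v : Vel d) : |gain σ (resolvent M σ E g) v| ≤ ν₂ / ν₁ * ∫ w, |g w| * M w := by
  refine (h.abs_gain_le (h.integrable_resolvent hg hb E) v).trans ?_
  rw [div_mul_eq_mul_div, mul_div_assoc]
  exact mul_le_mul_of_nonneg_left (h.integral_abs_resolvent_le hg hb E) h.upper_pos.le

theorem abs_integral_mul_M_le (g : Vel d → ℝ) : |∫ w, g w * M w| ≤ ∫ w, |g w| * M w := by
  refine (norm_integral_le_integral_norm (fun w => g w * M w)).trans_eq ?_
  simp only [norm_mul, Real.norm_eq_abs, abs_of_pos (h.pos _)]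

theorem abs_reducedGain_le {g : Vel d → ℝ} (hg : Continuous g) (hb : ∃ a, ∀ v, |g v| ≤ a)
    {κ : ℝ} (hκ : 0 ≤ κ) (E v : Vel d) :
    |reducedGain M σ κ E g v| ≤ (ν₂ / ν₁ + κ) * ∫ w, |g w| * M w := by
  refine (abs_sub _ _).trans ?_
  rw [abs_mul, abs_of_nonneg hκ, add_mul]
  exact add_le_add (h.abs_gain_resolvent_le hg hb E v)
    (mul_le_mul_of_nonneg_left (h.abs_integral_mul_M_le g) hκ)

/-- Doeblin's minorization: K T g ≥ ν₁ ∫ T g ≥ (ν₁/ν₂) ∫ g M ≥ κ ∫ g M. -/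
theorem reducedGain_nonneg {g : Vel d → ℝ} (hg : Continuous g) (hb : ∃ a, ∀ v, |g v| ≤ a)
    (h0 : ∀ v, 0 ≤ g v) {κ : ℝ} (hκ : 0 ≤ κ) (hκ' : κ * ν₂ ≤ ν₁) (E v : Vel d) :
    0 ≤ reducedGain M σ κ E g v := by
  have h1 := h.lower_mul_integral_le_gain (h.integrable_resolvent hg hb E)
    (h.resolvent_nonneg h0 E) v
  have h2 := h.le_upper_mul_integral_resolvent hg hb h0 E
  have h3 : 0 ≤ ∫ v, resolvent M σ E g v := integral_nonneg (h.resolvent_nonneg h0 E)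
  unfold reducedGain
  nlinarith [mul_le_mul_of_nonneg_left h2 hκ, mul_le_mul_of_nonneg_right hκ' h3]

/-- K T preserves the M-mass, and the subtracted constant carries the fraction κ of it because ∫ M =
1. -/
theorem integral_reducedGain {g : Vel d → ℝ} (hg : Continuous g) (hb : ∃ a, ∀ v, |g v| ≤ a)
    (κ : ℝ) (E : Vel d) :
    ∫ v, reducedGain M σ κ E g v * M v = (1 - κ) * ∫ v, g v * M v := by
  have hi := h.integrable_resolvent hg hb E
  have hgc := (h.gain_contDiff hi).1.continuous
  simp only [reducedGain, sub_mul]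
  rw [integral_sub (h.integrable_mul_M hgc ⟨_, h.abs_gain_le hi⟩) (h.integrable.const_mul _),
    h.integral_gain_mul hi, h.integral_frequency_mul_resolvent hg hb, integral_const_mul,
    h.integral_eq_one]
  ring

theorem reducedGain_sub {f g : Vel d → ℝ} (hf : Continuous f) (hfb : ∃ a, ∀ v, |f v| ≤ a)
    (hg : Continuous g) (hgb : ∃ a, ∀ v, |g v| ≤ a) (κ : ℝ) (E v : Vel d) :
    reducedGain M σ κ E (fun w => f w - g w) v =
      reducedGain M σ κ E f v - reducedGain M σ κ E g v := by
  have h1 : resolvent M σ E (fun w => f w - g w) =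
      fun w => resolvent M σ E f w - resolvent M σ E g w :=
    funext fun w => h.resolvent_sub hf hfb hg hgb E w
  unfold reducedGain
  rw [h1, h.gain_sub (h.integrable_resolvent hf hfb E) (h.integrable_resolvent hg hgb E)]
  simp only [sub_mul]
  rw [integral_sub (h.integrable_mul_M hf hfb) (h.integrable_mul_M hg hgb)]
  ring

theorem reducedGain_mono {f g : Vel d → ℝ} (hf : Continuous f) (hfb : ∃ a, ∀ v, |f v| ≤ a)
    (hg : Continuous g) (hgb : ∃ a, ∀ v, |g v| ≤ a) (hfg : ∀ v, f v ≤ g v)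
    {κ : ℝ} (hκ : 0 ≤ κ) (hκ' : κ * ν₂ ≤ ν₁) (E v : Vel d) :
    reducedGain M σ κ E f v ≤ reducedGain M σ κ E g v := by
  obtain ⟨a, ha⟩ := hfb
  obtain ⟨b, hb⟩ := hgb
  have := h.reducedGain_nonneg (hg.sub hf) ⟨b + a, fun v => (abs_sub _ _).trans
    (add_le_add (hb v) (ha v))⟩ (fun v => sub_nonneg.2 (hfg v)) hκ hκ' E v
  have h2 := h.reducedGain_sub hg ⟨b, hb⟩ hf ⟨a, ha⟩ κ E v
  change 0 ≤ reducedGain M σ κ E (fun w => g w - f w) v at this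
  linarith

omit h in
theorem reducedGain_const_mul (c : ℝ) (g : Vel d → ℝ) (κ : ℝ) (E v : Vel d) :
    reducedGain M σ κ E (fun w => c * g w) v = c * reducedGain M σ κ E g v := by
  have h1 : resolvent M σ E (fun w => c * g w) = fun w => c * resolvent M σ E g w :=
    funext fun w => resolvent_const_mul c g E w
  unfold reducedGain gain
  rw [h1]
  simp only [mul_assoc, mul_left_comm _ c, integral_const_mul]
  ring

theorem abs_reducedGain_le_reducedGain_abs {g : Vel d → ℝ} (hg : Continuous g)
    (hb : ∃ a, ∀ v, |g v| ≤ a) {κ : ℝ} (hκ : 0 ≤ κ) (hκ' : κ * ν₂ ≤ ν₁) (E v : Vel d) :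
    |reducedGain M σ κ E g v| ≤ reducedGain M σ κ E (fun w => |g w|) v := by
  rw [abs_le]
  constructor
  · have h1 := h.reducedGain_mono (f := fun w => (-1) * g w) (hg.const_mul (-1)) (by simpa using hb)
      hg.abs (bounded_abs hb) (fun v => by simpa using neg_le_abs (g v)) hκ hκ' E v
    rw [reducedGain_const_mul] at h1
    linarith
  · exact h.reducedGain_mono hg hb hg.abs (bounded_abs hb) (fun v => le_abs_self _) hκ hκ' E v

/-- The reduced gain operator is a strict contraction in the `L¹(M)` norm. -/
theorem integral_abs_reducedGain_le {g : Vel d → ℝ} (hg : Continuous g)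
    (hb : ∃ a, ∀ v, |g v| ≤ a) {κ : ℝ} (hκ : 0 ≤ κ) (hκ' : κ * ν₂ ≤ ν₁) (E : Vel d) :
    ∫ v, |reducedGain M σ κ E g v| * M v ≤ (1 - κ) * ∫ v, |g v| * M v := by
  -- Positivity gives |B g| ≤ B |g|, and the exact mass identity applies to |g|.
  rw [← h.integral_reducedGain hg.abs (bounded_abs hb) κ E]
  refine integral_mono (h.integrable_mul_M (h.continuous_reducedGain hg hb κ E).abs
    (bounded_abs ⟨_, h.abs_reducedGain_le hg hb hκ E⟩))
    (h.integrable_mul_M (h.continuous_reducedGain hg.abs (bounded_abs hb) κ E)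
    ⟨_, h.abs_reducedGain_le hg.abs (bounded_abs hb) hκ E⟩) fun v => ?_
  exact mul_le_mul_of_nonneg_right (h.abs_reducedGain_le_reducedGain_abs hg hb hκ hκ' E v)
    (h.pos v).le

end KineticBounds

/-! ### Regularity in the field: tame and dominated families -/

/-- `C¹` functions of `(E, v)` which, locally uniformly in `E`, are bounded with bounded
`E`-derivative and with `v`-derivative bounded by a multiple of `1 / (1 + |v|)`. -/
structure IsTame {d : ℕ} (U : Vel d × Vel d → ℝ) : Prop where
  contDiff : ContDiff ℝ 1 U
  bound : ∀ R, 0 ≤ R → ∃ a, 0 ≤ a ∧ ∀ E v, ‖E‖ ≤ R → |U (E, v)| ≤ a ∧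
    (∀ w, |fderiv ℝ U (E, v) (0, w)| ≤ a / (1 + ‖v‖) * ‖w‖) ∧
    ∀ e, |fderiv ℝ U (E, v) (e, 0)| ≤ a * ‖e‖

/-- `C¹` functions of `(E, v)` which are bounded by multiples of `M` together with their
derivative, locally uniformly in `E`. -/
structure IsDominated {d : ℕ} (M : Vel d → ℝ) (Φ : Vel d × Vel d → ℝ) : Prop where
  contDiff : ContDiff ℝ 1 Φ
  bound : ∀ R, 0 ≤ R → ∃ a, 0 ≤ a ∧ ∀ E v, ‖E‖ ≤ R →
    |Φ (E, v)| ≤ a * M v ∧ ‖fderiv ℝ Φ (E, v)‖ ≤ a * M v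

/-- The resolvent acting on functions of `(E, v)`. -/
noncomputable def fieldResolvent {d : ℕ} (M : Vel d → ℝ) (σ : Vel d → Vel d → ℝ)
    (U : Vel d × Vel d → ℝ) (p : Vel d × Vel d) : ℝ :=
  resolvent M σ p.1 (fun w => U (p.1, w)) p.2

/-- The gain operator acting on functions of `(E, v)`. -/
noncomputable def fieldGain {d : ℕ} (σ : Vel d → Vel d → ℝ)
    (Φ : Vel d × Vel d → ℝ) (p : Vel d × Vel d) : ℝ :=
  gain σ (fun w => Φ (p.1, w)) p.2

/-- The reduced gain operator acting on functions of `(E, v)`. -/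
noncomputable def fieldReducedGain {d : ℕ} (M : Vel d → ℝ) (σ : Vel d → Vel d → ℝ) (κ : ℝ)
    (U : Vel d × Vel d → ℝ) (p : Vel d × Vel d) : ℝ :=
  reducedGain M σ κ p.1 (fun w => U (p.1, w)) p.2

theorem IsTame.norm_fderiv_le {d : ℕ} {U : Vel d × Vel d → ℝ} {p : Vel d × Vel d} {a : ℝ}
    (ha : 0 ≤ a) (hv : ∀ w, |fderiv ℝ U p (0, w)| ≤ a / (1 + ‖p.2‖) * ‖w‖)
    (he : ∀ e, |fderiv ℝ U p (e, 0)| ≤ a * ‖e‖) : ‖fderiv ℝ U p‖ ≤ 2 * a := by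
  refine ContinuousLinearMap.opNorm_le_bound _ (by positivity) fun x => ?_
  have h1 : fderiv ℝ U p x = fderiv ℝ U p (x.1, 0) + fderiv ℝ U p (0, x.2) := by
    rw [← map_add]; simp
  have h2 := hv x.2
  have h3 := he x.1
  have h4 : a / (1 + ‖p.2‖) ≤ a := div_le_self ha (by linarith [norm_nonneg p.2])
  have h5 : a / (1 + ‖p.2‖) * ‖x.2‖ ≤ a * ‖x‖ := by
    gcongr; exact norm_snd_le x
  have h6 : a * ‖x.1‖ ≤ a * ‖x‖ := by
    gcongr; exact norm_fst_le x
  rw [h1, Real.norm_eq_abs]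
  linarith [abs_add_le (fderiv ℝ U p (x.1, 0)) (fderiv ℝ U p (0, x.2))]

namespace IsTame

variable {d : ℕ} {U : Vel d × Vel d → ℝ} (hU : IsTame U)
include hU

theorem continuous_slice (E : Vel d) : Continuous fun w => U (E, w) :=
  hU.contDiff.continuous.comp (Continuous.prodMk_right E)

theorem bounded_slice (E : Vel d) : ∃ a, ∀ w, |U (E, w)| ≤ a := by
  obtain ⟨a, -, ha⟩ := hU.bound ‖E‖ (norm_nonneg E)
  exact ⟨a, fun w => (ha E w le_rfl).1⟩

theorem continuous_fderiv_slice (E e : Vel d) : Continuous fun w => fderiv ℝ U (E, w) (e, 0) :=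
  ((hU.contDiff.continuous_fderiv one_ne_zero).comp
    (Continuous.prodMk_right E)).clm_apply continuous_const

theorem bounded_fderiv_slice (E e : Vel d) : ∃ a, ∀ w, |fderiv ℝ U (E, w) (e, 0)| ≤ a := by
  obtain ⟨a, -, ha⟩ := hU.bound ‖E‖ (norm_nonneg E)
  exact ⟨a * ‖e‖, fun w => (ha E w le_rfl).2.2 e⟩

theorem hasFDerivAt_transported (t : ℝ) (p : Vel d × Vel d) :
    HasFDerivAt (fun p : Vel d × Vel d => U (p.1, p.2 - t • p.1))
      ((fderiv ℝ U (p.1, p.2 - t • p.1)).comp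
        ((ContinuousLinearMap.fst ℝ (Vel d) (Vel d)).prod
          (ContinuousLinearMap.snd ℝ (Vel d) (Vel d) -
            t • ContinuousLinearMap.fst ℝ (Vel d) (Vel d)))) p :=
  HasFDerivAt.comp (g := U) p (hU.contDiff.differentiable one_ne_zero _).hasFDerivAt
    ((ContinuousLinearMap.fst ℝ (Vel d) (Vel d)).prod
          (ContinuousLinearMap.snd ℝ (Vel d) (Vel d) -
            t • ContinuousLinearMap.fst ℝ (Vel d) (Vel d))).hasFDerivAt

end IsTame

theorem norm_fst_prod_snd_sub_smul_fst_le {d : ℕ} {t : ℝ} (ht : 0 ≤ t) :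
    ‖(ContinuousLinearMap.fst ℝ (Vel d) (Vel d)).prod
      (ContinuousLinearMap.snd ℝ (Vel d) (Vel d) -
        t • ContinuousLinearMap.fst ℝ (Vel d) (Vel d))‖ ≤ 1 + t := by
  have h1 := ContinuousLinearMap.norm_fst_le ℝ (Vel d) (Vel d)
  have h2 := ContinuousLinearMap.norm_snd_le ℝ (Vel d) (Vel d)
  rw [ContinuousLinearMap.opNorm_prod]
  refine max_le (h1.trans (by linarith)) ((norm_sub_le _ _).trans (add_le_add h2 ?_))
  rw [norm_smul, Real.norm_of_nonneg ht]
  exact mul_le_of_le_one_right ht h1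

namespace KineticBounds

variable {d : ℕ} {M : Vel d → ℝ} {σ : Vel d → Vel d → ℝ} {ν₁ ν₂ ν₀ A : ℝ} {k : ℕ}
  (h : KineticBounds M σ ν₁ ν₂ ν₀ A k)
include h

theorem fderiv_propagator_mul {U : Vel d × Vel d → ℝ} (hU : IsTame U) (t : ℝ)
    (p : Vel d × Vel d) :
    fderiv ℝ (fun p : Vel d × Vel d => propagator M σ t p * U (p.1, p.2 - t • p.1)) p =
      propagator M σ t p • (fderiv ℝ U (p.1, p.2 - t • p.1)).comp
        ((ContinuousLinearMap.fst ℝ (Vel d) (Vel d)).prod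
          (ContinuousLinearMap.snd ℝ (Vel d) (Vel d) -
            t • ContinuousLinearMap.fst ℝ (Vel d) (Vel d))) +
      U (p.1, p.2 - t • p.1) • fderiv ℝ (propagator M σ t) p :=
  (((h.propagator_contDiff t).differentiable one_ne_zero p).hasFDerivAt.mul
    (hU.hasFDerivAt_transported t p)).fderiv

theorem norm_fderiv_propagator_mul_le {U : Vel d × Vel d → ℝ} (hU : IsTame U) {R t a : ℝ}
    (hR : 0 ≤ R) (ht : 0 ≤ t) (ha : 0 ≤ a) {E : Vel d} (hE : ‖E‖ ≤ R)
    (h1 : ∀ w, |U (E, w)| ≤ a) (h2 : ∀ w, ‖fderiv ℝ U (E, w)‖ ≤ 2 * a) (v : Vel d) :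
    ‖fderiv ℝ (fun p : Vel d × Vel d => propagator M σ t p * U (p.1, p.2 - t • p.1)) (E, v)‖ ≤
      5 * A ^ 2 * (1 + R) ^ (k + 1) * a * M v * (Real.exp (-(ν₁ * t)) * (1 + t) ^ (k + 3)) := by
  have hA := h.A_pos
  have hM := h.pos v
  rw [h.fderiv_propagator_mul hU]
  refine (norm_add_le _ _).trans ?_
  rw [norm_smul, norm_smul, Real.norm_of_nonneg (h.propagator_pos _ _).le]
  have h3 := h.propagator_le hR ht hE v
  have h4 : A * (1 + R) ^ k * (Real.exp (-(ν₁ * t)) * (1 + t) ^ k) * M v * (1 + t) ≤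
      A ^ 2 * (1 + R) ^ (k + 1) * M v * (Real.exp (-(ν₁ * t)) * (1 + t) ^ (k + 3)) := by
    calc _ = A ^ 1 * (1 + R) ^ k * M v * (Real.exp (-(ν₁ * t)) * (1 + t) ^ (k + 1)) := by ring
      _ ≤ _ := by
        gcongr
        · exact h.one_le
        · norm_num
        · linarith
        · omega
        · linarith
        · norm_num
  have h5 : ‖fderiv ℝ (propagator M σ t) (E, v)‖ ≤
      3 * A ^ 2 * (1 + R) ^ (k + 1) * (Real.exp (-(ν₁ * t)) * (1 + t) ^ (k + 3)) * M v :=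
    (h.norm_fderiv_propagator_le hR ht hE v).trans
      (div_le_self (by positivity) (by linarith [norm_nonneg v]))
  -- The final constant 5 is 2 + 3: the factor 2 bounds the derivative of U, the factor 3 that of
  -- the propagator.
  calc _ ≤ (A * (1 + R) ^ k * (Real.exp (-(ν₁ * t)) * (1 + t) ^ k) * M v) *
        ((2 * a) * (1 + t)) + a * (3 * A ^ 2 * (1 + R) ^ (k + 1) *
          (Real.exp (-(ν₁ * t)) * (1 + t) ^ (k + 3)) * M v) := by
        refine add_le_add (mul_le_mul h3 ?_ (norm_nonneg _) (by positivity))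
          (mul_le_mul (h1 _) h5 (norm_nonneg _) ha)
        exact (ContinuousLinearMap.opNorm_comp_le _ _).trans
          (mul_le_mul (h2 _) (norm_fst_prod_snd_sub_smul_fst_le ht) (norm_nonneg _) (by positivity))
    _ = 2 * a * (A * (1 + R) ^ k * (Real.exp (-(ν₁ * t)) * (1 + t) ^ k) * M v * (1 + t)) +
        a * (3 * A ^ 2 * (1 + R) ^ (k + 1) *
          (Real.exp (-(ν₁ * t)) * (1 + t) ^ (k + 3)) * M v) := by ring
    _ ≤ 2 * a * (A ^ 2 * (1 + R) ^ (k + 1) * M v * (Real.exp (-(ν₁ * t)) * (1 + t) ^ (k + 3))) +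
        a * (3 * A ^ 2 * (1 + R) ^ (k + 1) *
          (Real.exp (-(ν₁ * t)) * (1 + t) ^ (k + 3)) * M v) := by gcongr
    _ = _ := by ring

theorem abs_propagator_mul_field_le {U : Vel d × Vel d → ℝ} {R t a : ℝ}
    (hR : 0 ≤ R) (ht : 0 ≤ t) (ha : 0 ≤ a) {E : Vel d} (hE : ‖E‖ ≤ R)
    (h1 : ∀ w, |U (E, w)| ≤ a) (v : Vel d) :
    |propagator M σ t (E, v) * U (E, v - t • E)| ≤
      5 * A ^ 2 * (1 + R) ^ (k + 1) * a * M v * (Real.exp (-(ν₁ * t)) * (1 + t) ^ (k + 3)) := by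
  have hA := h.A_pos
  have hM := h.pos v
  refine (h.abs_propagator_mul_le (g := fun w => U (E, w)) h1 hR hE ht v).trans ?_
  calc _ = 1 * A ^ 1 * (1 + R) ^ k * a * M v * (Real.exp (-(ν₁ * t)) * (1 + t) ^ k) := by ring
    _ ≤ _ := by
      gcongr
      · norm_num
      · exact h.one_le
      · norm_num
      · linarith
      · omega
      · linarith
      · omega

theorem fieldResolvent_contDiff {U : Vel d × Vel d → ℝ} (hU : IsTame U) :
    ContDiff ℝ 1 (fieldResolvent M σ U) ∧ ∀ p,
      IntegrableOn (fun t => fderiv ℝ (fun p : Vel d × Vel d =>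
        propagator M σ t p * U (p.1, p.2 - t • p.1)) p) (Set.Ioi 0) ∧
      fderiv ℝ (fieldResolvent M σ U) p = ∫ t in Set.Ioi (0 : ℝ),
        fderiv ℝ (fun p : Vel d × Vel d => propagator M σ t p * U (p.1, p.2 - t • p.1)) p := by
  have hA := h.A_pos
  refine contDiff_one_integral_of_continuous (μ := volume.restrict (Set.Ioi (0 : ℝ)))
    (f := fun t p => propagator M σ t p * U (p.1, p.2 - t • p.1))
    (h.continuous_propagator.mul (hU.contDiff.continuous.comp (by fun_prop : Continuous
      fun q : ℝ × (Vel d × Vel d) => (q.2.1, q.2.2 - q.1 • q.2.1))))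
    (fun t => (h.propagator_contDiff t).mul (hU.contDiff.comp (by fun_prop))) fun p₀ => ?_
  obtain ⟨a, ha, hb⟩ := hU.bound (‖p₀‖ + 1) (by positivity)
  -- On this neighbourhood both |E| and M(v) are bounded by constants, so the dominating function of
  -- t does not depend on the point.
  refine ⟨Metric.ball 0 (‖p₀‖ + 1) ∩ {p | M p.2 < M p₀.2 + 1},
    inter_mem (Metric.isOpen_ball.mem_nhds (by simp))
      ((isOpen_lt (h.continuous_M.comp continuous_snd) continuous_const).mem_nhds (by simp)),
    fun t => 5 * A ^ 2 * (1 + (‖p₀‖ + 1)) ^ (k + 1) * a * (M p₀.2 + 1) *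
      (Real.exp (-(ν₁ * t)) * (1 + t) ^ (k + 3)),
    (integrableOn_exp_neg_mul_one_add_pow h.lower_pos _).const_mul _, ?_⟩
  filter_upwards [ae_restrict_mem measurableSet_Ioi] with t ht p hp
  have ht : 0 < t := ht
  have hp1 : ‖p.1‖ ≤ ‖p₀‖ + 1 := (norm_fst_le p).trans (mem_ball_zero_iff.1 hp.1).le
  have hp2 : M p.2 ≤ M p₀.2 + 1 := le_of_lt hp.2
  have key : 5 * A ^ 2 * (1 + (‖p₀‖ + 1)) ^ (k + 1) * a * M p.2 *
      (Real.exp (-(ν₁ * t)) * (1 + t) ^ (k + 3)) ≤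
      5 * A ^ 2 * (1 + (‖p₀‖ + 1)) ^ (k + 1) * a * (M p₀.2 + 1) *
      (Real.exp (-(ν₁ * t)) * (1 + t) ^ (k + 3)) := by gcongr
  exact ⟨(h.abs_propagator_mul_field_le (by positivity) ht.le ha hp1
      (fun w => (hb p.1 w hp1).1) p.2).trans key,
    (h.norm_fderiv_propagator_mul_le hU (by positivity) ht.le ha hp1 (fun w => (hb p.1 w hp1).1)
      (fun w => IsTame.norm_fderiv_le ha (hb p.1 w hp1).2.1 (hb p.1 w hp1).2.2) p.2).trans key⟩

/-- The resolvent takes tame families to dominated ones and the gain takes them back, so tameness is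
stable under iteration. -/
theorem fieldResolvent_isDominated {U : Vel d × Vel d → ℝ} (hU : IsTame U) :
    IsDominated M (fieldResolvent M σ U) := by
  have hA := h.A_pos
  refine ⟨(h.fieldResolvent_contDiff hU).1, fun R hR => ?_⟩
  obtain ⟨a, ha, hb⟩ := hU.bound R hR
  set K := 5 * A ^ 2 * (1 + R) ^ (k + 1) * a with hK
  have hi := integrableOn_exp_neg_mul_one_add_pow h.lower_pos (k + 3)
  have hd := decayMoment_nonneg ν₁ (k + 3)
  refine ⟨K * decayMoment ν₁ (k + 3), by positivity, fun E v hE => ⟨?_, ?_⟩⟩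
  · have := norm_integral_le_of_norm_le (hi.const_mul (K * M v))
      (f := fun t => propagator M σ t (E, v) * U (E, v - t • E)) (by
        filter_upwards [ae_restrict_mem measurableSet_Ioi] with t ht
        exact h.abs_propagator_mul_field_le hR (le_of_lt ht) ha hE (fun w => (hb E w hE).1) v)
    rw [integral_const_mul] at this
    refine this.trans_eq ?_
    rw [decayMoment]; ring
  · rw [((h.fieldResolvent_contDiff hU).2 (E, v)).2]
    have := norm_integral_le_of_norm_le (hi.const_mul (K * M v))
      (f := fun t => fderiv ℝ (fun p : Vel d × Vel d =>
        propagator M σ t p * U (p.1, p.2 - t • p.1)) (E, v)) (by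
        filter_upwards [ae_restrict_mem measurableSet_Ioi] with t ht
        exact h.norm_fderiv_propagator_mul_le hU hR (le_of_lt ht) ha hE (fun w => (hb E w hE).1)
          (fun w => IsTame.norm_fderiv_le ha (hb E w hE).2.1 (hb E w hE).2.2) v)
    rw [integral_const_mul] at this
    refine this.trans_eq ?_
    rw [decayMoment]; ring

/-- The commutator of the resolvent with the derivative with respect to the field gains a factor
`1 / (1 + |v|)`. -/
theorem abs_fderiv_fieldResolvent_sub_le {U : Vel d × Vel d → ℝ} (hU : IsTame U) {R a : ℝ}
    (hR : 0 ≤ R) {E : Vel d} (hE : ‖E‖ ≤ R) (h1 : ∀ w, |U (E, w)| ≤ a)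
    (h2 : ∀ v w, |fderiv ℝ U (E, v) (0, w)| ≤ a / (1 + ‖v‖) * ‖w‖) (v e : Vel d) :
    |fderiv ℝ (fieldResolvent M σ U) (E, v) (e, 0) -
        resolvent M σ E (fun w => fderiv ℝ U (E, w) (e, 0)) v| ≤
      4 * A ^ 2 * (1 + R) ^ (k + 1) * decayMoment ν₁ (k + 3) * a * ‖e‖ * (M v / (1 + ‖v‖)) := by
  have hA := h.A_pos
  have hM := h.pos v
  have ha : 0 ≤ a := (abs_nonneg _).trans (h1 0)
  obtain ⟨hint, hfd⟩ := (h.fieldResolvent_contDiff hU).2 (E, v)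
  have hi2 := h.integrableOn_propagator_mul (hU.continuous_fderiv_slice E e)
    (hU.bounded_fderiv_slice E e) E v
  rw [hfd, ContinuousLinearMap.integral_apply hint, resolvent,
    ← integral_sub (hint.apply_continuousLinearMap (e, 0)) hi2]
  have := norm_integral_le_of_norm_le
    (f := fun t => fderiv ℝ (fun p : Vel d × Vel d =>
        propagator M σ t p * U (p.1, p.2 - t • p.1)) (E, v) (e, 0) -
        propagator M σ t (E, v) * fderiv ℝ U (E, v - t • E) (e, 0))
    ((integrableOn_exp_neg_mul_one_add_pow h.lower_pos (k + 3)).const_mul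
      (4 * A ^ 2 * (1 + R) ^ (k + 1) * a * ‖e‖ * (M v / (1 + ‖v‖)))) (by
    filter_upwards [ae_restrict_mem measurableSet_Ioi] with t ht
    have ht : 0 ≤ t := le_of_lt ht
    have h3 : fderiv ℝ U (E, v - t • E) (e, -(t • e)) =
        fderiv ℝ U (E, v - t • E) (e, 0) - t * fderiv ℝ U (E, v - t • E) (0, e) := by
      rw [← smul_eq_mul, ← map_smul, ← map_sub]; simp
    -- As E moves along e, the argument v - tE moves by -te. The pure field derivative of U cancels
    -- against the resolvent of ∂_E U; what remains is the derivative of the propagator and t ∂_v U,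
    -- both with decay 1/(1+|v|). Their constants 3 and 1 add up to 4.
    have h4 : fderiv ℝ (fun p : Vel d × Vel d =>
        propagator M σ t p * U (p.1, p.2 - t • p.1)) (E, v) (e, 0) -
        propagator M σ t (E, v) * fderiv ℝ U (E, v - t • E) (e, 0) =
        U (E, v - t • E) * fderiv ℝ (propagator M σ t) (E, v) (e, 0) -
          propagator M σ t (E, v) * (t * fderiv ℝ U (E, v - t • E) (0, e)) := by
      rw [h.fderiv_propagator_mul hU]
      simp only [add_apply, smul_apply,
        ContinuousLinearMap.comp_apply, ContinuousLinearMap.prod_apply,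
        sub_apply, ContinuousLinearMap.coe_fst', ContinuousLinearMap.coe_snd',
        zero_sub, smul_eq_mul, h3]
      ring
    rw [h4]
    have h5 : |fderiv ℝ (propagator M σ t) (E, v) (e, 0)| ≤
        3 * A ^ 2 * (1 + R) ^ (k + 1) * (Real.exp (-(ν₁ * t)) * (1 + t) ^ (k + 3)) *
        M v / (1 + ‖v‖) * ‖e‖ := by
      refine ((fderiv ℝ (propagator M σ t) (E, v)).le_opNorm (e, 0)).trans ?_
      have : ‖((e, 0) : Vel d × Vel d)‖ = ‖e‖ := by simp [Prod.norm_def]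
      rw [this]
      gcongr
      exact h.norm_fderiv_propagator_le hR ht hE v
    have h6 : |fderiv ℝ U (E, v - t • E) (0, e)| ≤ a * ((1 + R) * (1 + t) / (1 + ‖v‖)) * ‖e‖ := by
      refine (h2 _ _).trans ?_
      rw [div_eq_mul_inv]
      gcongr
      refine (inv_one_add_norm_sub_le _ _).trans ?_
      gcongr
      exact one_add_norm_smul_le hR ht hE
    have h7 := h.propagator_le hR ht hE v
    have h8 : A * (1 + R) ^ k * (Real.exp (-(ν₁ * t)) * (1 + t) ^ k) * M v *
        (t * (a * ((1 + R) * (1 + t) / (1 + ‖v‖)) * ‖e‖)) ≤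
        A ^ 2 * (1 + R) ^ (k + 1) * a * ‖e‖ * (M v / (1 + ‖v‖)) *
          (Real.exp (-(ν₁ * t)) * (1 + t) ^ (k + 3)) := by
      calc _ = A ^ 1 * (1 + R) ^ (k + 1) * a * ‖e‖ * (M v / (1 + ‖v‖)) *
          (Real.exp (-(ν₁ * t)) * (t * (1 + t) ^ (k + 1))) := by ring
        _ ≤ A ^ 2 * (1 + R) ^ (k + 1) * a * ‖e‖ * (M v / (1 + ‖v‖)) *
          (Real.exp (-(ν₁ * t)) * ((1 + t) ^ 2 * (1 + t) ^ (k + 1))) := by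
          gcongr
          · exact h.one_le
          · norm_num
          · nlinarith
        _ = _ := by ring
    rw [Real.norm_eq_abs]
    refine (abs_sub _ _).trans ?_
    rw [abs_mul, abs_mul, abs_of_pos (h.propagator_pos _ _), abs_mul, abs_of_nonneg ht]
    calc _ ≤ a * (3 * A ^ 2 * (1 + R) ^ (k + 1) * (Real.exp (-(ν₁ * t)) * (1 + t) ^ (k + 3)) *
          M v / (1 + ‖v‖) * ‖e‖) + A * (1 + R) ^ k * (Real.exp (-(ν₁ * t)) * (1 + t) ^ k) * M v *
          (t * (a * ((1 + R) * (1 + t) / (1 + ‖v‖)) * ‖e‖)) := by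
          have := (h.propagator_pos t (E, v)).le
          gcongr
          exact h1 _
      _ ≤ _ := by
          refine (add_le_add_right h8 _).trans_eq ?_
          ring)
  rw [integral_const_mul] at this
  refine this.trans_eq ?_
  rw [decayMoment]; ring

end KineticBounds

namespace IsDominated

variable {d : ℕ} {M : Vel d → ℝ} {Φ : Vel d × Vel d → ℝ} (hΦ : IsDominated M Φ)
include hΦ

theorem continuous_slice (E : Vel d) : Continuous fun w => Φ (E, w) :=
  hΦ.contDiff.continuous.comp (Continuous.prodMk_right E)

theorem integrable_slice (hM : Integrable M) (E : Vel d) : Integrable fun w => Φ (E, w) := by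
  obtain ⟨a, -, ha⟩ := hΦ.bound ‖E‖ (norm_nonneg E)
  exact (hM.const_mul a).mono' (hΦ.continuous_slice E).aestronglyMeasurable
    (Eventually.of_forall fun w => (ha E w le_rfl).1)

theorem continuous_fderiv_slice (E e : Vel d) : Continuous fun w => fderiv ℝ Φ (E, w) (e, 0) :=
  ((hΦ.contDiff.continuous_fderiv one_ne_zero).comp
    (Continuous.prodMk_right E)).clm_apply continuous_const

omit hΦ in
theorem abs_fderiv_apply_le {a : ℝ} {E v : Vel d} (ha : ‖fderiv ℝ Φ (E, v)‖ ≤ a * M v)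
    (e : Vel d) : |fderiv ℝ Φ (E, v) (e, 0)| ≤ a * M v * ‖e‖ := by
  refine ((fderiv ℝ Φ (E, v)).le_opNorm (e, 0)).trans ?_
  have : ‖((e, 0) : Vel d × Vel d)‖ = ‖e‖ := by simp [Prod.norm_def]
  rw [this]
  gcongr

theorem integrable_fderiv_slice (hM : Integrable M) (E e : Vel d) :
    Integrable fun w => fderiv ℝ Φ (E, w) (e, 0) := by
  obtain ⟨a, -, ha⟩ := hΦ.bound ‖E‖ (norm_nonneg E)
  exact ((hM.const_mul a).mul_const ‖e‖).mono' (hΦ.continuous_fderiv_slice E e).aestronglyMeasurable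
    (Eventually.of_forall fun w => IsDominated.abs_fderiv_apply_le (ha E w le_rfl).2 e)

theorem contDiff_integral (hM : Integrable M) :
    ContDiff ℝ 1 (fun E => ∫ w, Φ (E, w)) ∧
      ∀ E e, fderiv ℝ (fun E => ∫ w, Φ (E, w)) E e = ∫ w, fderiv ℝ Φ (E, w) (e, 0) := by
  have hfd : ∀ w E, HasFDerivAt (fun E => Φ (E, w))
      ((fderiv ℝ Φ (E, w)).comp (ContinuousLinearMap.inl ℝ (Vel d) (Vel d))) E := fun w E =>
    HasFDerivAt.comp (g := Φ) E (hΦ.contDiff.differentiable one_ne_zero _).hasFDerivAt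
      (hasFDerivAt_prodMk_left E w)
  have key := contDiff_one_integral_of_continuous (μ := (volume : Measure (Vel d)))
    (f := fun w E => Φ (E, w)) (hΦ.contDiff.continuous.comp continuous_swap)
    (fun w => hΦ.contDiff.comp (contDiff_id.prodMk contDiff_const)) fun E₀ => by
      obtain ⟨a, -, ha⟩ := hΦ.bound (‖E₀‖ + 1) (by positivity)
      refine ⟨Metric.ball 0 (‖E₀‖ + 1), Metric.isOpen_ball.mem_nhds (by simp), fun w => a * M w,
        hM.const_mul a, Eventually.of_forall fun w E hE => ?_⟩
      have hE' : ‖E‖ ≤ ‖E₀‖ + 1 := (mem_ball_zero_iff.1 hE).le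
      refine ⟨(ha E w hE').1, ?_⟩
      rw [(hfd w E).fderiv]
      refine (ContinuousLinearMap.opNorm_comp_le _ _).trans ((mul_le_of_le_one_right
        (norm_nonneg _) (ContinuousLinearMap.norm_inl_le_one ℝ _ _)).trans (ha E w hE').2)
  refine ⟨key.1, fun E e => ?_⟩
  rw [(key.2 E).2, ContinuousLinearMap.integral_apply (key.2 E).1]
  congr 1; ext w
  rw [(hfd w E).fderiv]
  simp

end IsDominated

namespace KineticBounds

variable {d : ℕ} {M : Vel d → ℝ} {σ : Vel d → Vel d → ℝ} {ν₁ ν₂ ν₀ A : ℝ} {k : ℕ}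
  (h : KineticBounds M σ ν₁ ν₂ ν₀ A k)
include h

/-- The variables separate: v enters only through σ and E only through Φ. Domination by M permits
differentiation under the integral. -/
theorem fieldGain_contDiff {Φ : Vel d × Vel d → ℝ} (hΦ : IsDominated M Φ) :
    ContDiff ℝ 1 (fieldGain σ Φ) ∧
      ∀ E v e, fderiv ℝ (fieldGain σ Φ) (E, v) (e, 0) =
        gain σ (fun w => fderiv ℝ Φ (E, w) (e, 0)) v := by
  have hA := h.A_pos
  have hν := h.upper_pos
  set fst := ContinuousLinearMap.fst ℝ (Vel d) (Vel d)
  set snd := ContinuousLinearMap.snd ℝ (Vel d) (Vel d)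
  have hfst : ‖fst‖ ≤ 1 := ContinuousLinearMap.norm_fst_le ℝ (Vel d) (Vel d)
  have hsnd : ‖snd‖ ≤ 1 := ContinuousLinearMap.norm_snd_le ℝ (Vel d) (Vel d)
  have hprod : ‖fst.prod (0 : Vel d × Vel d →L[ℝ] Vel d)‖ ≤ 1 := by
    rw [ContinuousLinearMap.opNorm_prod]
    exact max_le hfst (by simp)
  have hsw : ∀ v', (fun v => σ v v') = σ v' := fun v' => funext fun v => h.sigma_symm v v'
  have hfd : ∀ (w : Vel d) (p : Vel d × Vel d),
      HasFDerivAt (fun p : Vel d × Vel d => σ p.2 w * Φ (p.1, w))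
      (σ p.2 w • (fderiv ℝ Φ (p.1, w)).comp (fst.prod 0) +
        Φ (p.1, w) • (fderiv ℝ (σ w) p.2).comp snd) p := by
    intro w p
    have h1 : HasFDerivAt (fun p : Vel d × Vel d => σ p.2 w) ((fderiv ℝ (σ w) p.2).comp snd) p := by
      have h3 : HasFDerivAt (fun v => σ v w) (fderiv ℝ (σ w) p.2) p.2 := by
        rw [hsw]
        exact ((h.sigma_contDiff w).differentiable one_ne_zero _).hasFDerivAt
      exact HasFDerivAt.comp (g := fun v => σ v w) p h3 hasFDerivAt_snd
    have h2 : HasFDerivAt (fun p : Vel d × Vel d => Φ (p.1, w))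
        ((fderiv ℝ Φ (p.1, w)).comp (fst.prod 0)) p :=
      HasFDerivAt.comp (g := Φ) p (hΦ.contDiff.differentiable one_ne_zero _).hasFDerivAt
        (hasFDerivAt_fst.prodMk (hasFDerivAt_const w p))
    exact h1.mul h2
  have key := contDiff_one_integral_of_continuous (μ := (volume : Measure (Vel d)))
    (f := fun w (p : Vel d × Vel d) => σ p.2 w * Φ (p.1, w))
    ((h.continuous_sigma.comp (by fun_prop : Continuous
      fun q : Vel d × (Vel d × Vel d) => (q.2.2, q.1))).mul
      (hΦ.contDiff.continuous.comp (by fun_prop : Continuous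
      fun q : Vel d × (Vel d × Vel d) => (q.2.1, q.1))))
    (fun w => by
      refine ContDiff.mul ?_ (hΦ.contDiff.comp (by fun_prop))
      have := (h.sigma_contDiff w).comp (contDiff_snd (E := Vel d) (F := Vel d))
      rwa [← hsw] at this) fun p₀ => by
      obtain ⟨a, ha0, ha⟩ := hΦ.bound (‖p₀‖ + 1) (by positivity)
      refine ⟨Metric.ball 0 (‖p₀‖ + 1), Metric.isOpen_ball.mem_nhds (by simp),
        fun w => (ν₂ + A) * (a * M w), (h.integrable.const_mul a).const_mul _,
        Eventually.of_forall fun w p hp => ?_⟩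
      have hp' : ‖p.1‖ ≤ ‖p₀‖ + 1 := (norm_fst_le p).trans (mem_ball_zero_iff.1 hp).le
      have hM := (h.pos w).le
      obtain ⟨h1, h2⟩ := ha p.1 w hp'
      constructor
      · rw [abs_mul]
        exact mul_le_mul (by linarith [h.sigma_abs_le p.2 w]) h1 (abs_nonneg _) (by positivity)
      · rw [(hfd w p).fderiv]
        refine (norm_add_le _ _).trans ?_
        rw [norm_smul, norm_smul]
        change _ ≤ (ν₂ + A) * (a * M w)
        rw [add_mul, mul_comm A]
        have h3 : ‖(fderiv ℝ (σ w) p.2).comp snd‖ ≤ A :=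
          (ContinuousLinearMap.opNorm_comp_le _ _).trans ((mul_le_of_le_one_right
            (norm_nonneg _) hsnd).trans ((h.sigma_fderiv_le w p.2).trans
              (div_le_self hA.le (by linarith [norm_nonneg p.2]))))
        have h4 : ‖(fderiv ℝ Φ (p.1, w)).comp (fst.prod 0)‖ ≤ a * M w :=
          (ContinuousLinearMap.opNorm_comp_le _ _).trans ((mul_le_of_le_one_right
            (norm_nonneg _) hprod).trans h2)
        exact add_le_add (mul_le_mul (h.sigma_abs_le _ _) h4 (norm_nonneg _) hν.le)
          (mul_le_mul h1 h3 (norm_nonneg _) (by positivity))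
  refine ⟨key.1, fun E v e => ?_⟩
  change fderiv ℝ (fun p : Vel d × Vel d => ∫ w, σ p.2 w * Φ (p.1, w)) (E, v) (e, 0) = _
  rw [(key.2 (E, v)).2, ContinuousLinearMap.integral_apply (key.2 (E, v)).1, gain]
  congr 1; ext w
  rw [(hfd w (E, v)).fderiv]
  simp [fst, snd]

theorem fderiv_fieldGain_vel {Φ : Vel d × Vel d → ℝ} (hΦ : IsDominated M Φ) (E v w : Vel d) :
    |fderiv ℝ (fieldGain σ Φ) (E, v) (0, w)| ≤ A * (∫ v', |Φ (E, v')|) / (1 + ‖v‖) * ‖w‖ := by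
  have hd := ((h.fieldGain_contDiff hΦ).1.differentiable one_ne_zero (E, v)).hasFDerivAt
  have h1 : HasFDerivAt (gain σ (fun w => Φ (E, w)))
      ((fderiv ℝ (fieldGain σ Φ) (E, v)).comp (ContinuousLinearMap.inr ℝ (Vel d) (Vel d))) v :=
    HasFDerivAt.comp (g := fieldGain σ Φ) v hd (hasFDerivAt_prodMk_right E v)
  have h2 := (h.gain_contDiff (hΦ.integrable_slice h.integrable E)).2 v
  rw [h1.fderiv] at h2
  have h3 := ((fderiv ℝ (fieldGain σ Φ) (E, v)).comp
    (ContinuousLinearMap.inr ℝ (Vel d) (Vel d))).le_opNorm w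
  simp only [ContinuousLinearMap.comp_apply, ContinuousLinearMap.inr_apply,
    Real.norm_eq_abs] at h3
  exact h3.trans (mul_le_mul_of_nonneg_right h2 (norm_nonneg w))

theorem fieldGain_isTame {Φ : Vel d × Vel d → ℝ} (hΦ : IsDominated M Φ) :
    IsTame (fieldGain σ Φ) := by
  have hA := h.A_pos
  have hν := h.upper_pos
  refine ⟨(h.fieldGain_contDiff hΦ).1, fun R hR => ?_⟩
  obtain ⟨a, ha0, ha⟩ := hΦ.bound R hR
  refine ⟨(ν₂ + A) * a, by positivity, fun E v hE => ?_⟩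
  have hi := hΦ.integrable_slice h.integrable E
  have h1 : ∫ w, |Φ (E, w)| ≤ a := by
    have := integral_mono hi.abs (h.integrable.const_mul a) fun w => (ha E w hE).1
    rwa [integral_const_mul, h.integral_eq_one, mul_one] at this
  have h2 : ∀ e, ∫ w, |fderiv ℝ Φ (E, w) (e, 0)| ≤ a * ‖e‖ := fun e => by
    have := integral_mono (hΦ.integrable_fderiv_slice h.integrable E e).abs
      ((h.integrable.const_mul a).mul_const ‖e‖)
      fun w => IsDominated.abs_fderiv_apply_le (ha E w hE).2 e
    rwa [integral_mul_const, integral_const_mul, h.integral_eq_one, mul_one] at this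
  refine ⟨?_, fun w => ?_, fun e => ?_⟩
  · refine (h.abs_gain_le hi v).trans ?_
    gcongr
    linarith
  · refine (h.fderiv_fieldGain_vel hΦ E v w).trans ?_
    gcongr
    linarith
  · rw [(h.fieldGain_contDiff hΦ).2]
    refine (h.abs_gain_le (hΦ.integrable_fderiv_slice h.integrable E e) v).trans ?_
    rw [mul_assoc]
    exact mul_le_mul (by linarith) (h2 e) (integral_nonneg fun _ => abs_nonneg _) (by positivity)

theorem hasFDerivAt_mul_M {U : Vel d × Vel d → ℝ} (hU : IsTame U) (p : Vel d × Vel d) :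
    HasFDerivAt (fun p : Vel d × Vel d => U p * M p.2)
      (U p • (fderiv ℝ M p.2).comp (ContinuousLinearMap.snd ℝ (Vel d) (Vel d)) +
        M p.2 • fderiv ℝ U p) p :=
  (hU.contDiff.differentiable one_ne_zero p).hasFDerivAt.mul
    (HasFDerivAt.comp (g := M) p (h.contDiff.differentiable one_ne_zero p.2).hasFDerivAt
      hasFDerivAt_snd)

theorem mul_M_isDominated {U : Vel d × Vel d → ℝ} (hU : IsTame U) :
    IsDominated M (fun p : Vel d × Vel d => U p * M p.2) := by
  have hA := h.A_pos
  refine ⟨hU.contDiff.mul (h.contDiff.comp contDiff_snd), fun R hR => ?_⟩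
  obtain ⟨a, ha0, ha⟩ := hU.bound R hR
  refine ⟨(A + 2) * a, by positivity, fun E v hE => ?_⟩
  have hM := (h.pos v).le
  obtain ⟨h1, h2, h3⟩ := ha E v hE
  constructor
  · simp only [abs_mul, abs_of_nonneg hM]
    gcongr
    nlinarith
  · rw [(h.hasFDerivAt_mul_M hU (E, v)).fderiv]
    refine (norm_add_le _ _).trans ?_
    rw [norm_smul, norm_smul, Real.norm_of_nonneg hM]
    have h4 : ‖(fderiv ℝ M v).comp (ContinuousLinearMap.snd ℝ (Vel d) (Vel d))‖ ≤ A * M v :=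
      (ContinuousLinearMap.opNorm_comp_le _ _).trans ((mul_le_of_le_one_right (norm_nonneg _)
        (ContinuousLinearMap.norm_snd_le ℝ (Vel d) (Vel d))).trans ((h.fderiv_le v).trans
          (div_le_self (by positivity) (by linarith [norm_nonneg v]))))
    have h5 := IsTame.norm_fderiv_le (p := (E, v)) ha0 h2 h3
    calc _ ≤ a * (A * M v) + M v * (2 * a) :=
          add_le_add (mul_le_mul h1 h4 (norm_nonneg _) ha0) (mul_le_mul_of_nonneg_left h5 hM)
      _ = _ := by ring

theorem fieldReducedGain_hasFDerivAt {U : Vel d × Vel d → ℝ} (hU : IsTame U) (κ : ℝ) :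
    ContDiff ℝ 1 (fieldReducedGain M σ κ U) ∧
    (∀ p, HasFDerivAt (fieldReducedGain M σ κ U)
      (fderiv ℝ (fieldGain σ (fieldResolvent M σ U)) p -
        κ • (fderiv ℝ (fun E => ∫ w, U (E, w) * M w) p.1).comp
          (ContinuousLinearMap.fst ℝ (Vel d) (Vel d))) p) := by
  have h1 := (h.fieldGain_contDiff (h.fieldResolvent_isDominated hU)).1
  have h2 := ((h.mul_M_isDominated hU).contDiff_integral h.integrable).1
  refine ⟨h1.sub (contDiff_const.mul (h2.comp contDiff_fst)), fun p => ?_⟩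
  exact (h1.differentiable one_ne_zero p).hasFDerivAt.sub
    (HasFDerivAt.const_mul (HasFDerivAt.comp (g := fun E => ∫ w, U (E, w) * M w) p
      (h2.differentiable one_ne_zero p.1).hasFDerivAt hasFDerivAt_fst) κ)

theorem fderiv_fieldReducedGain_field {U : Vel d × Vel d → ℝ} (hU : IsTame U) (κ : ℝ)
    (E v e : Vel d) : fderiv ℝ (fieldReducedGain M σ κ U) (E, v) (e, 0) =
      gain σ (fun w => fderiv ℝ (fieldResolvent M σ U) (E, w) (e, 0)) v -
        κ * ∫ w, fderiv ℝ U (E, w) (e, 0) * M w := by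
  rw [((h.fieldReducedGain_hasFDerivAt hU κ).2 (E, v)).fderiv]
  simp only [sub_apply, smul_apply, ContinuousLinearMap.comp_apply, ContinuousLinearMap.coe_fst',
    smul_eq_mul]
  rw [(h.fieldGain_contDiff (h.fieldResolvent_isDominated hU)).2,
    ((h.mul_M_isDominated hU).contDiff_integral h.integrable).2]
  congr 3; ext w
  rw [(h.hasFDerivAt_mul_M hU (E, w)).fderiv]
  simp [mul_comm]

theorem fderiv_fieldReducedGain_vel {U : Vel d × Vel d → ℝ} (hU : IsTame U) (κ : ℝ)
    (E v w : Vel d) : fderiv ℝ (fieldReducedGain M σ κ U) (E, v) (0, w) =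
      fderiv ℝ (fieldGain σ (fieldResolvent M σ U)) (E, v) (0, w) := by
  rw [((h.fieldReducedGain_hasFDerivAt hU κ).2 (E, v)).fderiv]
  simp

theorem fieldReducedGain_isTame {U : Vel d × Vel d → ℝ} (hU : IsTame U) (κ : ℝ) :
    IsTame (fieldReducedGain M σ κ U) := by
  refine ⟨(h.fieldReducedGain_hasFDerivAt hU κ).1, fun R hR => ?_⟩
  obtain ⟨a, ha0, ha⟩ := (h.fieldGain_isTame (h.fieldResolvent_isDominated (σ := σ) hU)).bound R hR
  obtain ⟨b, hb0, hb⟩ := hU.bound R hR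
  have hMint : ∀ (f : Vel d → ℝ) (c : ℝ), (∀ w, |f w| ≤ c) → |∫ w, f w * M w| ≤ c := by
    intro f c hf
    have := norm_integral_le_of_norm_le (h.integrable.const_mul c) (f := fun w => f w * M w)
      (Eventually.of_forall fun w => by
        rw [norm_mul, Real.norm_of_nonneg (h.pos w).le]
        exact mul_le_mul_of_nonneg_right (hf w) (h.pos w).le)
    rwa [integral_const_mul, h.integral_eq_one, mul_one] at this
  refine ⟨a + |κ| * b, by positivity, fun E v hE => ⟨?_, fun w => ?_, fun e => ?_⟩⟩
  · refine (abs_sub _ _).trans (add_le_add (ha E v hE).1 ?_)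
    rw [abs_mul]
    exact mul_le_mul_of_nonneg_left (hMint _ b fun w => (hb E w hE).1) (abs_nonneg _)
  · rw [h.fderiv_fieldReducedGain_vel hU]
    refine ((ha E v hE).2.1 w).trans ?_
    gcongr
    have := mul_nonneg (abs_nonneg κ) hb0
    linarith
  · rw [h.fderiv_fieldReducedGain_field hU]
    refine (abs_sub _ _).trans ?_
    rw [add_mul]
    refine add_le_add ?_ ?_
    · have := (ha E v hE).2.2 e
      rwa [(h.fieldGain_contDiff (h.fieldResolvent_isDominated hU)).2] at this
    · rw [abs_mul, mul_assoc]
      exact mul_le_mul_of_nonneg_left (hMint _ (b * ‖e‖) fun w => (hb E w hE).2.2 e)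
        (abs_nonneg _)

/-- The reduced gain operator almost commutes with the derivative with respect to the field. -/
theorem abs_fderiv_fieldReducedGain_sub_le {U : Vel d × Vel d → ℝ} (hU : IsTame U) {R a κ : ℝ}
    (hR : 0 ≤ R) {E : Vel d} (hE : ‖E‖ ≤ R) (h1 : ∀ w, |U (E, w)| ≤ a)
    (h2 : ∀ v w, |fderiv ℝ U (E, v) (0, w)| ≤ a / (1 + ‖v‖) * ‖w‖) (v e : Vel d) :
    |fderiv ℝ (fieldReducedGain M σ κ U) (E, v) (e, 0) -
        reducedGain M σ κ E (fun w => fderiv ℝ U (E, w) (e, 0)) v| ≤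
      ν₂ * (4 * A ^ 2 * (1 + R) ^ (k + 1) * decayMoment ν₁ (k + 3)) * a * ‖e‖ := by
  have hA := h.A_pos
  have ha : 0 ≤ a := (abs_nonneg _).trans (h1 0)
  have hdm := decayMoment_nonneg ν₁ (k + 3)
  have hi1 := (h.fieldResolvent_isDominated (σ := σ) hU).integrable_fderiv_slice h.integrable E e
  have hi2 := h.integrable_resolvent (hU.continuous_fderiv_slice E e)
    (hU.bounded_fderiv_slice E e) E
  -- The terms κ ∫ ∂_E U M cancel exactly, leaving the gain of the resolvent commutator, which its
  -- L¹ norm controls.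
  rw [h.fderiv_fieldReducedGain_field hU, reducedGain, sub_sub_sub_cancel_right,
    ← h.gain_sub hi1 hi2]
  refine (h.abs_gain_le (hi1.sub hi2) v).trans ?_
  rw [mul_assoc ν₂, mul_assoc ν₂]
  refine mul_le_mul_of_nonneg_left ?_ h.upper_pos.le
  have := integral_mono (hi1.sub hi2).abs (h.integrable.const_mul
    (4 * A ^ 2 * (1 + R) ^ (k + 1) * decayMoment ν₁ (k + 3) * a * ‖e‖)) fun w => by
      refine (h.abs_fderiv_fieldResolvent_sub_le hU hR hE h1 h2 w e).trans ?_
      have := (h.pos w).le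
      gcongr
      exact div_le_self this (by linarith [norm_nonneg w])
  rwa [integral_const_mul, h.integral_eq_one, mul_one] at this

end KineticBounds

/-! ### Neumann series and the fixed point -/

/-- The terms of the Neumann series `∑ Bⁿ 1` of the reduced gain operator `B`. -/
noncomputable def neumannTerm {d : ℕ} (M : Vel d → ℝ) (σ : Vel d → Vel d → ℝ) (κ : ℝ) :
    ℕ → Vel d × Vel d → ℝ
  | 0 => fun _ => 1
  | n + 1 => fieldReducedGain M σ κ (neumannTerm M σ κ n)

/-- The Neumann series `∑ Bⁿ 1` of the reduced gain operator `B`. -/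
noncomputable def neumannSeries {d : ℕ} (M : Vel d → ℝ) (σ : Vel d → Vel d → ℝ) (κ : ℝ)
    (p : Vel d × Vel d) : ℝ :=
  ∑' n, neumannTerm M σ κ n p

theorem isTame_one {d : ℕ} : IsTame (fun _ : Vel d × Vel d => (1 : ℝ)) :=
  ⟨contDiff_const, fun R _ => ⟨1, zero_le_one, fun E v _ => by
    simp only [abs_one, le_refl, fderiv_fun_const, Pi.zero_apply, zero_apply, abs_zero, one_mul,
      true_and, norm_nonneg, implies_true, and_true]
    intro w; positivity⟩⟩

theorem IsTame.smul_field {d : ℕ} {U : Vel d × Vel d → ℝ} (hU : IsTame U) {c : Vel d → ℝ}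
    (hc : ContDiff ℝ 1 c) : IsTame (fun p : Vel d × Vel d => c p.1 * U p) := by
  have hd : ∀ p : Vel d × Vel d, HasFDerivAt (fun p : Vel d × Vel d => c p.1 * U p)
      (c p.1 • fderiv ℝ U p +
        U p • (fderiv ℝ c p.1).comp (ContinuousLinearMap.fst ℝ (Vel d) (Vel d))) p := fun p =>
    (HasFDerivAt.comp (g := c) p (hc.differentiable one_ne_zero p.1).hasFDerivAt
      hasFDerivAt_fst).mul (hU.contDiff.differentiable one_ne_zero p).hasFDerivAt
  refine ⟨(hc.comp contDiff_fst).mul hU.contDiff, fun R hR => ?_⟩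
  obtain ⟨a, ha0, ha⟩ := hU.bound R hR
  obtain ⟨b, hb⟩ := (isCompact_closedBall (0 : Vel d) R).exists_bound_of_continuousOn
    hc.continuous.continuousOn
  obtain ⟨b', hb'⟩ := (isCompact_closedBall (0 : Vel d) R).exists_bound_of_continuousOn
    (hc.continuous_fderiv one_ne_zero).continuousOn
  have h0 : (0 : Vel d) ∈ Metric.closedBall (0 : Vel d) R := Metric.mem_closedBall_self hR
  have hb0 : 0 ≤ b := (norm_nonneg _).trans (hb 0 h0)
  have hb0' : 0 ≤ b' := (norm_nonneg _).trans (hb' 0 h0)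
  refine ⟨b * a + a * b', by positivity, fun E v hE => ?_⟩
  have hE' : E ∈ Metric.closedBall (0 : Vel d) R := mem_closedBall_zero_iff.2 hE
  obtain ⟨h1, h2, h3⟩ := ha E v hE
  have hab : 0 ≤ a * b' := by positivity
  refine ⟨?_, fun w => ?_, fun e => ?_⟩
  · rw [abs_mul]
    exact (mul_le_mul (hb E hE') h1 (abs_nonneg _) hb0).trans (by linarith)
  · rw [(hd (E, v)).fderiv]
    simp only [add_apply, smul_apply, ContinuousLinearMap.comp_apply, ContinuousLinearMap.coe_fst',
      map_zero, mul_zero, add_zero, smul_eq_mul, abs_mul]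
    refine (mul_le_mul (hb E hE') (h2 w) (abs_nonneg _) hb0).trans ?_
    rw [← mul_assoc, ← mul_div_assoc]
    gcongr
    linarith
  · rw [(hd (E, v)).fderiv]
    simp only [add_apply, smul_apply, ContinuousLinearMap.comp_apply, ContinuousLinearMap.coe_fst',
      smul_eq_mul]
    refine (abs_add_le _ _).trans ?_
    rw [abs_mul, abs_mul, add_mul, mul_assoc, mul_assoc]
    refine add_le_add (mul_le_mul (hb E hE') (h3 e) (abs_nonneg _) hb0)
      (mul_le_mul h1 ?_ (abs_nonneg _) ha0)
    exact ((fderiv ℝ c E).le_opNorm e).trans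
      (mul_le_mul_of_nonneg_right (hb' E hE') (norm_nonneg _))

namespace KineticBounds

variable {d : ℕ} {M : Vel d → ℝ} {σ : Vel d → Vel d → ℝ} {ν₁ ν₂ ν₀ A : ℝ} {k : ℕ}
  (h : KineticBounds M σ ν₁ ν₂ ν₀ A k)
include h

theorem neumannTerm_isTame (κ : ℝ) (n : ℕ) : IsTame (neumannTerm M σ κ n) := by
  induction n with
  | zero => exact isTame_one
  | succ n ih => exact h.fieldReducedGain_isTame ih κ

theorem neumannTerm_nonneg {κ : ℝ} (hκ : 0 ≤ κ) (hκ' : κ * ν₂ ≤ ν₁) (n : ℕ) (p : Vel d × Vel d) :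
    0 ≤ neumannTerm M σ κ n p := by
  induction n generalizing p with
  | zero => exact zero_le_one
  | succ n ih =>
    have ht := h.neumannTerm_isTame κ n
    exact h.reducedGain_nonneg (ht.continuous_slice p.1) (ht.bounded_slice p.1)
      (fun v => ih (p.1, v)) hκ hκ' p.1 p.2

theorem integral_neumannTerm (κ : ℝ) (n : ℕ) (E : Vel d) :
    ∫ w, neumannTerm M σ κ n (E, w) * M w = (1 - κ) ^ n := by
  induction n with
  | zero => simp [neumannTerm, h.integral_eq_one]
  | succ n ih =>
    have ht := h.neumannTerm_isTame κ n
    have := h.integral_reducedGain (ht.continuous_slice E) (ht.bounded_slice E) κ E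
    rw [ih, ← pow_succ'] at this
    exact this

theorem integral_abs_neumannTerm {κ : ℝ} (hκ : 0 ≤ κ) (hκ' : κ * ν₂ ≤ ν₁) (n : ℕ) (E : Vel d) :
    ∫ w, |neumannTerm M σ κ n (E, w)| * M w = (1 - κ) ^ n := by
  simp only [abs_of_nonneg (h.neumannTerm_nonneg hκ hκ' n _)]
  exact h.integral_neumannTerm κ n E

/-- The L¹(M) norm of the n-th term is exactly (1-κ)ⁿ, and one more application of the operator
converts it into sup and v-derivative bounds. Dividing by 1 - κ accounts for the index shift; the
constant does not depend on E. -/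
theorem exists_neumannTerm_bound {κ : ℝ} (hκ : 0 ≤ κ) (hκ' : κ * ν₂ ≤ ν₁) (hκ1 : κ < 1) :
    ∃ a, 0 ≤ a ∧ ∀ n E v, |neumannTerm M σ κ n (E, v)| ≤ a * (1 - κ) ^ n ∧
      ∀ w, |fderiv ℝ (neumannTerm M σ κ n) (E, v) (0, w)| ≤
        a * (1 - κ) ^ n / (1 + ‖v‖) * ‖w‖ := by
  have hρ : 0 < 1 - κ := by linarith
  have h1 := h.lower_pos
  have h2 := h.upper_pos
  have hA := h.A_pos
  set C := (ν₂ / ν₁ + κ) / (1 - κ) with hC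
  set D := A / ν₁ / (1 - κ) with hD
  have hC0 : 0 ≤ C := by positivity
  have hD0 : 0 ≤ D := by positivity
  refine ⟨1 + C + D, by positivity, fun n E v => ?_⟩
  cases n with
  | zero =>
    have : fderiv ℝ (neumannTerm M σ κ 0) (E, v) = 0 := by simp [neumannTerm]
    rw [this]
    simp only [neumannTerm, abs_one, pow_zero, mul_one, zero_apply, abs_zero]
    exact ⟨by linarith, fun w => by positivity⟩
  | succ n =>
    have ht := h.neumannTerm_isTame κ n
    have hp : 0 < (1 - κ) ^ (n + 1) := by positivity
    constructor
    · have := h.abs_reducedGain_le (ht.continuous_slice E) (ht.bounded_slice E) hκ E v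
      rw [h.integral_abs_neumannTerm hκ hκ'] at this
      have h3 : (ν₂ / ν₁ + κ) * (1 - κ) ^ n = C * (1 - κ) ^ (n + 1) := by
        rw [hC, pow_succ]; field_simp
      exact (this.trans_eq h3).trans (mul_le_mul_of_nonneg_right (by linarith) hp.le)
    · intro w
      rw [neumannTerm, h.fderiv_fieldReducedGain_vel ht]
      refine (h.fderiv_fieldGain_vel (h.fieldResolvent_isDominated ht) E v w).trans ?_
      have h3 := h.integral_abs_resolvent_le (ht.continuous_slice E) (ht.bounded_slice E) E
      rw [h.integral_abs_neumannTerm hκ hκ'] at h3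
      have h4 : A * ((1 - κ) ^ n / ν₁) = D * (1 - κ) ^ (n + 1) := by
        rw [hD, pow_succ]; field_simp
      refine mul_le_mul_of_nonneg_right (div_le_div_of_nonneg_right ?_ (by positivity))
        (norm_nonneg _)
      exact (mul_le_mul_of_nonneg_left h3 hA.le).trans (h4.trans_le
        (mul_le_mul_of_nonneg_right (by linarith) hp.le))

/-- The field derivatives obey the same recursion as the terms, up to a commutator of size (1-κ)ⁿ.
Summing these errors through the contraction produces the extra factor n + 1. -/
theorem exists_fderiv_neumannTerm_bound {κ : ℝ} (hκ : 0 ≤ κ) (hκ' : κ * ν₂ ≤ ν₁) (hκ1 : κ < 1)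
    {R : ℝ} (hR : 0 ≤ R) :
    ∃ b, 0 ≤ b ∧ ∀ n E v, ‖E‖ ≤ R → ∀ e,
      |fderiv ℝ (neumannTerm M σ κ n) (E, v) (e, 0)| ≤ b * ((n + 1) * (1 - κ) ^ n) * ‖e‖ := by
  obtain ⟨a, ha0, ha⟩ := h.exists_neumannTerm_bound hκ hκ' hκ1
  have hρ : 0 < 1 - κ := by linarith
  have h1 := h.lower_pos
  have h2 := h.upper_pos
  have hA := h.A_pos
  have hdm := decayMoment_nonneg ν₁ (k + 3)
  set X := ν₂ * (4 * A ^ 2 * (1 + R) ^ (k + 1) * decayMoment ν₁ (k + 3)) * a with hX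
  have hX0 : 0 ≤ X := by positivity
  set C := ν₂ / ν₁ + κ with hC
  have hC0 : 0 ≤ C := by positivity
  have hstep : ∀ n E v, ‖E‖ ≤ R → ∀ e,
      |fderiv ℝ (neumannTerm M σ κ (n + 1)) (E, v) (e, 0)| ≤
        |reducedGain M σ κ E (fun w => fderiv ℝ (neumannTerm M σ κ n) (E, w) (e, 0)) v| +
          X * (1 - κ) ^ n * ‖e‖ := by
    intro n E v hE e
    have := h.abs_fderiv_fieldReducedGain_sub_le (h.neumannTerm_isTame κ n) (κ := κ) hR hE
      (fun w => (ha n E w).1) (fun v w => (ha n E v).2 w) v e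
    rw [← mul_assoc _ a, ← hX] at this
    have h4 := abs_add_le (fderiv ℝ (fieldReducedGain M σ κ (neumannTerm M σ κ n)) (E, v) (e, 0) -
      reducedGain M σ κ E (fun w => fderiv ℝ (neumannTerm M σ κ n) (E, w) (e, 0)) v)
      (reducedGain M σ κ E (fun w => fderiv ℝ (neumannTerm M σ κ n) (E, w) (e, 0)) v)
    rw [sub_add_cancel] at h4
    rw [neumannTerm]
    linarith
  -- In L¹(M) the recursion is q_{n+1} ≤ (1-κ) q_n + X (1-κ)ⁿ ‖e‖ with q₀ = 0. The sup bound follows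
  -- afterwards from one more application of the operator.
  have hq : ∀ n E, ‖E‖ ≤ R → ∀ e,
      ∫ w, |fderiv ℝ (neumannTerm M σ κ n) (E, w) (e, 0)| * M w ≤
        n * (X / (1 - κ)) * (1 - κ) ^ n * ‖e‖ := by
    intro n E hE e
    induction n with
    | zero =>
      have : ∀ w, fderiv ℝ (neumannTerm M σ κ 0) (E, w) = 0 := by simp [neumannTerm]
      simp [this]
    | succ n ih =>
      have ht := h.neumannTerm_isTame κ n
      have ht' := h.neumannTerm_isTame κ (n + 1)
      have hc := ht.continuous_fderiv_slice E e
      have hb := ht.bounded_fderiv_slice E e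
      have hBi := h.integrable_mul_M (h.continuous_reducedGain hc hb κ E).abs
        (bounded_abs ⟨_, h.abs_reducedGain_le hc hb hκ E⟩)
      have h5 : _ ≤ ∫ w, (|reducedGain M σ κ E
          (fun w => fderiv ℝ (neumannTerm M σ κ n) (E, w) (e, 0)) w| * M w +
            X * (1 - κ) ^ n * ‖e‖ * M w) := integral_mono
        (h.integrable_mul_M (ht'.continuous_fderiv_slice E e).abs
          (bounded_abs (ht'.bounded_fderiv_slice E e)))
        (hBi.add (h.integrable.const_mul (X * (1 - κ) ^ n * ‖e‖)))
        (fun w => by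
          have := mul_le_mul_of_nonneg_right (hstep n E w hE e) (h.pos w).le
          rwa [add_mul] at this)
      rw [integral_add hBi (h.integrable.const_mul _), integral_const_mul,
        h.integral_eq_one, mul_one] at h5
      have h6 := h.integral_abs_reducedGain_le hc hb hκ hκ' E
      refine (h5.trans (add_le_add_left (h6.trans (mul_le_mul_of_nonneg_left ih hρ.le)) _)).trans_eq ?_
      push_cast
      rw [pow_succ]
      field_simp
  refine ⟨(C * (X / (1 - κ)) + X) / (1 - κ), by positivity, fun n E v hE e => ?_⟩
  cases n with
  | zero =>
    have : fderiv ℝ (neumannTerm M σ κ 0) (E, v) = 0 := by simp [neumannTerm]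
    rw [this]
    simp only [zero_apply, abs_zero]
    positivity
  | succ n =>
    have ht := h.neumannTerm_isTame κ n
    have h5 := h.abs_reducedGain_le (ht.continuous_fderiv_slice E e) (ht.bounded_fderiv_slice E e)
      hκ E v
    have h6 := hstep n E v hE e
    have h7 := mul_le_mul_of_nonneg_left (hq n E hE e) hC0
    have hp : 0 < (1 - κ) ^ n := by positivity
    calc _ ≤ C * (n * (X / (1 - κ)) * (1 - κ) ^ n * ‖e‖) + X * (1 - κ) ^ n * ‖e‖ := by linarith
      _ = (C * (X / (1 - κ)) * n + X) * ((1 - κ) ^ n * ‖e‖) := by ring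
      _ ≤ ((C * (X / (1 - κ)) + X) * (n + 1 + 1)) * ((1 - κ) ^ n * ‖e‖) := by
        gcongr
        have : 0 ≤ C * (X / (1 - κ)) := by positivity
        have hn : (0 : ℝ) ≤ n := n.cast_nonneg
        nlinarith [mul_nonneg hX0 hn]
      _ = _ := by
        rw [pow_succ]
        push_cast
        field_simp

omit h in
theorem summable_succ_mul_pow {κ : ℝ} (hκ : 0 < κ) (hκ1 : κ < 1) :
    Summable fun n : ℕ => ((n : ℝ) + 1) * (1 - κ) ^ n := by
  have hr : ‖1 - κ‖ < 1 := by
    rw [Real.norm_of_nonneg (by linarith)]; linarith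
  have h1 := summable_pow_mul_geometric_of_norm_lt_one 1 hr
  have h2 := summable_geometric_of_norm_lt_one hr
  simpa [add_mul] using h1.add h2

theorem summable_neumannTerm {κ : ℝ} (hκ : 0 < κ) (hκ' : κ * ν₂ ≤ ν₁) (hκ1 : κ < 1)
    (p : Vel d × Vel d) : Summable fun n => neumannTerm M σ κ n p := by
  obtain ⟨a, ha0, ha⟩ := h.exists_neumannTerm_bound hκ.le hκ' hκ1
  exact Summable.of_norm_bounded
    ((summable_geometric_of_lt_one (by linarith) (by linarith)).mul_left a)
    (fun n => (ha n p.1 p.2).1)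

theorem neumannSeries_isTame {κ : ℝ} (hκ : 0 < κ) (hκ' : κ * ν₂ ≤ ν₁) (hκ1 : κ < 1) :
    IsTame (neumannSeries M σ κ) := by
  obtain ⟨a, ha0, ha⟩ := h.exists_neumannTerm_bound hκ.le hκ' hκ1
  set ρ := 1 - κ with hρdef
  have hρ : 0 < ρ := by simp only [hρdef]; linarith
  have hρ1 : ρ < 1 := by simp only [hρdef]; linarith
  have hsum : Summable fun n : ℕ => ((n : ℝ) + 1) * ρ ^ n := summable_succ_mul_pow hκ hκ1
  have hgeo : HasSum (fun n : ℕ => ρ ^ n) (1 - ρ)⁻¹ := hasSum_geometric_of_lt_one hρ.le hρ1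
  have hlocal : ∀ R, 0 ≤ R → ∃ b, 0 ≤ b ∧ (∀ n E v, ‖E‖ ≤ R → (∀ e,
      |fderiv ℝ (neumannTerm M σ κ n) (E, v) (e, 0)| ≤ b * ((n + 1) * ρ ^ n) * ‖e‖) ∧
      ‖fderiv ℝ (neumannTerm M σ κ n) (E, v)‖ ≤ 2 * ((b + a) * ((n + 1) * ρ ^ n))) := by
    intro R hR
    obtain ⟨b, hb0, hb⟩ := h.exists_fderiv_neumannTerm_bound hκ.le hκ' hκ1 hR
    refine ⟨b, hb0, fun n E v hE => ⟨hb n E v hE, IsTame.norm_fderiv_le (p := (E, v)) ?_ ?_ ?_⟩⟩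
    · positivity
    · intro w
      refine ((ha n E v).2 w).trans ?_
      have : ρ ^ n ≤ (n + 1) * ρ ^ n :=
        le_mul_of_one_le_left (by positivity) (by linarith [n.cast_nonneg (α := ℝ)])
      gcongr
      linarith
    · intro e
      refine (hb n E v hE e).trans ?_
      gcongr
      linarith
  -- The derivative bounds are uniform only for bounded E, so the series is differentiated termwise
  -- on these convex cylinders.
  have hset : ∀ R : ℝ, IsOpen {p : Vel d × Vel d | ‖p.1‖ < R} ∧
      IsPreconnected {p : Vel d × Vel d | ‖p.1‖ < R} := by
    intro R
    have : {p : Vel d × Vel d | ‖p.1‖ < R} = Metric.ball (0 : Vel d) R ×ˢ Set.univ := by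
      ext p; simp
    rw [this]
    exact ⟨Metric.isOpen_ball.prod isOpen_univ,
      ((convex_ball _ _).prod convex_univ).isPreconnected⟩
  have hder : ∀ R p, 0 ≤ R → ‖p.1‖ < R → HasFDerivAt (neumannSeries M σ κ)
      (∑' n, fderiv ℝ (neumannTerm M σ κ n) p) p ∧
      ContinuousAt (fun p => ∑' n, fderiv ℝ (neumannTerm M σ κ n) p) p := by
    intro R p hR hp
    obtain ⟨b, hb0, hb⟩ := hlocal R hR
    have hs : Summable fun n : ℕ => 2 * ((b + a) * (((n : ℝ) + 1) * ρ ^ n)) :=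
      (hsum.mul_left _).mul_left _
    constructor
    · exact hasFDerivAt_tsum_of_isPreconnected hs (hset R).1 (hset R).2
        (fun n q _ => ((h.neumannTerm_isTame κ n).contDiff.differentiable
          one_ne_zero q).hasFDerivAt)
        (fun n q hq => (hb n q.1 q.2 (le_of_lt hq)).2) hp
        (h.summable_neumannTerm hκ hκ' hκ1 p) hp
    · refine ContinuousOn.continuousAt (s := {p : Vel d × Vel d | ‖p.1‖ < R}) ?_
        ((hset R).1.mem_nhds hp)
      exact continuousOn_tsum (fun n => ((h.neumannTerm_isTame κ n).contDiff.continuous_fderiv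
        one_ne_zero).continuousOn) hs (fun n q hq => (hb n q.1 q.2 (le_of_lt hq)).2)
  have hfd : ∀ p, fderiv ℝ (neumannSeries M σ κ) p = ∑' n, fderiv ℝ (neumannTerm M σ κ n) p :=
    fun p => (hder (‖p.1‖ + 1) p (by positivity) (by simp)).1.fderiv
  refine ⟨contDiff_one_iff_fderiv.2 ⟨fun p =>
    (hder (‖p.1‖ + 1) p (by positivity) (by simp)).1.differentiableAt, ?_⟩, fun R hR => ?_⟩
  · rw [funext hfd]
    exact continuous_iff_continuousAt.2 fun p =>
      (hder (‖p.1‖ + 1) p (by positivity) (by simp)).2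
  · obtain ⟨b, hb0, hb⟩ := hlocal R hR
    have hs : Summable fun n : ℕ => 2 * ((b + a) * (((n : ℝ) + 1) * ρ ^ n)) :=
      (hsum.mul_left _).mul_left _
    have happ : ∀ E v x, ‖E‖ ≤ R → fderiv ℝ (neumannSeries M σ κ) (E, v) x =
        ∑' n, fderiv ℝ (neumannTerm M σ κ n) (E, v) x := by
      intro E v x hE
      rw [hfd]
      exact (ContinuousLinearMap.apply ℝ ℝ x).map_tsum
        (Summable.of_norm_bounded hs fun n => (hb n E v hE).2)
    set B := ∑' n : ℕ, ((n : ℝ) + 1) * ρ ^ n with hB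
    have hB0 : 0 ≤ B := tsum_nonneg fun n => by positivity
    have hρ2 : 0 < 1 - ρ := by linarith
    refine ⟨a * (1 - ρ)⁻¹ + b * B, by positivity, fun E v hE => ⟨?_, fun w => ?_, fun e => ?_⟩⟩
    · have := tsum_of_norm_bounded (f := fun n => neumannTerm M σ κ n (E, v))
        (hgeo.mul_left a) (fun n => (ha n E v).1)
      refine le_trans this ?_
      linarith [mul_nonneg hb0 hB0]
    · rw [happ E v _ hE]
      have := tsum_of_norm_bounded
        (f := fun n => fderiv ℝ (neumannTerm M σ κ n) (E, v) (0, w)) (((hgeo.mul_left a).div_const (1 + ‖v‖)).mul_right ‖w‖)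
        (fun n => (ha n E v).2 w)
      refine le_trans this ?_
      gcongr
      linarith [mul_nonneg hb0 hB0]
    · rw [happ E v _ hE]
      have := tsum_of_norm_bounded
        (f := fun n => fderiv ℝ (neumannTerm M σ κ n) (E, v) (e, 0)) ((hsum.hasSum.mul_left b).mul_right ‖e‖)
        (fun n => (hb n E v hE).1 e)
      refine le_trans this ?_
      gcongr
      have : 0 ≤ a * (1 - ρ)⁻¹ := by positivity
      linarith

/-- Partial sums satisfy S_{N+1} = 1 + B S_N. The limit passes through B because B is bounded from
L¹(M) to sup norm and S_N converges in L¹(M) by dominated convergence. -/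
theorem neumannSeries_eq {κ : ℝ} (hκ : 0 < κ) (hκ' : κ * ν₂ ≤ ν₁) (hκ1 : κ < 1) (E v : Vel d) :
    neumannSeries M σ κ (E, v) =
      1 + reducedGain M σ κ E (fun w => neumannSeries M σ κ (E, w)) v := by
  obtain ⟨a, ha0, ha⟩ := h.exists_neumannTerm_bound hκ.le hκ' hκ1
  have hT := h.neumannSeries_isTame hκ hκ' hκ1
  have ht := h.neumannTerm_isTame κ
  set S : ℕ → Vel d → ℝ := fun N w => ∑ n ∈ Finset.range N, neumannTerm M σ κ n (E, w) with hS
  have hSc : ∀ N, Continuous (S N) := fun N =>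
    continuous_finsetSum _ fun n _ => (ht n).continuous_slice E
  have hSb : ∀ N, ∃ a, ∀ w, |S N w| ≤ a := fun N =>
    ⟨∑ n ∈ Finset.range N, a * (1 - κ) ^ n, fun w =>
      (Finset.abs_sum_le_sum_abs _ _).trans (Finset.sum_le_sum fun n _ => (ha n E w).1)⟩
  have hrec : ∀ N w, S (N + 1) w = 1 + reducedGain M σ κ E (S N) w := by
    intro N
    induction N with
    | zero =>
      intro w
      have : S 0 = fun w => 0 * S 0 w := by ext w; simp [hS]
      rw [this, reducedGain_const_mul]
      simp [hS, neumannTerm]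
    | succ N ih =>
      intro w
      have h1 : S N = fun w => S (N + 1) w - neumannTerm M σ κ N (E, w) := by
        ext w; simp [hS, Finset.sum_range_succ]
      have h2 := ih w
      rw [h1, h.reducedGain_sub (hSc _) (hSb _) ((ht N).continuous_slice E)
        ((ht N).bounded_slice E)] at h2
      have h3 : S (N + 1 + 1) w = S (N + 1) w + neumannTerm M σ κ (N + 1) (E, w) := by
        simp [hS, Finset.sum_range_succ]
      have h4 : neumannTerm M σ κ (N + 1) (E, w) =
        reducedGain M σ κ E (fun w => neumannTerm M σ κ N (E, w)) w := rfl
      rw [h3, h4, h2]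
      ring
  have hlim : ∀ w, Tendsto (fun N => S N w) atTop (𝓝 (neumannSeries M σ κ (E, w))) := fun w =>
    (h.summable_neumannTerm hκ hκ' hκ1 (E, w)).hasSum.tendsto_sum_nat
  have hlim2 : Tendsto (fun N => reducedGain M σ κ E (S N) v) atTop
      (𝓝 (reducedGain M σ κ E (fun w => neumannSeries M σ κ (E, w)) v)) := by
    have hz : Tendsto (fun N => (ν₂ / ν₁ + κ) *
        ∫ w, |neumannSeries M σ κ (E, w) - S N w| * M w) atTop (𝓝 0) := by
      have h5 : Tendsto (fun N => ∫ w, |neumannSeries M σ κ (E, w) - S N w| * M w) atTop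
          (𝓝 (∫ _ : Vel d, (0 : ℝ))) := by
        refine tendsto_integral_of_dominated_convergence (fun w => (a * (1 - (1 - κ))⁻¹ +
          a * (1 - (1 - κ))⁻¹) * M w) (fun N => ?_) (h.integrable.const_mul _)
          (fun N => Eventually.of_forall fun w => ?_) (Eventually.of_forall fun w => ?_)
        · exact (((hT.continuous_slice E).sub (hSc N)).abs.mul h.continuous_M).aestronglyMeasurable
        · rw [norm_mul, Real.norm_of_nonneg (h.pos w).le, Real.norm_eq_abs, abs_abs]
          refine mul_le_mul_of_nonneg_right ?_ (h.pos w).le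
          have hg : HasSum (fun n : ℕ => a * (1 - κ) ^ n) (a * (1 - (1 - κ))⁻¹) :=
            (hasSum_geometric_of_lt_one (by linarith) (by linarith)).mul_left a
          refine (abs_sub _ _).trans (add_le_add ?_ ?_)
          · exact tsum_of_norm_bounded (f := fun n => neumannTerm M σ κ n (E, w)) hg (fun n => (ha n E w).1)
          · refine (Finset.abs_sum_le_sum_abs _ _).trans
              ((Finset.sum_le_sum fun n _ => (ha n E w).1).trans ?_)
            refine sum_le_hasSum _ (fun n _ => ?_) hg
            have : 0 < 1 - κ := by linarith
            positivity
        · have := ((tendsto_const_nhds (x := neumannSeries M σ κ (E, w))).sub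
            (hlim w)).abs.mul_const (M w)
          simpa using this
      simpa using h5.const_mul (ν₂ / ν₁ + κ)
    refine tendsto_iff_dist_tendsto_zero.2 (squeeze_zero (fun _ => dist_nonneg) (fun N => ?_) hz)
    obtain ⟨b, hb⟩ := hT.bounded_slice E
    obtain ⟨b', hb'⟩ := hSb N
    rw [dist_comm, Real.dist_eq, ← h.reducedGain_sub (hT.continuous_slice E)
      (hT.bounded_slice E) (hSc N) (hSb N)]
    exact h.abs_reducedGain_le ((hT.continuous_slice E).sub (hSc N))
      ⟨b + b', fun w => (abs_sub _ _).trans (add_le_add (hb w) (hb' w))⟩ hκ.le E v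
  refine tendsto_nhds_unique ((hlim v).comp (tendsto_add_atTop_nat 1)) ?_
  refine (hlim2.const_add 1).congr fun N => ?_
  exact (hrec N v).symm

/-- Integrating G = 1 + B G against M gives I = 1 + (1-κ) I. Hence the subtracted constant κ ∫ G M
cancels the source 1, and G is fixed by K T. -/
theorem integral_neumannSeries {κ : ℝ} (hκ : 0 < κ) (hκ' : κ * ν₂ ≤ ν₁) (hκ1 : κ < 1)
    (E : Vel d) : κ * ∫ w, neumannSeries M σ κ (E, w) * M w = 1 := by
  have hT := h.neumannSeries_isTame hκ hκ' hκ1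
  have hc := hT.continuous_slice E
  have hb := hT.bounded_slice E
  have h1 : ∫ w, neumannSeries M σ κ (E, w) * M w =
      ∫ w, (M w + reducedGain M σ κ E (fun w => neumannSeries M σ κ (E, w)) w * M w) := by
    congr 1; ext w
    rw [h.neumannSeries_eq hκ hκ' hκ1 E w, add_mul, one_mul]
  rw [integral_add h.integrable (h.integrable_mul_M (h.continuous_reducedGain hc hb κ E)
    ⟨_, h.abs_reducedGain_le hc hb hκ.le E⟩), h.integral_eq_one,
    h.integral_reducedGain hc hb] at h1
  linarith

/-- There is a tame family of fixed points of `gain ∘ resolvent`, with normalized resolvents. -/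
theorem exists_fixedPoint : ∃ G : Vel d × Vel d → ℝ, IsTame G ∧ (∀ p, 0 ≤ G p) ∧
    (∀ E v, gain σ (resolvent M σ E fun w => G (E, w)) v = G (E, v)) ∧
    ∀ E, ∫ v, resolvent M σ E (fun w => G (E, w)) v = 1 := by
  have h1 := h.lower_pos
  have h2 := h.upper_pos
  obtain ⟨κ, hκ, hκ', hκ1⟩ : ∃ κ : ℝ, 0 < κ ∧ κ * ν₂ ≤ ν₁ ∧ κ < 1 := by
    -- The factor 2 keeps κ < 1 even when ν₁ = ν₂.
    refine ⟨ν₁ / (2 * ν₂), by positivity, ?_, ?_⟩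
    · rw [div_mul_eq_mul_div, div_le_iff₀ (by positivity)]
      nlinarith
    · rw [div_lt_one (by positivity)]
      linarith [h.le_upper]
  set G := neumannSeries M σ κ with hG
  have hT : IsTame G := h.neumannSeries_isTame hκ hκ' hκ1
  have hG0 : ∀ p, 0 ≤ G p := fun p => tsum_nonneg fun n => h.neumannTerm_nonneg hκ.le hκ' n p
  have hfix : ∀ E v, gain σ (resolvent M σ E fun w => G (E, w)) v = G (E, v) := by
    intro E v
    have h3 := h.neumannSeries_eq hκ hκ' hκ1 E v
    have h4 := h.integral_neumannSeries hκ hκ' hκ1 E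
    rw [reducedGain, h4] at h3
    rw [hG, h3]
    ring
  -- The mass of T_E G is C¹ in E and nonzero, since ν₂ Z ≥ ∫ G M = 1/κ; dividing by it preserves
  -- tameness and the fixed point equation.
  set Z : Vel d → ℝ := fun E => ∫ v, fieldResolvent M σ G (E, v) with hZ
  have hZc : ContDiff ℝ 1 Z := ((h.fieldResolvent_isDominated hT).contDiff_integral h.integrable).1
  have hZpos : ∀ E, Z E ≠ 0 := by
    intro E hE
    have h3 := h.le_upper_mul_integral_resolvent (hT.continuous_slice E) (hT.bounded_slice E)
      (fun v => hG0 (E, v)) E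
    have h4 := h.integral_neumannSeries hκ hκ' hκ1 E
    have h5 : ∫ v, resolvent M σ E (fun w => G (E, w)) v = 0 := hE
    rw [h5, mul_zero] at h3
    nlinarith
  have hZ0 : ∀ E, 0 ≤ Z E := fun E =>
    integral_nonneg fun v => h.resolvent_nonneg (fun w => hG0 (E, w)) E v
  have hres : ∀ E, resolvent M σ E (fun w => (Z E)⁻¹ * G (E, w)) =
      fun v => (Z E)⁻¹ * resolvent M σ E (fun w => G (E, w)) v := fun E =>
    funext fun v => resolvent_const_mul _ _ E v
  refine ⟨fun p => (Z p.1)⁻¹ * G p, hT.smul_field (hZc.inv hZpos),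
    fun p => mul_nonneg (inv_nonneg.2 (hZ0 _)) (hG0 p), fun E v => ?_, fun E => ?_⟩
  · simp only [hres]
    rw [← hfix E v, gain, gain, ← integral_const_mul]
    congr 1; ext w; ring
  · simp only [hres]
    rw [integral_const_mul]
    exact inv_mul_cancel₀ (hZpos E)

end KineticBounds

/-! ### Enlarging the class of test functions -/

section WeakTransport

open scoped Convolution

variable {d : ℕ} {z c : Vel d → ℝ} {E : Vel d}

/-- The weak formulation of a transport equation passes to bounded pointwise limits of test
functions. -/
theorem integral_transport_eq_zero_of_tendsto (hz : Integrable z) (hc : Continuous c)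
    {b : ℝ} (hcb : ∀ v, |c v| ≤ b) {φ : ℕ → Vel d → ℝ} {φ₀ : Vel d → ℝ}
    (hφ : ∀ n, ContDiff ℝ 1 (φ n)) (h0 : ∀ n, ∫ v, z v * (c v * φ n v - fderiv ℝ (φ n) v E) = 0)
    {a : ℝ} (h1 : ∀ n v, |φ n v| ≤ a) (h2 : ∀ n v, |fderiv ℝ (φ n) v E| ≤ a)
    (hl1 : ∀ v, Tendsto (fun n => φ n v) atTop (𝓝 (φ₀ v)))
    (hl2 : ∀ v, Tendsto (fun n => fderiv ℝ (φ n) v E) atTop (𝓝 (fderiv ℝ φ₀ v E))) :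
    ∫ v, z v * (c v * φ₀ v - fderiv ℝ φ₀ v E) = 0 := by
  have hb : 0 ≤ b := (abs_nonneg _).trans (hcb 0)
  have ht : Tendsto (fun n => ∫ v, z v * (c v * φ n v - fderiv ℝ (φ n) v E)) atTop
      (𝓝 (∫ v, z v * (c v * φ₀ v - fderiv ℝ φ₀ v E))) := by
    refine tendsto_integral_of_dominated_convergence (fun v => |z v| * (b * a + a)) (fun n => ?_)
      (hz.abs.mul_const _) (fun n => Eventually.of_forall fun v => ?_)
      (Eventually.of_forall fun v => ((hl1 v).const_mul _ |>.sub (hl2 v)).const_mul _)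
    · exact hz.aestronglyMeasurable.mul ((hc.mul (hφ n).continuous).sub
        (((hφ n).continuous_fderiv one_ne_zero).clm_apply continuous_const)).aestronglyMeasurable
    · rw [norm_mul, Real.norm_eq_abs, Real.norm_eq_abs]
      refine mul_le_mul_of_nonneg_left ((abs_sub _ _).trans (add_le_add ?_ (h2 n v)))
        (abs_nonneg _)
      rw [abs_mul]
      exact mul_le_mul (hcb v) (h1 n v) (abs_nonneg _) hb
  simp only [h0] at ht
  exact (tendsto_nhds_unique ht tendsto_const_nhds)

/-- The factor 3 is 2a for the distance to g v plus a for |g v|; only uniformity in the bump β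
matters. -/
theorem abs_convolution_normed_le (β : ContDiffBump (0 : Vel d)) {g : Vel d → ℝ}
    (hg : Continuous g) {a : ℝ} (ha : ∀ v, |g v| ≤ a) (v : Vel d) :
    |(β.normed volume ⋆[ContinuousLinearMap.lsmul ℝ ℝ, volume] g) v| ≤ 3 * a := by
  have h1 := β.dist_normed_convolution_le (μ := volume) (g := g) (x₀ := v) (ε := 2 * a)
    hg.aestronglyMeasurable (fun x _ => by
      rw [Real.dist_eq]
      linarith [abs_sub (g x) (g v), ha x, ha v])
  rw [Real.dist_eq] at h1
  have h2 := abs_add_le ((β.normed volume ⋆[ContinuousLinearMap.lsmul ℝ ℝ, volume] g) v - g v) (g v)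
  rw [sub_add_cancel] at h2
  linarith [ha v]

/-- Smooth compactly supported test functions can be replaced by compactly supported `C¹`
functions. -/
theorem integral_transport_eq_zero_of_hasCompactSupport (hz : Integrable z) (hc : Continuous c)
    {b : ℝ} (hcb : ∀ v, |c v| ≤ b)
    (h0 : ∀ φ : Vel d → ℝ, ContDiff ℝ ∞ φ → HasCompactSupport φ →
      ∫ v, z v * (c v * φ v - fderiv ℝ φ v E) = 0)
    {φ : Vel d → ℝ} (hφ : ContDiff ℝ 1 φ) (hs : HasCompactSupport φ) :
    ∫ v, z v * (c v * φ v - fderiv ℝ φ v E) = 0 := by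
  set β : ℕ → ContDiffBump (0 : Vel d) := fun n =>
    ⟨1 / (n + 1) / 2, 1 / (n + 1), by positivity, half_lt_self (by positivity)⟩ with hβ
  have hβ0 : Tendsto (fun n => (β n).rOut) atTop (𝓝 0) := tendsto_one_div_add_atTop_nhds_zero_nat
  set L := ContinuousLinearMap.lsmul ℝ ℝ (E := ℝ)
  set ψ : ℕ → Vel d → ℝ := fun n => (β n).normed volume ⋆[L, volume] φ with hψ
  have hli : ∀ n, LocallyIntegrable ((β n).normed volume) (volume : Measure (Vel d)) := fun n =>
    (β n).continuous_normed.locallyIntegrable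
  have hfc : Continuous (fderiv ℝ φ) := hφ.continuous_fderiv one_ne_zero
  have hgc : Continuous fun v => fderiv ℝ φ v E := hfc.clm_apply continuous_const
  -- The derivative is put on φ rather than on the bump, so it stays bounded and converges as the
  -- bump concentrates.
  have hfd : ∀ n v, fderiv ℝ (ψ n) v E =
      ((β n).normed volume ⋆[L, volume] fun v => fderiv ℝ φ v E) v := by
    intro n v
    rw [(hs.hasFDerivAt_convolution_right L (hli n) hφ v).fderiv,
      convolution_precompR_apply L (hli n) (hs.fderiv (𝕜 := ℝ)) hfc]
  have hsm : ∀ n, ContDiff ℝ ∞ (ψ n) := fun n =>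
    (β n).hasCompactSupport_normed.contDiff_convolution_left L (β n).contDiff_normed
      hφ.continuous.locallyIntegrable
  obtain ⟨a, ha⟩ := hφ.continuous.bounded_above_of_compact_support hs
  obtain ⟨a', ha'⟩ := hgc.bounded_above_of_compact_support (hs.fderiv_apply (𝕜 := ℝ) E)
  refine integral_transport_eq_zero_of_tendsto hz hc hcb (φ := ψ) (a := 3 * max a a')
    (fun n => (hsm n).of_le (by exact_mod_cast le_top))
    (fun n => h0 _ (hsm n) ((β n).hasCompactSupport_normed.convolution L hs))
    (fun n v => ?_) (fun n v => ?_) (fun v => ?_) (fun v => ?_)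
  · exact abs_convolution_normed_le (β n) hφ.continuous
      (fun v => (ha v).trans (le_max_left _ _)) v
  · rw [hfd]
    exact abs_convolution_normed_le (β n) hgc (fun v => (ha' v).trans (le_max_right _ _)) v
  · exact ContDiffBump.convolution_tendsto_right_of_continuous hβ0 hφ.continuous v
  · simp only [hfd]
    exact ContDiffBump.convolution_tendsto_right_of_continuous hβ0 hgc v

/-- Smooth compactly supported test functions can be replaced by bounded `C¹` functions with
bounded derivative along the field. -/
theorem integral_transport_eq_zero_of_bounded (hz : Integrable z) (hc : Continuous c)
    {b : ℝ} (hcb : ∀ v, |c v| ≤ b)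
    (h0 : ∀ φ : Vel d → ℝ, ContDiff ℝ ∞ φ → HasCompactSupport φ →
      ∫ v, z v * (c v * φ v - fderiv ℝ φ v E) = 0)
    {φ : Vel d → ℝ} (hφ : ContDiff ℝ 1 φ) {a : ℝ} (h1 : ∀ v, |φ v| ≤ a)
    (h2 : ∀ v, |fderiv ℝ φ v E| ≤ a) :
    ∫ v, z v * (c v * φ v - fderiv ℝ φ v E) = 0 := by
  have ha : 0 ≤ a := (abs_nonneg _).trans (h1 0)
  let χ : ContDiffBump (0 : Vel d) := ⟨1, 2, one_pos, one_lt_two⟩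
  have hχ : ContDiff ℝ 1 χ := χ.contDiff
  have hχd : Continuous fun v => fderiv ℝ χ v E :=
    (hχ.continuous_fderiv one_ne_zero).clm_apply continuous_const
  obtain ⟨B, hB⟩ := hχd.bounded_above_of_compact_support
    (χ.hasCompactSupport.fderiv_apply (𝕜 := ℝ) E)
  have hB0 : 0 ≤ B := (norm_nonneg _).trans (hB 0)
  set r : ℕ → ℝ := fun n => 1 / ((n : ℝ) + 1) with hr
  have hr0 : ∀ n, 0 < r n := fun n => by positivity
  have hr1 : ∀ n, r n ≤ 1 := fun n => by
    rw [hr]; exact div_le_self zero_le_one (by linarith [n.cast_nonneg (α := ℝ)])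
  have hrl : Tendsto r atTop (𝓝 0) := tendsto_one_div_add_atTop_nhds_zero_nat
  have hcut : ∀ n, ContDiff ℝ 1 (fun v : Vel d => χ (r n • v)) := fun n =>
    hχ.comp (contDiff_const_smul _)
  -- Differentiating the dilated cutoff produces a factor r n, so the second term is bounded and
  -- tends to 0.
  have hfd : ∀ n v, fderiv ℝ (fun v => χ (r n • v) * φ v) v E =
      χ (r n • v) * fderiv ℝ φ v E + φ v * (r n * fderiv ℝ χ (r n • v) E) := by
    intro n v
    rw [fderiv_fun_mul ((hcut n).differentiable one_ne_zero v)
      (hφ.differentiable one_ne_zero v), fderiv_comp_smul]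
    simp
  have hcl : ∀ v : Vel d, Tendsto (fun n => χ (r n • v)) atTop (𝓝 1) := by
    intro v
    have h3 : Tendsto (fun n => r n • v) atTop (𝓝 0) := by simpa using hrl.smul_const v
    have h4 : χ 0 = 1 := χ.one_of_mem_closedBall (Metric.mem_closedBall_self zero_le_one)
    rw [← h4]
    exact (hχ.continuous.tendsto 0).comp h3
  have hχ1 : ∀ v, |χ v| ≤ 1 := fun v => by
    rw [abs_of_nonneg χ.nonneg]; exact χ.le_one
  refine integral_transport_eq_zero_of_tendsto hz hc hcb
    (φ := fun n v => χ (r n • v) * φ v) (a := a + a * B)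
    (fun n => (hcut n).mul hφ) (fun n => ?_) (fun n v => ?_) (fun n v => ?_) (fun v => ?_)
    (fun v => ?_)
  · refine integral_transport_eq_zero_of_hasCompactSupport hz hc hcb h0 ((hcut n).mul hφ) ?_
    exact (χ.hasCompactSupport.comp_smul (hr0 n).ne').mul_right
  · rw [abs_mul]
    have := mul_le_mul (hχ1 (r n • v)) (h1 v) (abs_nonneg _) zero_le_one
    linarith [mul_nonneg ha hB0]
  · rw [hfd]
    refine (abs_add_le _ _).trans ?_
    rw [abs_mul, abs_mul, abs_mul, abs_of_pos (hr0 n)]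
    have h3 := mul_le_mul (hχ1 (r n • v)) (h2 v) (abs_nonneg _) zero_le_one
    have h4 : r n * |fderiv ℝ χ (r n • v) E| ≤ 1 * B :=
      mul_le_mul (hr1 n) (hB _) (abs_nonneg _) zero_le_one
    have h5 := mul_le_mul (h1 v) h4 (by have := hr0 n; positivity) ha
    linarith
  · simpa using (hcl v).mul_const (φ v)
  · simp only [hfd]
    have h3 : Tendsto (fun n => φ v * (r n * fderiv ℝ χ (r n • v) E)) atTop (𝓝 0) := by
      have h4 : Tendsto (fun n => r n * B) atTop (𝓝 0) := by simpa using hrl.mul_const B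
      have h5 : Tendsto (fun n => r n * fderiv ℝ χ (r n • v) E) atTop (𝓝 0) := by
        refine squeeze_zero_norm (fun n => ?_) h4
        rw [norm_mul, Real.norm_of_nonneg (hr0 n).le]
        exact mul_le_mul_of_nonneg_left (hB _) (hr0 n).le
      simpa using h5.const_mul (φ v)
    simpa using ((hcl v).mul_const (fderiv ℝ φ v E)).add h3

end WeakTransport

/-! ### Weak solutions and uniqueness -/

theorem isTame_const_field {d : ℕ} {g : Vel d → ℝ} (hg : ContDiff ℝ 1 g) {a : ℝ}
    (h1 : ∀ v, |g v| ≤ a) (h2 : ∀ v, ‖fderiv ℝ g v‖ ≤ a / (1 + ‖v‖)) :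
    IsTame (fun p : Vel d × Vel d => g p.2) := by
  have ha : 0 ≤ a := (abs_nonneg _).trans (h1 0)
  refine ⟨hg.comp contDiff_snd, fun R _ => ⟨a, ha, fun E v _ => ⟨h1 v, fun w => ?_, fun e => ?_⟩⟩⟩
  all_goals
    have hd : HasFDerivAt (fun p : Vel d × Vel d => g p.2)
        ((fderiv ℝ g v).comp (ContinuousLinearMap.snd ℝ (Vel d) (Vel d))) (E, v) :=
      HasFDerivAt.comp (g := g) (E, v) (hg.differentiable one_ne_zero v).hasFDerivAt
        hasFDerivAt_snd
    rw [hd.fderiv]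
  · exact ((fderiv ℝ g v).le_opNorm w).trans (mul_le_mul_of_nonneg_right (h2 v) (norm_nonneg w))
  · simp only [ContinuousLinearMap.comp_apply, ContinuousLinearMap.coe_snd', map_zero, abs_zero]
    positivity

theorem isTame_of_hasCompactSupport {d : ℕ} {g : Vel d → ℝ} (hg : ContDiff ℝ 1 g)
    (hs : HasCompactSupport g) : IsTame (fun p : Vel d × Vel d => g p.2) := by
  obtain ⟨a₁, ha₁⟩ := hg.continuous.bounded_above_of_compact_support hs
  have hdc : Continuous fun v => (1 + ‖v‖) • fderiv ℝ g v :=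
    (by fun_prop : Continuous fun v : Vel d => 1 + ‖v‖).smul (hg.continuous_fderiv one_ne_zero)
  have hds : HasCompactSupport fun v => (1 + ‖v‖) • fderiv ℝ g v :=
    HasCompactSupport.smul_left (f := fun v : Vel d => 1 + ‖v‖) (hs.fderiv (𝕜 := ℝ))
  obtain ⟨a₂, ha₂⟩ := hdc.bounded_above_of_compact_support hds
  refine isTame_const_field hg (a := max a₁ a₂) (fun v => (ha₁ v).trans (le_max_left _ _))
    fun v => ?_
  rw [le_div_iff₀ (by positivity)]
  have := ha₂ v
  rw [norm_smul, Real.norm_of_nonneg (by positivity), mul_comm] at this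
  exact this.trans (le_max_right _ _)

namespace KineticBounds

variable {d : ℕ} {M : Vel d → ℝ} {σ : Vel d → Vel d → ℝ} {ν₁ ν₂ ν₀ A : ℝ} {k : ℕ}
  (h : KineticBounds M σ ν₁ ν₂ ν₀ A k)
include h

theorem resolvent_contDiff {U : Vel d × Vel d → ℝ} (hU : IsTame U) (E : Vel d) :
    ContDiff ℝ 1 (resolvent M σ E fun w => U (E, w)) :=
  (h.fieldResolvent_isDominated (σ := σ) hU).contDiff.comp (contDiff_const.prodMk contDiff_id)

/-- The resolvent of a tame function is a classical solution of the transport equation. -/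
theorem fderiv_resolvent_field {U : Vel d × Vel d → ℝ} (hU : IsTame U) (E v : Vel d) :
    fderiv ℝ (resolvent M σ E fun w => U (E, w)) v E =
      M v * U (E, v) - collisionFrequency M σ v * resolvent M σ E (fun w => U (E, w)) v := by
  have h1 := h.hasDerivAt_resolvent (hU.continuous_slice E) (hU.bounded_slice E) E v
  have h2 := ((h.resolvent_contDiff hU E).differentiable one_ne_zero v).hasFDerivAt
  have h3 : HasDerivAt (fun r : ℝ => v + r • E) E 0 := by
    simpa using ((hasDerivAt_id (0 : ℝ)).smul_const E).const_add v
  have h4 : HasFDerivAt (resolvent M σ E fun w => U (E, w))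
      (fderiv ℝ (resolvent M σ E fun w => U (E, w)) v) (v + (0 : ℝ) • E) := by
    simpa using h2
  have h5 := h4.comp_hasDerivAt (0 : ℝ) h3
  exact h5.unique h1

theorem collision_eq {f : Vel d → ℝ} (hf : Integrable f) (v : Vel d) :
    collision M σ f v = M v * gain σ f v - collisionFrequency M σ v * f v := by
  have h1 : Integrable fun v' => σ v v' * M v * f v' :=
    ((h.integrable_sigma_mul hf v).const_mul (M v)).congr
      (Eventually.of_forall fun v' => by ring)
  have h2 : Integrable fun v' => σ v' v * M v' * f v := by
    have := (h.integrable_sigma_mul h.integrable v).mul_const (f v)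
    simpa only [h.sigma_symm v] using this
  rw [collision, integral_sub h1 h2, integral_mul_const, collisionFrequency, gain,
    ← integral_const_mul]
  congr 2; ext v'; ring

/-- An integrable function which is a weak solution of `E · ∇ z + ν z = 0` vanishes. -/
theorem ae_eq_zero_of_weak_transport {z : Vel d → ℝ} (hz : Integrable z) {E : Vel d}
    (h0 : ∀ φ : Vel d → ℝ, ContDiff ℝ ∞ φ → HasCompactSupport φ →
      ∫ v, z v * (collisionFrequency M σ v * φ v - fderiv ℝ φ v E) = 0) :
    ∀ᵐ v, z v = 0 := by
  refine ae_eq_zero_of_integral_contDiff_smul_eq_zero hz.locallyIntegrable fun ψ hψ hψs => ?_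
  have hMne : ∀ v, M v ≠ 0 := fun v => (h.pos v).ne'
  have hg : ContDiff ℝ 1 fun v => ψ v / M v :=
    (hψ.of_le (by exact_mod_cast le_top)).div h.contDiff hMne
  have hgs : HasCompactSupport fun v => ψ v / M v := by
    simp only [div_eq_mul_inv]; exact hψs.mul_right
  obtain ⟨a₁, ha₁⟩ := hg.continuous.bounded_above_of_compact_support hgs
  have htame : IsTame fun p : Vel d × Vel d => ψ p.2 / M p.2 :=
    isTame_of_hasCompactSupport hg hgs
  -- Duality: reversing the field gives the adjoint equation νφ - E·∇φ = ψ, the division by M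
  -- compensating for the M built into the resolvent. This φ need not have compact support, but it
  -- and its derivative along E are bounded, which is why the test class was enlarged.
  set φ := resolvent M σ (-E) fun w => ψ w / M w with hφ
  have hφc : ContDiff ℝ 1 φ := h.resolvent_contDiff htame (-E)
  have hφd : ∀ v, fderiv ℝ φ v E = collisionFrequency M σ v * φ v - ψ v := by
    intro v
    have := h.fderiv_resolvent_field htame (-E) v
    simp only [map_neg, mul_div_cancel₀ _ (hMne v)] at this
    linarith
  obtain ⟨B, hB0, hB⟩ : ∃ B, 0 ≤ B ∧ ∀ v, |φ v| ≤ B := by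
    have hb : ∀ v, |ψ v / M v| ≤ a₁ := ha₁
    have ha : 0 ≤ a₁ := (abs_nonneg _).trans (hb 0)
    have hA := h.A_pos
    have hdm := decayMoment_nonneg ν₁ k
    refine ⟨A * (1 + ‖-E‖) ^ k * decayMoment ν₁ k * a₁ * A, by positivity, fun v => ?_⟩
    refine (h.abs_resolvent_le hb (norm_nonneg (-E)) le_rfl v).trans ?_
    gcongr
    exact h.le_bound v
  obtain ⟨C, hC⟩ := hψ.continuous.bounded_above_of_compact_support hψs
  have hC0 : 0 ≤ C := (norm_nonneg _).trans (hC 0)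
  have hν := h.upper_pos
  have key := integral_transport_eq_zero_of_bounded hz h.continuous_frequency h.frequency_abs_le h0
    hφc (a := B + (ν₂ * B + C)) (fun v => (hB v).trans (by nlinarith [mul_nonneg hν.le hB0]))
    (fun v => by
      rw [hφd]
      have h3 := mul_le_mul (h.frequency_abs_le v) (hB v) (abs_nonneg _) hν.le
      rw [← abs_mul] at h3
      have h4 : |ψ v| ≤ C := hC v
      linarith [abs_sub (collisionFrequency M σ v * φ v) (ψ v)])
  rw [← key]
  congr 1; ext v
  rw [hφd, smul_eq_mul]
  ring

end KineticBounds

namespace KineticBounds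

variable {d : ℕ} {M : Vel d → ℝ} {σ : Vel d → Vel d → ℝ} {ν₁ ν₂ ν₀ A : ℝ} {k : ℕ}
  (h : KineticBounds M σ ν₁ ν₂ ν₀ A k)
include h

/-- Weak form of the transport equation solved by the resolvent of a tame function. -/
theorem integral_resolvent_mul_fderiv {U : Vel d × Vel d → ℝ} (hU : IsTame U) (E : Vel d)
    {φ : Vel d → ℝ} (hφ : ContDiff ℝ ∞ φ) (hs : HasCompactSupport φ) :
    ∫ v, resolvent M σ E (fun w => U (E, w)) v * fderiv ℝ φ v E =
      -∫ v, (M v * U (E, v) -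
        collisionFrequency M σ v * resolvent M σ E (fun w => U (E, w)) v) * φ v := by
  set f := resolvent M σ E fun w => U (E, w) with hf
  have hfc : ContDiff ℝ 1 f := h.resolvent_contDiff hU E
  have hφ1 : ContDiff ℝ 1 φ := hφ.of_le (by exact_mod_cast le_top)
  have hfd : Continuous fun v => fderiv ℝ f v E :=
    (hfc.continuous_fderiv one_ne_zero).clm_apply continuous_const
  have hφd : Continuous fun v => fderiv ℝ φ v E :=
    (hφ1.continuous_fderiv one_ne_zero).clm_apply continuous_const
  rw [integral_mul_fderiv_eq_neg_fderiv_mul_of_integrable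
    ((hfd.mul hφ.continuous).integrable_of_hasCompactSupport hs.mul_left)
    ((hfc.continuous.mul hφd).integrable_of_hasCompactSupport
      (hs.fderiv_apply (𝕜 := ℝ) E).mul_left)
    ((hfc.continuous.mul hφ.continuous).integrable_of_hasCompactSupport hs.mul_left)
    (fun x _ => hfc.differentiable one_ne_zero x) (fun x _ => hφ1.differentiable one_ne_zero x)]
  congr 2; ext v
  rw [hf, h.fderiv_resolvent_field hU]

theorem integrable_gain_mul_M {f : Vel d → ℝ} (hf : Integrable f) :
    Integrable fun v => M v * gain σ f v :=
  (h.integrable_mul_M (h.gain_contDiff hf).1.continuous ⟨_, h.abs_gain_le hf⟩).congr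
    (Eventually.of_forall fun _ => mul_comm _ _)

theorem gain_isTame {f : Vel d → ℝ} (hf : Integrable f) :
    IsTame (fun p : Vel d × Vel d => gain σ f p.2) := by
  have hI : 0 ≤ ∫ v, |f v| := integral_nonneg fun _ => abs_nonneg _
  have hA := h.A_pos
  have hν := h.upper_pos
  refine isTame_const_field (h.gain_contDiff hf).1 (a := (ν₂ + A) * ∫ v, |f v|) (fun v => ?_)
    fun v => ?_
  · exact (h.abs_gain_le hf v).trans (mul_le_mul_of_nonneg_right (by linarith) hI)
  · refine ((h.gain_contDiff hf).2 v).trans (div_le_div_of_nonneg_right ?_ (by positivity))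
    exact mul_le_mul_of_nonneg_right (by linarith) hI

/-- Every integrable weak solution is the resolvent of its own gain. -/
theorem ae_eq_resolvent_gain {E : Vel d} {f : Vel d → ℝ} (hf : IsNormalizedSolution M σ E f) :
    f =ᵐ[volume] resolvent M σ E (gain σ f) := by
  have hT := h.gain_isTame hf.integrable
  set w := resolvent M σ E (gain σ f) with hw
  have hwi : Integrable w := h.integrable_resolvent (hT.continuous_slice E) (hT.bounded_slice E) E
  have key : ∀ᵐ v, f v - w v = 0 := by
    -- Both functions solve the transport equation with the same source M K f, so their difference
    -- solves the homogeneous one.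
    refine h.ae_eq_zero_of_weak_transport (hf.integrable.sub hwi) (E := E) fun φ hφ hs => ?_
    have hφ1 : ContDiff ℝ 1 φ := hφ.of_le (by exact_mod_cast le_top)
    have hφd : Continuous fun v => fderiv ℝ φ v E :=
      (hφ1.continuous_fderiv one_ne_zero).clm_apply continuous_const
    obtain ⟨a, ha⟩ := hφ.continuous.bounded_above_of_compact_support hs
    obtain ⟨b, hb⟩ := hφd.bounded_above_of_compact_support (hs.fderiv_apply (𝕜 := ℝ) E)
    have hmφ : ∀ {g : Vel d → ℝ}, Integrable g → Integrable fun v => g v * φ v := fun hg =>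
      hg.mul_bdd hφ.continuous.aestronglyMeasurable (Eventually.of_forall ha)
    have hmd : ∀ {g : Vel d → ℝ}, Integrable g → Integrable fun v => g v * fderiv ℝ φ v E :=
      fun hg => hg.mul_bdd hφd.aestronglyMeasurable (Eventually.of_forall hb)
    have hi : ∀ {g : Vel d → ℝ}, Integrable g →
        Integrable fun v => (M v * gain σ f v - collisionFrequency M σ v * g v) * φ v := fun hg =>
      hmφ ((h.integrable_gain_mul_M hf.integrable).sub (h.integrable_frequency_mul hg))
    have h1 := hf.equation φ hφ hs
    have h2 : ∫ v, w v * fderiv ℝ φ v E =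
        -∫ v, (M v * gain σ f v - collisionFrequency M σ v * w v) * φ v :=
      h.integral_resolvent_mul_fderiv hT E hφ hs
    simp only [h.collision_eq hf.integrable] at h1
    have h3 : ∫ v, (f v - w v) * (collisionFrequency M σ v * φ v - fderiv ℝ φ v E) =
        ∫ v, ((M v * gain σ f v - collisionFrequency M σ v * w v) * φ v -
          (M v * gain σ f v - collisionFrequency M σ v * f v) * φ v -
          (f v * fderiv ℝ φ v E - w v * fderiv ℝ φ v E)) := by
      congr 1; ext v; ring
    refine h3.trans ?_
    have hA : Integrable fun v => (M v * gain σ f v - collisionFrequency M σ v * w v) * φ v -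
        (M v * gain σ f v - collisionFrequency M σ v * f v) * φ v := (hi hwi).sub (hi hf.integrable)
    have hB : Integrable fun v => f v * fderiv ℝ φ v E - w v * fderiv ℝ φ v E :=
      (hmd hf.integrable).sub (hmd hwi)
    rw [integral_sub hA hB,
      integral_sub (hi hwi) (hi hf.integrable), integral_sub (hmd hf.integrable) (hmd hwi)]
    linarith
  exact key.mono fun v hv => sub_eq_zero.1 hv

omit h in
theorem gain_congr_ae {f g : Vel d → ℝ} (hfg : f =ᵐ[volume] g) : gain σ f = gain σ g :=
  funext fun v => integral_congr_ae (hfg.mono fun w hw => by simp only [hw])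

/-- Fixed points of `gain ∘ resolvent` without mass vanish. -/
theorem eq_zero_of_gain_resolvent_eq {E : Vel d} {g : Vel d → ℝ} (hg : Continuous g)
    (hb : ∃ a, ∀ v, |g v| ≤ a) (hfix : ∀ v, gain σ (resolvent M σ E g) v = g v)
    (h0 : ∫ v, g v * M v = 0) (v : Vel d) : g v = 0 := by
  have h1 := h.lower_pos
  have h2 := h.upper_pos
  have hκ : 0 < ν₁ / ν₂ := by positivity
  -- Without M-mass the correction term disappears, so g is fixed by a strict L¹(M) contraction.
  have hred : reducedGain M σ (ν₁ / ν₂) E g = g := by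
    ext v; rw [reducedGain, h0, hfix]; ring
  have h3 := h.integral_abs_reducedGain_le hg hb hκ.le (by field_simp; rfl) E
  rw [hred] at h3
  have h4 : 0 ≤ ∫ v, |g v| * M v :=
    integral_nonneg fun v => mul_nonneg (abs_nonneg _) (h.pos v).le
  have h5 : ∫ v, |g v| * M v = 0 := by nlinarith
  have h6 := h.abs_reducedGain_le hg hb hκ.le E v
  rw [hred, h5, mul_zero] at h6
  exact abs_nonpos_iff.1 h6

/-- The function g = K f is a fixed point of K T. Subtracting the multiple c G with the same M-mass
leaves a massless fixed point, which vanishes; so f = c T G almost everywhere, and unit mass gives c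
= 1. -/
theorem ae_eq_of_isNormalizedSolution {G : Vel d × Vel d → ℝ} (hG : IsTame G)
    (hG0 : ∀ p, 0 ≤ G p)
    (hfix : ∀ E v, gain σ (resolvent M σ E fun w => G (E, w)) v = G (E, v))
    (hmass : ∀ E, ∫ v, resolvent M σ E (fun w => G (E, w)) v = 1) {E : Vel d} {f : Vel d → ℝ}
    (hf : IsNormalizedSolution M σ E f) :
    f =ᵐ[volume] resolvent M σ E fun w => G (E, w) := by
  have hT := h.gain_isTame hf.integrable
  have hfw := h.ae_eq_resolvent_gain hf
  set g := gain σ f with hg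
  have hgc : Continuous g := hT.continuous_slice E
  have hgb : ∃ a, ∀ v, |g v| ≤ a := hT.bounded_slice E
  have hGc := hG.continuous_slice E
  have hGb := hG.bounded_slice E
  -- The gain ignores null sets, so an almost everywhere identity becomes an identity everywhere.
  have hgfix : gain σ (resolvent M σ E g) = g := (gain_congr_ae hfw).symm
  have hI : 0 < ∫ v, G (E, v) * M v := by
    have := h.lower_mul_integral_resolvent_le hGc hGb (fun v => hG0 (E, v)) E
    rw [hmass E, mul_one] at this
    exact h.lower_pos.trans_le this
  set c := (∫ v, g v * M v) / ∫ v, G (E, v) * M v with hc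
  have hcGb : ∃ a, ∀ v, |c * G (E, v)| ≤ a := by
    obtain ⟨a, ha⟩ := hGb
    exact ⟨|c| * a, fun _ => by
      rw [abs_mul]; exact mul_le_mul_of_nonneg_left (ha _) (abs_nonneg c)⟩
  have hres : ∀ v, resolvent M σ E (fun w => g w - c * G (E, w)) v =
      resolvent M σ E g v - c * resolvent M σ E (fun w => G (E, w)) v := fun v => by
    rw [h.resolvent_sub hgc hgb (hGc.const_mul c) hcGb, resolvent_const_mul]
  have hzero : ∀ v, g v - c * G (E, v) = 0 := by
    refine h.eq_zero_of_gain_resolvent_eq (E := E) (hgc.sub (hGc.const_mul c)) ?_ (fun v => ?_) ?_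
    · obtain ⟨a, ha⟩ := hgb
      obtain ⟨b, hb⟩ := hcGb
      exact ⟨a + b, fun v => (abs_sub _ _).trans (add_le_add (ha v) (hb v))⟩
    · have hi := h.integrable_resolvent hGc hGb E
      rw [funext hres, h.gain_sub (h.integrable_resolvent hgc hgb E) (hi.const_mul c), hgfix,
        ← hfix E v]
      congr 1
      rw [gain, gain, ← integral_const_mul]
      congr 1; ext w; ring
    · have : ∀ v, (g v - c * G (E, v)) * M v = g v * M v - c * (G (E, v) * M v) := fun v => by ring
      simp only [this]
      rw [integral_sub (h.integrable_mul_M hgc hgb) ((h.integrable_mul_M hGc hGb).const_mul c),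
        integral_const_mul, hc, div_mul_cancel₀ _ hI.ne', sub_self]
  have hgG : resolvent M σ E g = fun v => c * resolvent M σ E (fun w => G (E, w)) v := by
    ext v
    rw [← resolvent_const_mul]
    congr 1; ext w
    exact sub_eq_zero.1 (hzero w)
  rw [hgG] at hfw
  have hc1 : c = 1 := by
    have := integral_congr_ae hfw
    rw [hf.integral_eq_one, integral_const_mul, hmass E, mul_one] at this
    exact this.symm
  refine hfw.trans (Eventually.of_forall fun v => ?_)
  simp [hc1]

theorem isNormalizedSolution_resolvent {G : Vel d × Vel d → ℝ} (hG : IsTame G)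
    (hfix : ∀ E v, gain σ (resolvent M σ E fun w => G (E, w)) v = G (E, v))
    (hmass : ∀ E, ∫ v, resolvent M σ E (fun w => G (E, w)) v = 1) (E : Vel d) :
    IsNormalizedSolution M σ E (resolvent M σ E fun w => G (E, w)) := by
  have hi := h.integrable_resolvent (hG.continuous_slice E) (hG.bounded_slice E) E
  refine ⟨hi, hmass E, fun φ hφ hs => ?_⟩
  rw [h.integral_resolvent_mul_fderiv hG E hφ hs]
  simp only [h.collision_eq hi, hfix]
  ring

/-! ### Lower bound and decay of the field derivative -/

/-- Lower bound for the resolvent of a function which is bounded below. -/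
theorem exists_le_resolvent {R : ℝ} (hR : 0 ≤ R) : ∃ c, 0 < c ∧ ∀ (g : Vel d → ℝ), Continuous g →
    (∃ a, ∀ v, |g v| ≤ a) → (∀ v, ν₁ ≤ g v) → ∀ E : Vel d, ‖E‖ ≤ R → ∀ v,
      c * M v ≤ resolvent M σ E g v := by
  have hA := h.A_pos
  have hν := h.lower_pos
  -- Only times t ≤ 1 are kept: there the attenuation is at least exp(-ν₂), and translating back by
  -- -E gives M(v) ≤ D M(v - tE).
  set D := A * (1 + R) ^ k * 2 ^ k with hD
  have hD0 : 0 < D := by positivity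
  refine ⟨Real.exp (-ν₂) / D * ν₁, by positivity, fun g hg hb hge E hE v => ?_⟩
  have hi := h.integrableOn_propagator_mul hg hb E v
  have h0 : ∀ t, 0 ≤ propagator M σ t (E, v) * g (v - t • E) := fun t =>
    mul_nonneg (h.propagator_pos _ _).le (hν.le.trans (hge _))
  have h1 : ∀ t ∈ Set.Ioc (0 : ℝ) 1, Real.exp (-ν₂) / D * ν₁ * M v ≤
      propagator M σ t (E, v) * g (v - t • E) := by
    intro t ht
    have h2 : M v ≤ D * M (v - t • E) := by
      have h3 := h.M_shift_le hR ht.1.le (E := -E) (by simpa using hE) (v - t • E)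
      rw [smul_neg, sub_neg_eq_add, sub_add_cancel] at h3
      refine h3.trans ?_
      have := (h.pos (v - t • E)).le
      have := ht.1
      rw [hD]
      gcongr
      linarith [ht.2]
    have h4 : Real.exp (-ν₂) / D * M v ≤ propagator M σ t (E, v) := by
      refine le_trans ?_ (h.le_propagator ht.1.le E v)
      rw [div_mul_eq_mul_div, mul_div_assoc]
      have h5 : M v / D ≤ M (v - t • E) := by
        rw [div_le_iff₀ hD0]; linarith
      have h6 : Real.exp (-ν₂) ≤ Real.exp (-(ν₂ * t)) := by
        rw [Real.exp_le_exp]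
        nlinarith [h.upper_pos, ht.2]
      have := (h.pos v).le
      exact mul_le_mul h6 h5 (by positivity) (Real.exp_pos _).le
    calc _ = Real.exp (-ν₂) / D * M v * ν₁ := by ring
      _ ≤ _ := mul_le_mul h4 (hge _) hν.le (h.propagator_pos _ _).le
  calc Real.exp (-ν₂) / D * ν₁ * M v
      = ∫ t in Set.Ioc (0 : ℝ) 1, Real.exp (-ν₂) / D * ν₁ * M v := by
        rw [setIntegral_const]; simp
    _ ≤ ∫ t in Set.Ioc (0 : ℝ) 1, propagator M σ t (E, v) * g (v - t • E) :=
        setIntegral_mono_on (integrable_const _) (hi.mono_set Set.Ioc_subset_Ioi_self) measurableSet_Ioc h1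
    _ ≤ _ := setIntegral_mono_set hi (Eventually.of_forall h0)
        (Eventually.of_forall Set.Ioc_subset_Ioi_self)

/-- Zero mass permits replacing σ by σ - ν₀, which is O(1/(1+|v|)). -/
theorem abs_gain_le_div_of_integral_eq_zero {f : Vel d → ℝ} (hf : Integrable f)
    (h0 : ∫ v, f v = 0) (v : Vel d) : |gain σ f v| ≤ A * (∫ w, |f w|) / (1 + ‖v‖) := by
  have h1 : gain σ f v = ∫ w, (σ v w - ν₀) * f w := by
    simp only [sub_mul]
    rw [integral_sub (h.integrable_sigma_mul hf v) (hf.const_mul _), integral_const_mul, h0,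
      mul_zero, sub_zero, gain]
  rw [h1, mul_div_right_comm, ← integral_const_mul]
  rw [← Real.norm_eq_abs]
  refine norm_integral_le_of_norm_le (f := fun w => (σ v w - ν₀) * f w) (hf.abs.const_mul _) (Eventually.of_forall fun w => ?_)
  rw [norm_mul]
  exact mul_le_mul_of_nonneg_right (h.sigma_limit v w) (abs_nonneg _)

/-- The derivative of the solution with respect to the field decays faster than `M`. -/
theorem exists_abs_fderiv_le {G : Vel d × Vel d → ℝ} (hG : IsTame G)
    (hfix : ∀ E v, gain σ (resolvent M σ E fun w => G (E, w)) v = G (E, v))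
    (hmass : ∀ E, ∫ v, resolvent M σ E (fun w => G (E, w)) v = 1) {R : ℝ} (hR : 0 ≤ R) :
    ∃ C, 0 ≤ C ∧ ∀ E v e : Vel d, ‖E‖ ≤ R →
      |fderiv ℝ (fieldResolvent M σ G) (E, v) (e, 0)| ≤ C * (M v / (1 + ‖v‖)) * ‖e‖ := by
  have hA := h.A_pos
  have hdom := h.fieldResolvent_isDominated (σ := σ) hG
  obtain ⟨a, ha0, ha⟩ := hdom.bound R hR
  obtain ⟨b, hb0, hb⟩ := hG.bound R hR
  have hd1 := decayMoment_nonneg ν₁ (k + 1)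
  have hd3 := decayMoment_nonneg ν₁ (k + 3)
  refine ⟨4 * A ^ 2 * (1 + R) ^ (k + 1) * decayMoment ν₁ (k + 3) * b +
    A * (1 + R) ^ (k + 1) * decayMoment ν₁ (k + 1) * (A * a), by positivity,
    fun E v e hE => ?_⟩
  have hGeq : fieldGain σ (fieldResolvent M σ G) = G := funext fun p => hfix p.1 p.2
  have hint := hdom.integrable_fderiv_slice h.integrable E e
  -- The mass is 1 for every E, so its derivative in E vanishes.
  have hzero : ∫ w, fderiv ℝ (fieldResolvent M σ G) (E, w) (e, 0) = 0 := by
    rw [← (hdom.contDiff_integral h.integrable).2]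
    have : (fun E => ∫ w, fieldResolvent M σ G (E, w)) = fun _ => 1 := funext hmass
    rw [this]
    simp
  have hL1 : ∫ w, |fderiv ℝ (fieldResolvent M σ G) (E, w) (e, 0)| ≤ a * ‖e‖ := by
    have := integral_mono hint.abs ((h.integrable.const_mul a).mul_const ‖e‖)
      fun w => IsDominated.abs_fderiv_apply_le (ha E w hE).2 e
    rwa [integral_mul_const, integral_const_mul, h.integral_eq_one, mul_one] at this
  -- Differentiating G = K F gives ∂_E G = K(∂_E F), with ∂_E F of zero mass. The resolvent
  -- preserves the resulting decay, and the commutator has it as well.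
  have hDG : ∀ w, |fderiv ℝ G (E, w) (e, 0)| ≤ A * (a * ‖e‖) / (1 + ‖w‖) := by
    intro w
    have h1 := (h.fieldGain_contDiff hdom).2 E w e
    rw [hGeq] at h1
    rw [h1]
    refine (h.abs_gain_le_div_of_integral_eq_zero hint hzero w).trans ?_
    gcongr
  have h2 := h.abs_resolvent_le_div hDG hR hE v
  have h3 := h.abs_fderiv_fieldResolvent_sub_le hG hR hE (fun w => (hb E w hE).1)
    (fun v => (hb E v hE).2.1) v e
  have h4 := abs_add_le (fderiv ℝ (fieldResolvent M σ G) (E, v) (e, 0) -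
    resolvent M σ E (fun w => fderiv ℝ G (E, w) (e, 0)) v)
    (resolvent M σ E (fun w => fderiv ℝ G (E, w) (e, 0)) v)
  rw [sub_add_cancel] at h4
  refine h4.trans ((add_le_add h3 h2).trans_eq ?_)
  ring

end KineticBounds
end LinearBoltzmann

/-! ### The main theorem -/

theorem theorem2p2 (d : ℕ) (α : ℝ) (hα₁ : 1 ≤ α) (hα₂ : α < 2)
    (M : LinearBoltzmann.Vel d → ℝ)
    (σ : LinearBoltzmann.Vel d → LinearBoltzmann.Vel d → ℝ)
    (hM : LinearBoltzmann.IsHeavyTailEquilibrium α M)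
    (hσ : LinearBoltzmann.IsCrossSection M σ) :
    ∃ F : LinearBoltzmann.Vel d → LinearBoltzmann.Vel d → ℝ,
      -- (i) existence of a solution, and uniqueness among all distributional solutions
      (∀ E : LinearBoltzmann.Vel d,
        ContDiff ℝ 1 (fun v => F v E) ∧
        Integrable (fun v => F v E ^ 2 / M v) ∧
        (∀ v, fderiv ℝ (fun w => F w E) v E
          - LinearBoltzmann.collision M σ (fun w => F w E) v = 0) ∧
        LinearBoltzmann.IsNormalizedSolution M σ E (fun v => F v E) ∧
        ∀ f : LinearBoltzmann.Vel d → ℝ, LinearBoltzmann.IsNormalizedSolution M σ E f →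
          f =ᵐ[volume] fun v => F v E) ∧
      -- (ii) two-sided comparison with the equilibrium
      (∀ R : ℝ, 0 < R → ∃ c C : ℝ, 0 < c ∧ 0 < C ∧
        ∀ E : LinearBoltzmann.Vel d, ‖E‖ ≤ R → ∀ v, c * M v ≤ F v E ∧ F v E ≤ C * M v) ∧
      -- (iii) regularity with respect to the field
      (∀ v, ContDiff ℝ 1 (fun E => F v E)) ∧
      (∀ R : ℝ, 0 < R → ∃ C : ℝ, 0 < C ∧
        ∀ v E : LinearBoltzmann.Vel d, ‖E‖ ≤ R →
          ‖fderiv ℝ (fun E' => F v E') E‖ ≤ C * (F v E / (1 + ‖v‖))) := by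
  open LinearBoltzmann in
  obtain ⟨ν₁, ν₂, ν₀, A, k, h⟩ := exists_kineticBounds hα₁ hM hσ
  obtain ⟨G, hG, hG0, hfix, hmass⟩ := h.exists_fixedPoint
  have hdom := h.fieldResolvent_isDominated (σ := σ) hG
  have hGE := fun E => hG.continuous_slice E
  have hGb := fun E => hG.bounded_slice E
  have hlow : ∀ R, 0 ≤ R → ∃ c, 0 < c ∧ ∀ E : Vel d, ‖E‖ ≤ R → ∀ v,
      c * M v ≤ fieldResolvent M σ G (E, v) := by
    intro R hR
    obtain ⟨c, hc, hcb⟩ := h.exists_le_resolvent (σ := σ) hR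
    refine ⟨c, hc, fun E hE v => hcb _ (hGE E) (hGb E) (fun w => ?_) E hE v⟩
    -- Here G = K F with F nonnegative of unit mass, so G ≥ ν₁.
    have := h.lower_mul_integral_le_gain (h.integrable_resolvent (hGE E) (hGb E) E)
      (h.resolvent_nonneg (fun w => hG0 (E, w)) E) w
    rwa [hmass, mul_one, hfix] at this
  refine ⟨fun v E => fieldResolvent M σ G (E, v), fun E => ⟨?_, ?_, fun v => ?_, ?_, ?_⟩,
    fun R hR => ?_, fun v => ?_, fun R hR => ?_⟩
  · exact h.resolvent_contDiff hG E
  · obtain ⟨a, ha0, ha⟩ := hdom.bound ‖E‖ (norm_nonneg E)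
    refine (h.integrable.const_mul (a ^ 2)).mono'
      (((hdom.continuous_slice E).pow 2).div h.continuous_M
        fun v => (h.pos v).ne').aestronglyMeasurable (Filter.Eventually.of_forall fun v => ?_)
    rw [Real.norm_of_nonneg (div_nonneg (sq_nonneg _) (h.pos v).le), div_le_iff₀ (h.pos v),
      ← sq_abs]
    calc _ ≤ (a * M v) ^ 2 := by gcongr; exact (ha E v le_rfl).1
      _ = _ := by ring
  · change fderiv ℝ (resolvent M σ E fun w => G (E, w)) v E -
      collision M σ (resolvent M σ E fun w => G (E, w)) v = 0
    rw [h.fderiv_resolvent_field hG, h.collision_eq (h.integrable_resolvent (hGE E) (hGb E) E),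
      hfix, sub_self]
  · exact h.isNormalizedSolution_resolvent hG hfix hmass E
  · exact fun f hf => h.ae_eq_of_isNormalizedSolution hG hG0 hfix hmass hf
  · obtain ⟨c, hc, hcb⟩ := hlow R hR.le
    obtain ⟨a, ha0, ha⟩ := hdom.bound R hR.le
    refine ⟨c, a + 1, hc, by positivity, fun E hE v => ⟨hcb E hE v, ?_⟩⟩
    have := (h.pos v).le
    exact ((le_abs_self _).trans (ha E v hE).1).trans (by gcongr; linarith)
  · exact hdom.contDiff.comp (contDiff_id.prodMk contDiff_const)
  · obtain ⟨c, hc, hcb⟩ := hlow R hR.le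
    obtain ⟨C, hC0, hC⟩ := h.exists_abs_fderiv_le hG hfix hmass hR.le
    -- The lower bound c M ≤ F converts the estimate by M into one by F; the 1 keeps the constant
    -- positive when C = 0.
    refine ⟨C / c + 1, by positivity, fun v E hE => ?_⟩
    have hFM := hcb E hE v
    have hM0 := h.pos v
    have hF0 : 0 ≤ fieldResolvent M σ G (E, v) := (by positivity : 0 ≤ c * M v).trans hFM
    have hd : HasFDerivAt (fun E' => fieldResolvent M σ G (E', v))
        ((fderiv ℝ (fieldResolvent M σ G) (E, v)).comp
          (ContinuousLinearMap.inl ℝ (Vel d) (Vel d))) E :=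
      HasFDerivAt.comp (g := fieldResolvent M σ G) E
        (hdom.contDiff.differentiable one_ne_zero _).hasFDerivAt (hasFDerivAt_prodMk_left E v)
    rw [hd.fderiv]
    have h1 : ‖(fderiv ℝ (fieldResolvent M σ G) (E, v)).comp
        (ContinuousLinearMap.inl ℝ (Vel d) (Vel d))‖ ≤ C * (M v / (1 + ‖v‖)) :=
      ContinuousLinearMap.opNorm_le_bound _ (by positivity) fun e => by
        simpa using hC E v e hE
    refine h1.trans ?_
    have h2 : C * M v ≤ (C / c + 1) * fieldResolvent M σ G (E, v) := by
      calc C * M v = C / c * (c * M v) := by field_simp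
        _ ≤ C / c * fieldResolvent M σ G (E, v) := by gcongr
        _ ≤ _ := by gcongr; linarith
    rw [← mul_div_assoc, ← mul_div_assoc]
    gcongr
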